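/- Let $\mathcal{E}_n$ be the Fomin–Kirillov algebra, i.e. the associative $\mathbb{C}$-algebra generated by $x_{ij}$, $1\le i<j\le n$, with relations $x_{ij}^2=0$; $x_{ij}x_{jk}=x_{ik}x_{ij}+x_{jk}x_{ik}$ and $x_{jk}x_{ij}=x_{ij}x_{ik}+x_{ik}x_{jk}$ for $i<j<k$; and $x_{ij}x_{kl}=x_{kl}x_{ij}$ for distinct $i,j,k,l$ (with $i<j$, $k<l$). Let $\mathcal{E}_n^+\subset\mathcal{E}_n$ be the cone of all linear combinations with nonnegative real coefficients of (noncommutative) monomials in the generators $x_{ij}$, $i<j$, and let $\theta_i=-\sum_{j<i}x_{ji}+\sum_{k>i}x_{ik}$, $1\le i\le n$, be the Dunkl elements, which commute pairwise. Let $a\ge 1$, $b\ge 2$ and let $\lambda=(b,2,1^{a-1})$ (a hook plus a box at position $(2,2)$, with $a+1$ parts). Suppose that $\lambda$ fits in a $k\times(n-k)$ rectangle, i.e. $a+1\le k$ and $k+b\le n$, and let $w(\lambda,k)\in S_n$ be the Grassmannian permutation with $w(\lambda,k)_i=\lambda_{k+1-i}+i$ for $1\le i\le k$ (where $\lambda_j=0$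 for $j>a+1$) and $w(\lambda,k)_{k+1}<\dots<w(\lambda,k)_n$. Then the Schubert polynomial $\mathfrak{S}_{w(\lambda,k)}$ and the Schur polynomial $s_\lambda$ in $k$ variables satisfy $$\mathfrak{S}_{w(\lambda,k)}(\theta_1,\dots,\theta_n)=s_\lambda(\theta_1,\dots,\theta_k)\in\mathcal{E}_n^+ .$$ -/

import Mathlib

noncomputable section

namespace FominKirillov

open MvPolynomial

/-! ### The algebra, its Dunkl elements and its nonnegative cone

All index sets are `Fin n`, that is, the indices `1, …, n` are shifted to `0, …, n - 1`. -/

/-- The pairs `i < j`, which index the generators. -/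
abbrev Gen (n : ℕ) : Type := {p : Fin n × Fin n // p.1 < p.2}

/-- The free generator with index `i < j`. -/
def freeGen {n : ℕ} (i j : Fin n) (h : i < j) : FreeAlgebra ℂ (Gen n) :=
  FreeAlgebra.ι ℂ ⟨(i, j), h⟩

/-- The defining relations of the Fomin-Kirillov algebra. -/
inductive FKRel (n : ℕ) : FreeAlgebra ℂ (Gen n) → FreeAlgebra ℂ (Gen n) → Prop
  | sq (i j : Fin n) (h : i < j) : FKRel n (freeGen i j h * freeGen i j h) 0
  | tri (i j k : Fin n) (hij : i < j) (hjk : j < k) :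
      FKRel n (freeGen i j hij * freeGen j k hjk)
        (freeGen i k (hij.trans hjk) * freeGen i j hij +
          freeGen j k hjk * freeGen i k (hij.trans hjk))
  | tri' (i j k : Fin n) (hij : i < j) (hjk : j < k) :
      FKRel n (freeGen j k hjk * freeGen i j hij)
        (freeGen i j hij * freeGen i k (hij.trans hjk) +
          freeGen i k (hij.trans hjk) * freeGen j k hjk)
  | comm (i j k l : Fin n) (hij : i < j) (hkl : k < l)
      (hik : i ≠ k) (hil : i ≠ l) (hjk : j ≠ k) (hjl : j ≠ l) :
      FKRel n (freeGen i j hij * freeGen k l hkl) (freeGen k l hkl * freeGen i j hij)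

/-- The Fomin-Kirillov algebra `ℰ_n` over `ℂ`. -/
def FKAlgebra (n : ℕ) : Type := RingQuot (FKRel n)

instance (n : ℕ) : Ring (FKAlgebra n) := inferInstanceAs (Ring (RingQuot (FKRel n)))

instance (n : ℕ) : Algebra ℂ (FKAlgebra n) := inferInstanceAs (Algebra ℂ (RingQuot (FKRel n)))

/-- The quotient map from the free algebra. -/
def mk (n : ℕ) : FreeAlgebra ℂ (Gen n) →ₐ[ℂ] FKAlgebra n := RingQuot.mkAlgHom ℂ (FKRel n)

theorem mk_rel {n : ℕ} {u v : FreeAlgebra ℂ (Gen n)} (h : FKRel n u v) : mk n u = mk n v :=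
  RingQuot.mkAlgHom_rel ℂ h

/-- The generator of `ℰ_n` indexed by a pair `i < j`. -/
def gen {n : ℕ} (p : Gen n) : FKAlgebra n :=
  mk n (FreeAlgebra.ι ℂ p)

/-- The generator `x_{ij}` for `i < j`. It is only used for `i < j`; the value for other pairs is
set to `0`. -/
def x {n : ℕ} (i j : Fin n) : FKAlgebra n :=
  if h : i < j then gen ⟨(i, j), h⟩ else 0

/-- The Dunkl element `θ_i = - ∑_{j < i} x_{ji} + ∑_{k > i} x_{ik}`. -/
def dunkl {n : ℕ} (i : Fin n) : FKAlgebra n :=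
  -(∑ j ∈ Finset.univ.filter (fun j => j < i), x j i) +
    ∑ k ∈ Finset.univ.filter (fun k => i < k), x i k

/-- The cone `ℰ_n^+` of all linear combinations, with nonnegative real coefficients, of
(noncommutative) monomials in the generators `x_{ij}`, `i < j`. -/
def cone (n : ℕ) : AddSubmonoid (FKAlgebra n) :=
  AddSubmonoid.closure
    {y | ∃ (c : ℝ) (m : List (Gen n)), 0 ≤ c ∧ y = (c : ℂ) • (m.map gen).prod}

/-! ### The Dunkl elements commute, so polynomials can be evaluated at them -/

/-- The antisymmetric version of the generators: `y_{ij} = x_{ij} = - y_{ji}` for `i < j`. -/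
def y {n : ℕ} (i j : Fin n) : FKAlgebra n := x i j - x j i

theorem x_of_lt {n : ℕ} {i j : Fin n} (h : i < j) :
    x i j = mk n (freeGen i j h) := by
  simp [x, h, gen, freeGen]

theorem x_of_not_lt {n : ℕ} {i j : Fin n} (h : ¬ i < j) : x i j = 0 := by
  simp [x, h]

theorem y_self {n : ℕ} (i : Fin n) : y i i = 0 := by simp [y]

theorem y_swap {n : ℕ} (i j : Fin n) : y j i = -y i j := by simp [y]

theorem y_of_lt {n : ℕ} {i j : Fin n} (h : i < j) : y i j = x i j := by
  simp [y, x_of_not_lt h.asymm]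

theorem dunkl_eq_sum {n : ℕ} (i : Fin n) : dunkl i = ∑ j, y i j := by
  have h1 : ∑ j ∈ Finset.univ.filter (fun j => j < i), x j i = ∑ j, x j i := by
    rw [Finset.sum_filter]
    exact Finset.sum_congr rfl fun j _ => by
      by_cases h : j < i
      · simp [h]
      · simp [h, x_of_not_lt h]
  have h2 : ∑ k ∈ Finset.univ.filter (fun k => i < k), x i k = ∑ k, x i k := by
    rw [Finset.sum_filter]
    exact Finset.sum_congr rfl fun j _ => by
      by_cases h : i < j
      · simp [h]
      · simp [h, x_of_not_lt h]
  rw [dunkl, h1, h2]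
  simp only [y, Finset.sum_sub_distrib]
  abel

theorem x_comm {n : ℕ} {i j k l : Fin n}
    (hik : i ≠ k) (hil : i ≠ l) (hjk : j ≠ k) (hjl : j ≠ l) :
    x i j * x k l = x k l * x i j := by
  by_cases hij : i < j
  · by_cases hkl : k < l
    · rw [x_of_lt hij, x_of_lt hkl, ← map_mul, ← map_mul]
      exact mk_rel (FKRel.comm i j k l hij hkl hik hil hjk hjl)
    · simp [x_of_not_lt hkl]
  · simp [x_of_not_lt hij]

theorem y_comm {n : ℕ} {i j k l : Fin n}
    (hik : i ≠ k) (hil : i ≠ l) (hjk : j ≠ k) (hjl : j ≠ l) :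
    y i j * y k l = y k l * y i j := by
  simp only [y, sub_mul, mul_sub]
  rw [x_comm hik hil hjk hjl, x_comm hil hik hjl hjk, x_comm hjk hjl hik hil,
    x_comm hjl hjk hil hik]
  abel

theorem x_tri {n : ℕ} {i j k : Fin n} (hij : i < j) (hjk : j < k) :
    x i j * x j k = x i k * x i j + x j k * x i k := by
  rw [x_of_lt hij, x_of_lt hjk, x_of_lt (hij.trans hjk), ← map_mul, ← map_mul, ← map_mul,
    ← map_add]
  exact mk_rel (FKRel.tri i j k hij hjk)

theorem x_tri' {n : ℕ} {i j k : Fin n} (hij : i < j) (hjk : j < k) :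
    x j k * x i j = x i j * x i k + x i k * x j k := by
  rw [x_of_lt hij, x_of_lt hjk, x_of_lt (hij.trans hjk), ← map_mul, ← map_mul, ← map_mul,
    ← map_add]
  exact mk_rel (FKRel.tri' i j k hij hjk)

theorem y_tri_of_lt {n : ℕ} {i j k : Fin n} (hij : i < j) (hjk : j < k) :
    y i j * y j k + y j k * y k i + y k i * y i j = 0 := by
  rw [y_swap i k, y_of_lt hij, y_of_lt hjk, y_of_lt (hij.trans hjk), x_tri hij hjk]
  simp only [mul_neg, neg_mul]
  abel

theorem y_tri_of_lt' {n : ℕ} {i j k : Fin n} (hij : i < j) (hjk : j < k) :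
    y k j * y j i + y j i * y i k + y i k * y k j = 0 := by
  rw [y_swap i j, y_swap j k, y_of_lt hij, y_of_lt hjk, y_of_lt (hij.trans hjk)]
  have := x_tri' hij hjk
  simp only [neg_mul, mul_neg, neg_neg, this]
  abel

theorem y_tri {n : ℕ} {i j k : Fin n} (hij : i ≠ j) (hjk : j ≠ k) (hik : i ≠ k) :
    y i j * y j k + y j k * y k i + y k i * y i j = 0 := by
  rcases lt_or_gt_of_ne hij with h1 | h1 <;> rcases lt_or_gt_of_ne hjk with h2 | h2 <;>
    rcases lt_or_gt_of_ne hik with h3 | h3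
  · exact y_tri_of_lt h1 h2
  · exact absurd (h1.trans h2) h3.asymm
  · rw [← y_tri_of_lt' h3 h2]; abel
  · rw [← y_tri_of_lt h3 h1]; abel
  · rw [← y_tri_of_lt' h1 h3]; abel
  · rw [← y_tri_of_lt h2 h3]; abel
  · exact absurd (h2.trans h1) h3.asymm
  · exact y_tri_of_lt' h2 h1

theorem dunkl_commute {n : ℕ} (i j : Fin n) : dunkl i * dunkl j = dunkl j * dunkl i := by
  by_cases hij : i = j
  · rw [hij]
  rw [← sub_eq_zero, dunkl_eq_sum, dunkl_eq_sum]
  have key : ∀ a b : Fin n, y i a * y j b - y j b * y i a =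
      (if a = j then y i j * y j b - y j b * y i j else 0) +
      (if b = i then y i a * y j i - y j i * y i a else 0) +
      (if a = b then y i a * y j a - y j a * y i a else 0) := by
    intro a b
    by_cases ha : a = j
    · subst ha
      by_cases hb : b = i
      · subst hb
        have h := y_swap a b
        simp [Ne.symm hij, h]
      · by_cases hab : a = b
        · subst hab
          simp [y_self, hb]
        · simp [hb, hab]
    · by_cases hb : b = i
      · subst hb
        by_cases hab : a = b
        · subst hab
          simp [y_self, ha]
        · simp [ha, hab]
      · by_cases hab : a = b
        · subst hab
          simp [ha, hb]
        · simp only [ha, hb, hab, if_false, add_zero]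
          by_cases hai : a = i
          · subst hai; simp [y_self]
          · by_cases hbj : b = j
            · subst hbj; simp [y_self]
            · rw [y_comm hij (Ne.symm hb) ha hab, sub_self]
  have e : (∑ a, y i a) * (∑ b, y j b) - (∑ b, y j b) * (∑ a, y i a) =
      ∑ c, ((y i j * y j c - y j c * y i j) + (y i c * y j i - y j i * y i c) +
        (y i c * y j c - y j c * y i c)) := by
    rw [Finset.sum_mul_sum, Finset.sum_mul_sum,
      Finset.sum_comm (f := fun b a => y j b * y i a), ← Finset.sum_sub_distrib]
    simp only [← Finset.sum_sub_distrib]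
    rw [Finset.sum_congr rfl fun a _ => Finset.sum_congr rfl fun b _ => key a b]
    simp only [Finset.sum_add_distrib]
    congr 1
    · congr 1
      · rw [Finset.sum_comm]; simp
      · simp
    · simp
  rw [e]
  refine Finset.sum_eq_zero fun c _ => ?_
  by_cases hci : c = i
  · subst hci
    have h := y_swap c j
    simp [y_self, h]
  by_cases hcj : c = j
  · subst hcj
    have h := y_swap i c
    simp [y_self, h]
  have h1 := y_tri hij (Ne.symm hcj) (Ne.symm hci)
  have h2 := y_tri (Ne.symm hij) (Ne.symm hci) (Ne.symm hcj)
  rw [y_swap i c] at h1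
  rw [y_swap j c] at h2
  have h3 := y_swap i j
  rw [h3] at h2 ⊢
  have : (y i j * y j c - y j c * y i j) + (y i c * -y i j - -y i j * y i c) +
      (y i c * y j c - y j c * y i c) =
      (y i j * y j c + y j c * -y i c + -y i c * y i j) -
        (-y i j * y i c + y i c * -y j c + -y j c * -y i j) := by
    simp only [mul_neg, neg_mul, neg_neg]
    abel
  rw [this, h1, h2, sub_zero]

/-- The subalgebra of `ℰ_n` generated by the Dunkl elements. -/
def dunklSubalgebra (n : ℕ) : Subalgebra ℂ (FKAlgebra n) :=
  Algebra.adjoin ℂ (Set.range dunkl)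

instance (n : ℕ) : IsMulCommutative (dunklSubalgebra n) :=
  Algebra.isMulCommutative_adjoin ℂ (by
    rintro _ ⟨i, rfl⟩ _ ⟨j, rfl⟩
    exact dunkl_commute i j)

open scoped IsMulCommutative in
/-- Evaluation `f ↦ f(θ_1, …, θ_n)` of polynomials at the Dunkl elements. -/
def evalDunkl (n : ℕ) : MvPolynomial (Fin n) ℂ →ₐ[ℂ] FKAlgebra n :=
  (dunklSubalgebra n).val.comp
    (aeval fun i => (⟨dunkl i, Algebra.subset_adjoin ⟨i, rfl⟩⟩ : dunklSubalgebra n))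

theorem evalDunkl_X {n : ℕ} (i : Fin n) : evalDunkl n (X i) = dunkl i := by
  simp [evalDunkl]

/-! ### Divided differences and Schubert polynomials -/

theorem dvd_map_sub_map {σ τ : Type*} (d : MvPolynomial τ ℂ)
    (φ ψ : MvPolynomial σ ℂ →ₐ[ℂ] MvPolynomial τ ℂ) (h : ∀ m, d ∣ φ (X m) - ψ (X m))
    (p : MvPolynomial σ ℂ) : d ∣ φ p - ψ p := by
  have e : (Ideal.Quotient.mkₐ ℂ (Ideal.span {d})).comp φ =
      (Ideal.Quotient.mkₐ ℂ (Ideal.span {d})).comp ψ := by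
    ext m
    simpa [Ideal.Quotient.eq, Ideal.mem_span_singleton] using h m
  have := DFunLike.congr_fun e p
  simpa [Ideal.Quotient.eq, Ideal.mem_span_singleton] using this

theorem X_sub_X_dvd_sub_swap {n : ℕ} (i j : Fin n) (f : MvPolynomial (Fin n) ℂ) :
    (X i - X j : MvPolynomial (Fin n) ℂ) ∣ f - rename (Equiv.swap i j) f := by
  refine dvd_map_sub_map (X i - X j) (AlgHom.id ℂ _) (rename (Equiv.swap i j)) (fun m => ?_) f
  by_cases hi : m = i
  · subst hi; simp
  by_cases hj : m = j
  · subst hj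
    simp only [AlgHom.id_apply, rename_X, Equiv.swap_apply_right]
    exact ⟨-1, by ring⟩
  · simp [Equiv.swap_apply_of_ne_of_ne hi hj]

/-- The divided difference `(f - s_{ij} f) / (x_i - x_j)`, where `s_{ij}` exchanges the
variables `x_i` and `x_j`; used for adjacent `i ≠ j`. -/
def dividedDiff {n : ℕ} (i j : Fin n) (f : MvPolynomial (Fin n) ℂ) : MvPolynomial (Fin n) ℂ :=
  (X_sub_X_dvd_sub_swap i j f).choose

theorem dividedDiff_spec {n : ℕ} (i j : Fin n) (f : MvPolynomial (Fin n) ℂ) :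
    f - rename (Equiv.swap i j) f = (X i - X j) * dividedDiff i j f :=
  (X_sub_X_dvd_sub_swap i j f).choose_spec

/-- `w` has an ascent at position `i`: `w(i) < w(i+1)`. -/
def IsAscent {n : ℕ} (w : Equiv.Perm (Fin n)) (i : ℕ) : Prop :=
  ∃ h : i + 1 < n, w ⟨i, Nat.lt_of_succ_lt h⟩ < w ⟨i + 1, h⟩

theorem sum_mul_swap_lt {n : ℕ} (w : Equiv.Perm (Fin n)) (a b : Fin n) (hab : a < b)
    (hw : w a < w b) :
    ∑ i : Fin n, (i : ℕ) * ((w * Equiv.swap a b) i : ℕ) < ∑ i : Fin n, (i : ℕ) * (w i : ℕ) := by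
  have hne : a ≠ b := hab.ne
  have hb : b ∈ Finset.univ.erase a := by simp [hne.symm]
  have split : ∀ f : Fin n → ℕ, ∑ i, f i = f a + (f b + ∑ i ∈ (Finset.univ.erase a).erase b, f i) := by
    intro f
    rw [Finset.add_sum_erase _ f hb, Finset.add_sum_erase _ f (Finset.mem_univ a)]
  rw [split, split]
  have hrest : ∑ i ∈ (Finset.univ.erase a).erase b, (i : ℕ) * ((w * Equiv.swap a b) i : ℕ) =
      ∑ i ∈ (Finset.univ.erase a).erase b, (i : ℕ) * (w i : ℕ) := by
    refine Finset.sum_congr rfl fun i hi => ?_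
    simp only [Finset.mem_erase, Finset.mem_univ, and_true] at hi
    simp [Equiv.swap_apply_of_ne_of_ne hi.2 hi.1]
  rw [hrest]
  simp only [Equiv.Perm.coe_mul, Function.comp_apply, Equiv.swap_apply_left,
    Equiv.swap_apply_right]
  have h1 : (a : ℕ) < b := hab
  have h2 : (w a : ℕ) < w b := hw
  nlinarith

open Classical in
/-- The Schubert polynomial `𝔖_w` of Lascoux and Schützenberger:
`𝔖_{w₀} = x_1^{n-1} x_2^{n-2} ⋯ x_{n-1}` for the longest permutation `w₀` (the one without
ascents), and `𝔖_w = ∂_i 𝔖_{w s_i}` if `w(i) < w(i+1)`. The result does not depend on the ascent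
that is used, since divided differences satisfy the braid relations; the recursion takes the
first one. -/
def schubert {n : ℕ} (w : Equiv.Perm (Fin n)) : MvPolynomial (Fin n) ℂ :=
  if h : ∃ i, IsAscent w i then
    let a : Fin n := ⟨Nat.find h, Nat.lt_of_succ_lt (Nat.find_spec h).1⟩
    let b : Fin n := ⟨Nat.find h + 1, (Nat.find_spec h).1⟩
    dividedDiff a b (schubert (w * Equiv.swap a b))
  else
    ∏ i : Fin n, X i ^ (n - 1 - (i : ℕ))
termination_by ∑ i : Fin n, (i : ℕ) * (w i : ℕ)
decreasing_by
  exact sum_mul_swap_lt w _ _ (Fin.mk_lt_mk.2 (Nat.lt_succ_self _)) (Nat.find_spec h).2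

/-! ### Partitions, Schur polynomials and Grassmannian permutations

A partition is the list of its parts, in weakly decreasing order; parts beyond the end of the
list are zero. -/

/-- The alternant `a_{λ+δ} = det (x_i^{λ_j + k - j})_{1 ≤ i, j ≤ k}` in `k` variables, for a
partition with at most `k` parts. -/
def alternant (k : ℕ) (lam : List ℕ) : MvPolynomial (Fin k) ℂ :=
  (Matrix.of fun i j : Fin k =>
    (X i : MvPolynomial (Fin k) ℂ) ^ (lam.getD (j : ℕ) 0 + (k - 1 - (j : ℕ)))).det

theorem X_sub_X_dvd_alternant (k : ℕ) (lam : List ℕ) {i j : Fin k} (hij : i ≠ j) :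
    (X j - X i : MvPolynomial (Fin k) ℂ) ∣ alternant k lam := by
  let ψ : MvPolynomial (Fin k) ℂ →ₐ[ℂ] MvPolynomial (Fin k) ℂ :=
    aeval fun m => if m = j then X i else X m
  have hd : (X j - X i : MvPolynomial (Fin k) ℂ) ∣
      AlgHom.id ℂ _ (alternant k lam) - ψ (alternant k lam) := by
    refine dvd_map_sub_map _ (AlgHom.id ℂ _) ψ (fun m => ?_) _
    by_cases hm : m = j
    · subst hm; simp [ψ]
    · simp [ψ, hm]
  have h0 : ψ (alternant k lam) = 0 := by
    rw [alternant, AlgHom.map_det]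
    refine Matrix.det_zero_of_row_eq hij ?_
    funext l
    simp [ψ, hij]
  simpa [h0] using hd

theorem irreducible_X_sub_X {k : ℕ} {i j : Fin k} (hij : i ≠ j) :
    Irreducible (X j - X i : MvPolynomial (Fin k) ℂ) := by
  have hc : coeff (Finsupp.single j 1) (X j - X i : MvPolynomial (Fin k) ℂ) = 1 := by
    have : ¬ Finsupp.single i 1 = (Finsupp.single j 1 : Fin k →₀ ℕ) := fun h =>
      hij (Finsupp.single_left_injective one_ne_zero h)
    simp [coeff_X, this]
  refine irreducible_of_totalDegree_eq_one (le_antisymm ?_ ?_) fun r hr => ?_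
  · exact (totalDegree_sub _ _).trans (by simp [totalDegree_X])
  · have := le_totalDegree (p := (X j - X i : MvPolynomial (Fin k) ℂ))
      (s := Finsupp.single j 1) (by rw [mem_support_iff, hc]; exact one_ne_zero)
    simpa using this
  · have := hr (Finsupp.single j 1)
    rw [hc] at this
    exact isUnit_of_dvd_one this

theorem alternant_nil_dvd (k : ℕ) (lam : List ℕ) : alternant k [] ∣ alternant k lam := by
  have hV : alternant k [] = Equiv.Perm.sign (Fin.revPerm (n := k)) *
      (Matrix.vandermonde (X : Fin k → MvPolynomial (Fin k) ℂ)).det := by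
    rw [← Matrix.det_permute', alternant]
    congr 1
    ext1 i j
    simp only [Matrix.of_apply, Matrix.submatrix_apply, Matrix.vandermonde_apply, id,
      Fin.revPerm_apply, Fin.val_rev, List.getD_nil, zero_add]
    congr 1
    lia
  have hu : IsUnit ((Equiv.Perm.sign (Fin.revPerm (n := k)) : ℤ) : MvPolynomial (Fin k) ℂ) :=
    (Units.isUnit (Equiv.Perm.sign (Fin.revPerm (n := k)))).map
      (Int.castRingHom (MvPolynomial (Fin k) ℂ))
  rw [hV, hu.mul_left_dvd, Matrix.det_vandermonde, Finset.prod_sigma']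
  refine Finset.prod_dvd_of_isRelPrime ?_ ?_
  · rintro ⟨i, j⟩ h ⟨i', j'⟩ h' hne
    simp only [Finset.coe_sigma, Finset.coe_univ, Finset.coe_Ioi, Set.mem_sigma_iff,
      Set.mem_univ, Set.mem_Ioi, true_and] at h h'
    refine (irreducible_X_sub_X h.ne).isRelPrime_iff_not_dvd.2 ?_
    rintro ⟨q, hq⟩
    obtain ⟨m, hm, hmi, hmj⟩ : ∃ m, (m = i' ∨ m = j') ∧ m ≠ i ∧ m ≠ j := by
      by_contra! hcon
      have h1 := hcon i' (Or.inl rfl)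
      have h2 := hcon j' (Or.inr rfl)
      have : i' = i ∧ j' = j := by
        by_cases e1 : i' = i <;> by_cases e2 : j' = i <;> grind
      exact hne (by rw [this.1, this.2])
    have := congrArg (eval (Pi.single m (1 : ℂ))) hq
    rcases hm with rfl | rfl
    · simp [hmi.symm, hmj.symm, h'.ne'] at this
    · simp [hmi.symm, hmj.symm, h'.ne] at this
  · rintro ⟨i, j⟩ h
    simp only [Finset.mem_sigma, Finset.mem_univ, Finset.mem_Ioi, true_and] at h
    exact X_sub_X_dvd_alternant k lam h.ne

/-- The Schur polynomial `s_λ(x_1, …, x_k) = a_{λ+δ} / a_δ` of a partition with at most `k`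
parts. -/
def schur (k : ℕ) (lam : List ℕ) : MvPolynomial (Fin k) ℂ :=
  (alternant_nil_dvd k lam).choose

theorem schur_spec (k : ℕ) (lam : List ℕ) : alternant k lam = alternant k [] * schur k lam :=
  (alternant_nil_dvd k lam).choose_spec

/-- `w` is the permutation `w(λ, k)` of `{1, …, n}`: `w_i = λ_{k+1-i} + i` for `1 ≤ i ≤ k`, and
`w_{k+1} < ⋯ < w_n`. In terms of indices `i` starting from `0` the first condition reads
`w_i = λ_{k-i} + i` for `0 ≤ i < k`, and `λ_{k-i}` has position `k - 1 - i` in the list. -/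
structure IsGrassmannianPerm (n k : ℕ) (lam : List ℕ) (w : Equiv.Perm (Fin n)) : Prop where
  head : ∀ i : Fin n, (i : ℕ) < k → (w i : ℕ) = lam.getD (k - 1 - (i : ℕ)) 0 + (i : ℕ)
  tail : ∀ i j : Fin n, k ≤ (i : ℕ) → i < j → w i < w j

/-- The permutation `w(λ, k)` exists if `λ` fits in a `k × (n - k)` rectangle. -/
theorem exists_isGrassmannianPerm (n k : ℕ) (lam : List ℕ) (hs : lam.SortedGE) (hk : k ≤ n)
    (hn : ∀ i, lam.getD i 0 ≤ n - k) : ∃ w, IsGrassmannianPerm n k lam w := by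
  have anti : ∀ p q : ℕ, p ≤ q → lam.getD q 0 ≤ lam.getD p 0 := by
    intro p q hpq
    by_cases hq : q < lam.length
    · rw [List.getD_eq_getElem _ _ hq, List.getD_eq_getElem _ _ (hpq.trans_lt hq)]
      exact hs.getElem_ge_getElem_of_le hpq
    · rw [List.getD_eq_default _ _ (not_lt.1 hq)]
      exact Nat.zero_le _
  let f : Fin k → Fin n := fun i => ⟨lam.getD (k - 1 - (i : ℕ)) 0 + i, by
    have := hn (k - 1 - (i : ℕ)); have := i.2; lia⟩
  have hf : StrictMono f := by
    intro i j hij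
    have h1 : (i : ℕ) < j := hij
    have h2 := anti (k - 1 - (j : ℕ)) (k - 1 - (i : ℕ)) (by lia)
    change lam.getD (k - 1 - (i : ℕ)) 0 + (i : ℕ) < lam.getD (k - 1 - (j : ℕ)) 0 + (j : ℕ)
    lia
  let s : Finset (Fin n) := Finset.univ.image f
  have hsc : s.card = k := by
    rw [Finset.card_image_of_injective _ hf.injective]; simp
  have hsc' : sᶜ.card = n - k := by rw [Finset.card_compl, hsc]; simp
  let w : Equiv.Perm (Fin n) :=
    ((finCongr (Nat.add_sub_cancel' hk).symm).trans finSumFinEquiv.symm).trans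
      (finSumEquivOfFinset hsc hsc')
  have hfe : f = s.orderEmbOfFin hsc :=
    Finset.orderEmbOfFin_unique hsc (fun i => Finset.mem_image_of_mem f (Finset.mem_univ i)) hf
  have hl : ∀ (i : Fin n) (hi : (i : ℕ) < k), w i = f ⟨i, hi⟩ := by
    intro i hi
    have : finCongr (Nat.add_sub_cancel' hk).symm i = Fin.castAdd (n - k) ⟨i, hi⟩ := rfl
    simp only [w, Equiv.trans_apply, this, finSumFinEquiv_symm_apply_castAdd,
      finSumEquivOfFinset_inl, hfe]
  have hr : ∀ (i : Fin n) (hi : k ≤ (i : ℕ)),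
      w i = sᶜ.orderEmbOfFin hsc' ⟨i - k, by have := i.2; lia⟩ := by
    intro i hi
    have : finCongr (Nat.add_sub_cancel' hk).symm i =
        Fin.natAdd k ⟨i - k, by have := i.2; lia⟩ := by
      ext; simp; lia
    simp only [w, Equiv.trans_apply, this, finSumFinEquiv_symm_apply_natAdd,
      finSumEquivOfFinset_inr]
  refine ⟨w, fun i hi => ?_, fun i j hi hij => ?_⟩
  · rw [hl i hi]
  · have h1 : (i : ℕ) < j := hij
    rw [hr i hi, hr j (by lia)]
    refine (sᶜ.orderEmbOfFin hsc').strictMono ?_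
    change (i : ℕ) - k < j - k
    lia

/-- The partition `(b, 2, 1^{a-1})`, a hook plus a box at `(2,2)`, for `a ≥ 1` and `b ≥ 2`. -/
def hookPlusBox (a b : ℕ) : List ℕ := b :: 2 :: List.replicate (a - 1) 1

end FominKirillov

end

noncomputable section
namespace FominKirillov

/-! ### Sums of words in which every row letter occurs once -/

section SumLemmas
variable {ι M : Type*} [DecidableEq ι] [AddCommMonoid M]

/-! The Schubert polynomial of a Grassmannian permutation is a Schur polynomial, and the classical
Pieri rules give `s_(b,2,1^(a-1)) = s_(b,1^a) e_1 - e_(a+1) h_b`. So it is enough to show that, at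
the Dunkl elements of the first `k` indices, `s_(b,1^a) e_1` exceeds `e_(a+1) h_b` by an element of
the cone.

Call the first `k` indices rows (`I`) and the others columns (`J`); a letter `y v u` with `v` a row
and `u` a column is a generator. The noncommutative Pieri formula `FKSystem.pieriSum_insert` writes
`e_p` as the sum of all words in which `p` chosen rows occur once each. The same formula with the
roles of rows and columns exchanged, for the negated Dunkl elements, gives `h_q`. A word of `e_p`
times a word of `h_q` is a forest on `I ∪ J`: every chosen vertex has an edge to its parent, and the
`α = |I| - p` rows and `β = |J| - q` columns that were not chosen are the roots
(`pieriSum_mul_pieriSum`).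

Forests without roots sum to zero, forests factor into trees (`splitsAt`, `forest_eq_sum`), and on a
block with at least two vertices the trees rooted at rows have the same sum as those rooted at
columns (`colTree_eq_rowTree`). Hence `e_p h_q` is a sum over set partitions into `α + β` blocks of
products of trees, with coefficient `binom(N, α - s)`, where `N` blocks have at least two vertices
and `s` are single rows: one chooses which big blocks get a row as root (`rootSum_eq`). Pascal's
rule matches `e_p h_q = s_(q+1,1^(p-1)) + s_(q,1^p)`, so the hook `s_(q,1^(p-1))` is the analogous
sum over partitions into `α + β + 1` blocks with coefficient `binom(N-1, α - s)` (`linkedSum`,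
`map_hookPoly`).

Finally `e_1` is the sum of all edges between rows and columns. Multiplying a product of trees by an
edge between two blocks merges these blocks, so it remains to bound each product of trees by the
ways to split one of its blocks and rejoin the parts by a last edge
(`blockProd_dom_sum_linkedMerge`). Every tree arises in this way (`tree_dom_mergeRight`). When `0 <
α - s < N`, summing over the `N` big blocks and elementary binomial inequalities suffice. When `α =
s` or `α - s = N`, some coefficients vanish and a sharper statement is needed: both parts may be
taken to be rooted at columns, respectively at rows (`colTree_dom_mergeRight`,
`rowTree_dom_mergeRight`). The second follows from the first by reversing words, which puts the
joining edge first; a commutator with the sum of all edges brings it to the end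
(`mergeRight_rowTree`). -/

theorem sum_erase_comm (X : Finset ι) (f : ι → ι → M) :
    ∑ v ∈ X, ∑ b ∈ X.erase v, f v b = ∑ b ∈ X, ∑ v ∈ X.erase b, f v b := by
  refine Finset.sum_comm' ?_
  intro a b
  simp only [Finset.mem_erase]
  tauto

end SumLemmas

section StarSum
variable {ι R : Type*} [DecidableEq ι] [Ring R]

open Classical in
/-- The sum of all words in the letters `z v u`, `v ∈ X`, `u ∈ Y`, in which every `v ∈ X` is used
exactly once; words are taken up to exchanging letters with different `u`. -/
def starSum (z : ι → ι → R) (X Y : Finset ι) : R :=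
  if h : Y.Nonempty then
    starSum z X (Y.erase h.choose) + ∑ v : X, z v h.choose * starSum z (X.erase v) Y
  else if X = ∅ then 1 else 0
termination_by X.card + Y.card
decreasing_by
  · have := Finset.card_erase_lt_of_mem h.choose_spec; omega
  · have := Finset.card_erase_lt_of_mem v.2; omega

theorem starSum_right_empty (z : ι → ι → R) (X : Finset ι) :
    starSum z X ∅ = if X = ∅ then 1 else 0 := by
  rw [starSum]; simp

/-- Letters with four different indices commute. -/
def LettersCommute (z : ι → ι → R) : Prop :=
  ∀ ⦃i j k l : ι⦄, i ≠ k → i ≠ l → j ≠ k → j ≠ l → z i j * z k l = z k l * z i j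

theorem exists_starSum_left (z : ι → ι → R) {Y : Finset ι} (h : Y.Nonempty) : ∃ u ∈ Y, ∀ X,
    starSum z X Y = starSum z X (Y.erase u) + ∑ v ∈ X, z v u * starSum z (X.erase v) Y := by
  refine ⟨h.choose, h.choose_spec, fun X => ?_⟩
  rw [starSum, dif_pos h, Finset.sum_coe_sort X fun v => z v h.choose * starSum z (X.erase v) Y]

/-- A word either avoids column `u`, or its first letter in column `u` can be moved to the front.
The choice of `u` in the definition does not matter: expanding by `u'` and then `u` or in the other
order differs only by exchanging two letters with four different indices. -/
theorem starSum_left {z : ι → ι → R} (hz : LettersCommute z) {X Y : Finset ι}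
    (hd : Disjoint X Y) {u : ι} (hu : u ∈ Y) :
    starSum z X Y = starSum z X (Y.erase u) + ∑ v ∈ X, z v u * starSum z (X.erase v) Y := by
  induction hm : X.card + Y.card using Nat.strong_induction_on generalizing X Y u with
  | _ m ih =>
  obtain ⟨u', hu', h⟩ := exists_starSum_left z ⟨u, hu⟩
  by_cases huu : u' = u
  · subst huu; exact h X
  have cY := Finset.card_erase_lt_of_mem hu
  have cY' := Finset.card_erase_lt_of_mem hu'
  have e1 := ih _ (by omega) (hd.mono_right (Finset.erase_subset u' Y))
    (Finset.mem_erase.2 ⟨Ne.symm huu, hu⟩) rfl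
  have e2 : starSum z X (Y.erase u) = _ := ih _ (by omega)
    (hd.mono_right (Finset.erase_subset u Y)) (Finset.mem_erase.2 ⟨huu, hu'⟩) rfl
  have e3 : ∀ v ∈ X, starSum z (X.erase v) Y = _ := fun v hv => ih _
    (by have := Finset.card_erase_lt_of_mem hv; omega)
    (hd.mono_left (Finset.erase_subset v X)) hu rfl
  have e4 : ∀ v ∈ X, starSum z (X.erase v) Y = _ := fun v hv => h (X.erase v)
  have E3 := Finset.sum_congr (rfl : X = X) fun v hv => congrArg (z v u' * ·) (e3 v hv)
  have E4 := Finset.sum_congr (rfl : X = X) fun v hv => congrArg (z v u * ·) (e4 v hv)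
  rw [h X, e1, e2, E3, E4]
  simp only [mul_add, Finset.sum_add_distrib, Finset.mul_sum]
  rw [Finset.erase_right_comm (a := u) (b := u'),
    sum_erase_comm X fun i x => z i u' * (z x u * starSum z ((X.erase i).erase x) Y)]
  have : ∑ b ∈ X, ∑ v ∈ X.erase b, z v u' * (z b u * starSum z ((X.erase v).erase b) Y) =
      ∑ b ∈ X, ∑ v ∈ X.erase b, z b u * (z v u' * starSum z ((X.erase b).erase v) Y) := by
    refine Finset.sum_congr rfl fun b hb => Finset.sum_congr rfl fun v hv => ?_
    obtain ⟨hvb, hv⟩ := Finset.mem_erase.1 hv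
    rw [← mul_assoc, ← mul_assoc, Finset.erase_right_comm,
      hz hvb (fun e => Finset.disjoint_left.1 hd hv (e ▸ hu))
        (fun e => Finset.disjoint_left.1 hd hb (e ▸ hu')) huu]
  rw [this]
  abel

theorem starSum_left_empty (z : ι → ι → R) (Y : Finset ι) : starSum z ∅ Y = 1 := by
  induction hm : Y.card using Nat.strong_induction_on generalizing Y with
  | _ m ih =>
  rcases Y.eq_empty_or_nonempty with rfl | hY
  · simp [starSum_right_empty]
  · obtain ⟨u, hu, h⟩ := exists_starSum_left z hY
    rw [h, ih _ (hm ▸ Finset.card_erase_lt_of_mem hu) _ rfl]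
    simp

theorem starSum_mem {z : ι → ι → R} {X Y : Finset ι} (C : Subsemiring R)
    (h : ∀ v ∈ X, ∀ u ∈ Y, z v u ∈ C) :
    starSum z X Y ∈ C := by
  induction hm : X.card + Y.card using Nat.strong_induction_on generalizing X Y with
  | _ m ih =>
  rcases Y.eq_empty_or_nonempty with rfl | hY
  · rw [starSum_right_empty]; split_ifs
    exacts [C.one_mem, C.zero_mem]
  · obtain ⟨u, hu, e⟩ := exists_starSum_left z hY
    rw [e]
    refine C.add_mem (ih _ ?_ ?_ rfl) (C.sum_mem fun v hv => C.mul_mem (h v hv u hu) (ih _ ?_ ?_ rfl))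
    · have := Finset.card_erase_lt_of_mem hu; omega
    · exact fun v hv w hw => h v hv w (Finset.mem_of_mem_erase hw)
    · have := Finset.card_erase_lt_of_mem hv; omega
    · exact fun w hw w' hw' => h w (Finset.mem_of_mem_erase hw) w' hw'

/-- The centralizer of `c` is a subsemiring, so membership of the letters passes to all sums of
words. -/
theorem commute_starSum {z : ι → ι → R} {X Y : Finset ι} {c : R}
    (h : ∀ v ∈ X, ∀ u ∈ Y, Commute c (z v u)) :
    Commute c (starSum z X Y) :=
  (Subsemiring.mem_centralizer_iff (s := {c})).1
    (starSum_mem (Subsemiring.centralizer {c}) fun _ hv _ hu =>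
      Subsemiring.mem_centralizer_iff.2 fun g hg => by
        rw [Set.mem_singleton_iff.1 hg]; exact h _ hv _ hu) c rfl

theorem letter_commute_starSum {z : ι → ι → R} (hz : LettersCommute z) {X Y : Finset ι} {i j : ι}
    (hiX : i ∉ X) (hiY : i ∉ Y) (hjX : j ∉ X) (hjY : j ∉ Y) : Commute (z i j) (starSum z X Y) :=
  commute_starSum fun _ hv _ hu => hz (fun e => hiX (e ▸ hv)) (fun e => hiY (e ▸ hu))
    (fun e => hjX (e ▸ hv)) (fun e => hjY (e ▸ hu))

/-- Both this expansion and `starSum_left`, applied once more to the other end, become sums over the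
first and the last letter in column `u`. The words with a single such letter agree because that
letter commutes with all words avoiding column `u`. -/
theorem starSum_right {z : ι → ι → R} (hz : LettersCommute z) {X Y : Finset ι}
    (hd : Disjoint X Y) {u : ι} (hu : u ∈ Y) :
    starSum z X Y = starSum z X (Y.erase u) + ∑ v ∈ X, starSum z (X.erase v) Y * z v u := by
  induction hm : X.card using Nat.strong_induction_on generalizing X with
  | _ m ih =>
  rw [starSum_left hz hd hu]
  congr 1
  have E3 := Finset.sum_congr (rfl : X = X) fun v hv => congrArg (z v u * ·) <| ih _
    (by have := Finset.card_erase_lt_of_mem hv; omega)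
    (hd.mono_left (Finset.erase_subset v X)) rfl
  have E4 := Finset.sum_congr (rfl : X = X) fun v hv => congrArg (· * z v u) <|
    starSum_left hz (hd.mono_left (Finset.erase_subset v X)) hu
  rw [E3, E4]
  simp only [mul_add, add_mul, Finset.sum_add_distrib, Finset.mul_sum, Finset.sum_mul]
  rw [sum_erase_comm X fun i x => z i u * (starSum z ((X.erase i).erase x) Y * z x u)]
  refine congrArg₂ _ (Finset.sum_congr rfl fun v hv => ?_)
    (Finset.sum_congr rfl fun b hb => Finset.sum_congr rfl fun v hv => ?_)
  · exact letter_commute_starSum hz (by simp)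
      (fun h => Finset.disjoint_left.1 hd hv (Finset.mem_of_mem_erase h))
      (fun h => Finset.disjoint_right.1 hd hu (Finset.mem_of_mem_erase h)) (by simp)
  · rw [Finset.erase_right_comm, mul_assoc]

end StarSum

/-! ### Antisymmetric solutions of the Fomin-Kirillov relations -/

/-- Elements `y i j` of a ring that satisfy the relations of the Fomin-Kirillov algebra in their
antisymmetric form. -/
structure FKSystem {ι R : Type*} [Ring R] (y : ι → ι → R) : Prop where
  self : ∀ i, y i i = 0
  swap : ∀ i j, y j i = -y i j
  sq : ∀ i j, y i j * y i j = 0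
  comm : LettersCommute y
  tri : ∀ ⦃i j k⦄, i ≠ j → j ≠ k → i ≠ k → y i j * y j k + y j k * y k i + y k i * y i j = 0

namespace FKSystem
variable {ι R : Type*} [Ring R] {y : ι → ι → R}

/-- Transposing the indices negates all letters, and the relations are homogeneous of degree two. -/
theorem flip (hy : FKSystem y) : FKSystem (fun i j => y j i) where
  self := hy.self
  swap i j := hy.swap j i
  sq i j := hy.sq j i
  comm i j k l h1 h2 h3 h4 := hy.comm h4 h3 h2 h1
  tri i j k h1 h2 h3 := by
    have := hy.tri h1 h2 h3
    rw [hy.swap i j, hy.swap j k, hy.swap k i]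
    simpa using this

/-- Reversing words and transposing indices is the symmetry that exchanges rows and columns below;
it turns each statement about row roots into one about column roots. -/
theorem op (hy : FKSystem y) : FKSystem (fun i j => MulOpposite.op (y j i)) where
  self i := by simp [hy.self]
  swap i j := by simp [hy.swap j i]
  sq i j := by rw [← MulOpposite.op_mul, hy.sq, MulOpposite.op_zero]
  comm i j k l h1 h2 h3 h4 := by
    rw [← MulOpposite.op_mul, ← MulOpposite.op_mul, hy.comm h4 h3 h2 h1]
  tri i j k h1 h2 h3 := by
    have := hy.tri h2.symm h1.symm h3.symm
    rw [← MulOpposite.op_mul, ← MulOpposite.op_mul, ← MulOpposite.op_mul, ← MulOpposite.op_add,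
      ← MulOpposite.op_add, MulOpposite.op_eq_zero_iff, ← this]
    abel

/-- The exchange relation at a common second index `i`. -/
theorem exchange (hy : FKSystem y) {a b i : ι} (hab : a ≠ b) (ha : a ≠ i) (hb : b ≠ i) :
    y a i * y b i = y b i * y a b - y a b * y a i := by
  have := hy.tri hab.symm ha hb
  rw [hy.swap b i, hy.swap a b] at this
  rw [eq_sub_iff_add_eq, ← sub_eq_zero, ← neg_eq_zero, ← this]
  noncomm_ring

variable [DecidableEq ι]

theorem starSum_singleton (hy : FKSystem y) {X : Finset ι} {i : ι} (hi : i ∉ X)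
    (hX : X.Nonempty) : starSum y X {i} = ∑ v ∈ X, y v i * starSum y (X.erase v) {i} := by
  rw [starSum_left hy.comm (Finset.disjoint_singleton_right.2 hi) (Finset.mem_singleton_self i)]
  simp [starSum_right_empty, hX.ne_empty]

theorem starSum_singleton_insert (hy : FKSystem y) {X : Finset ι} {a i : ι} (hi : i ∉ X)
    (ha : a ∉ X) (hai : a ≠ i) : starSum y (insert a X) {i} = y a i * starSum y X {i} +
      ∑ v ∈ X, y v i * starSum y (insert a (X.erase v)) {i} := by
  rw [hy.starSum_singleton (by simp [hi, hai.symm]) (by simp), Finset.sum_insert ha,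
    Finset.erase_insert ha]
  congr 1
  refine Finset.sum_congr rfl fun v hv => ?_
  rw [Finset.erase_insert_of_ne (ne_of_mem_of_not_mem hv ha).symm]

theorem letter_comm_singleton (hy : FKSystem y) {X : Finset ι} {a b i : ι} (ha : a ∉ X)
    (hb : b ∉ X) (hai : a ≠ i) (hbi : b ≠ i) : Commute (y a b) (starSum y X {i}) :=
  letter_commute_starSum hy.comm ha (by simpa) hb (by simpa)

/-- In the words for `insert a X` the letter `y a i` stands in every possible position. By
`exchange` it moves past `y b i` at the cost of two terms with `y a b`, which commutes with the
letters of the other rows. The induction strips the first letter `y v i`. -/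
theorem starSum_insert_singleton (hy : FKSystem y) {X : Finset ι} {a i : ι} (hi : i ∉ X)
    (ha : a ∉ X) (hai : a ≠ i) :
    starSum y (insert a X) {i} = starSum y X {i} * y a i +
      ∑ b ∈ X, (starSum y X {i} * y a b - y a b * starSum y (insert a (X.erase b)) {i}) := by
  induction X using Finset.strongInduction with
  | _ X ih =>
  rcases X.eq_empty_or_nonempty with rfl | hX
  · rw [hy.starSum_singleton_insert hi ha hai]
    simp [starSum_left_empty]
  rw [hy.starSum_singleton_insert hi ha hai]
  have E := Finset.sum_congr (rfl : X = X) fun v hv => congrArg (y v i * ·) <|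
    ih (X.erase v) (Finset.erase_ssubset hv) (fun h => hi (Finset.mem_of_mem_erase h))
      (fun h => ha (Finset.mem_of_mem_erase h))
  have E1 : starSum y X {i} * y a i + ∑ b ∈ X, starSum y X {i} * y a b =
      ∑ v ∈ X, (y v i * starSum y (X.erase v) {i} * y a i +
        y v i * starSum y (X.erase v) {i} * y a v +
        ∑ b ∈ X.erase v, y v i * starSum y (X.erase v) {i} * y a b) := by
    rw [hy.starSum_singleton hi hX]
    simp only [Finset.sum_mul, Finset.sum_add_distrib]
    rw [add_assoc]
    congr 1
    rw [Finset.sum_comm, ← Finset.sum_add_distrib]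
    exact Finset.sum_congr rfl fun v hv => (Finset.add_sum_erase X _ hv).symm
  have E2 : ∑ b ∈ X, y a b * starSum y (insert a (X.erase b)) {i} =
      ∑ v ∈ X, y a v * y a i * starSum y (X.erase v) {i} +
        ∑ v ∈ X, ∑ b ∈ X.erase v, y v i * (y a b *
          starSum y (insert a ((X.erase v).erase b)) {i}) := by
    rw [sum_erase_comm X, ← Finset.sum_add_distrib]
    refine Finset.sum_congr rfl fun b hb => ?_
    rw [hy.starSum_singleton_insert (fun h => hi (Finset.mem_of_mem_erase h))
      (fun h => ha (Finset.mem_of_mem_erase h)) hai, mul_add, Finset.mul_sum, mul_assoc]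
    congr 1
    refine Finset.sum_congr rfl fun v hv => ?_
    obtain ⟨hvb, hv⟩ := Finset.mem_erase.1 hv
    rw [← mul_assoc, ← mul_assoc, Finset.erase_right_comm,
      hy.comm (ne_of_mem_of_not_mem hv ha).symm hai (Ne.symm hvb) (ne_of_mem_of_not_mem hb hi)]
  rw [Finset.sum_sub_distrib, ← add_sub_assoc, E1, E2]
  have E0 : y a i * starSum y X {i} = ∑ v ∈ X, y a i * y v i * starSum y (X.erase v) {i} := by
    rw [hy.starSum_singleton hi hX, Finset.mul_sum]
    simp only [mul_assoc]
  rw [E, E0, ← Finset.sum_add_distrib, ← Finset.sum_add_distrib, ← Finset.sum_sub_distrib]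
  refine Finset.sum_congr rfl fun v hv => ?_
  have hav : a ≠ v := fun e => ha (e ▸ hv)
  have hvi : v ≠ i := fun e => hi (e ▸ hv)
  have c := (hy.letter_comm_singleton (X := X.erase v) (i := i)
    (fun h => ha (Finset.mem_of_mem_erase h)) (by simp) hai hvi).eq
  have := hy.exchange hav hai hvi
  rw [mul_assoc (y v i) _ (y a v), ← c, ← mul_assoc (y v i), this]
  simp only [Finset.sum_sub_distrib, mul_add, mul_sub, Finset.mul_sum, sub_mul, mul_assoc]
  abel

/-- The words in one column that begin and end with the same letter, with every other letter used
once, cancel cyclically. One row `a` is singled out and its letter moved to the end of the inner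
word by `starSum_insert_singleton`; the terms left over cancel by induction and `exchange`. -/
theorem sum_letter_starSum_letter (hy : FKSystem y) {X : Finset ι} {i : ι} (hi : i ∉ X) :
    ∑ v ∈ X, y v i * starSum y (X.erase v) {i} * y v i = 0 := by
  induction hm : X.card using Nat.strong_induction_on generalizing X with
  | _ m ih =>
  rcases X.eq_empty_or_nonempty with rfl | ⟨a, haX⟩
  · simp
  obtain ⟨Z, ha, rfl⟩ : ∃ Z, a ∉ Z ∧ insert a Z = X := ⟨X.erase a, by simp, Finset.insert_erase haX⟩
  have hiZ : i ∉ Z := fun h => hi (Finset.mem_insert_of_mem h)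
  have hai : a ≠ i := fun e => hi (by simp [e])
  rw [Finset.card_insert_of_notMem ha] at hm
  rw [Finset.sum_insert ha, Finset.erase_insert ha]
  have E := Finset.sum_congr (rfl : Z = Z) fun v hv =>
    (show y v i * starSum y ((insert a Z).erase v) {i} * y v i = _ by
      rw [Finset.erase_insert_of_ne (ne_of_mem_of_not_mem hv ha).symm,
        hy.starSum_insert_singleton (fun h => hiZ (Finset.mem_of_mem_erase h))
          (fun h => ha (Finset.mem_of_mem_erase h)) hai])
  -- The induction hypothesis is needed for `Z` and for every set in which one `b ∈ Z` is replaced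
  -- by `a`.
  have C1 := ih Z.card (by omega) hiZ rfl
  have C2 : ∀ b ∈ Z, y a i * starSum y (Z.erase b) {i} * y a i +
      ∑ v ∈ Z.erase b, y v i * starSum y (insert a ((Z.erase b).erase v)) {i} * y v i = 0 := by
    intro b hb
    have hab : a ∉ Z.erase b := fun h => ha (Finset.mem_of_mem_erase h)
    have := ih (insert a (Z.erase b)).card
      (by rw [Finset.card_insert_of_notMem hab]; have := Finset.card_erase_lt_of_mem hb; omega)
      (X := insert a (Z.erase b)) (by simp [hai.symm, hiZ]) rfl
    rw [Finset.sum_insert hab, Finset.erase_insert hab] at this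
    rw [← this]
    congr 1
    refine Finset.sum_congr rfl fun v hv => ?_
    rw [Finset.erase_insert_of_ne (ne_of_mem_of_not_mem hv hab).symm]
  have E1 : ∑ v ∈ Z, ∑ b ∈ Z.erase v, y v i * starSum y (Z.erase v) {i} * (y v i * y a b) =
      - ∑ v ∈ Z, y v i * starSum y (Z.erase v) {i} * y v i * y a v := by
    rw [sum_erase_comm, eq_neg_iff_add_eq_zero, ← Finset.sum_add_distrib]
    refine Finset.sum_eq_zero fun b hb => ?_
    rw [add_comm, ← Finset.add_sum_erase Z _ hb] at *
    have := congrArg (· * y a b) C1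
    simp only [zero_mul, Finset.sum_mul, add_mul, mul_assoc] at this
    simpa [mul_assoc] using this
  have E2 : ∑ v ∈ Z, ∑ b ∈ Z.erase v,
      y a b * (y v i * starSum y (insert a ((Z.erase v).erase b)) {i} * y v i) =
      - ∑ v ∈ Z, y a v * (y a i * starSum y (Z.erase v) {i} * y a i) := by
    rw [sum_erase_comm, eq_neg_iff_add_eq_zero, ← Finset.sum_add_distrib]
    refine Finset.sum_eq_zero fun b hb => ?_
    have := congrArg (y a b * ·) (C2 b hb)
    simp only [mul_zero, mul_add, Finset.mul_sum] at this
    rw [add_comm, ← this]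
    congr 1
    refine Finset.sum_congr rfl fun v _ => ?_
    rw [Finset.erase_right_comm]
  rcases Z.eq_empty_or_nonempty with rfl | hZ
  · simp [starSum_left_empty, hy.sq]
  have E0 : y a i * starSum y Z {i} * y a i =
      ∑ v ∈ Z, y a i * y v i * starSum y (Z.erase v) {i} * y a i := by
    rw [hy.starSum_singleton hiZ hZ, Finset.mul_sum, Finset.sum_mul]
    simp only [mul_assoc]
  have E3 : ∑ v ∈ Z, y v i * starSum y ((insert a Z).erase v) {i} * y v i =
      ∑ v ∈ Z, y v i * starSum y (Z.erase v) {i} * y a i * y v i +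
      (∑ v ∈ Z, ∑ b ∈ Z.erase v, y v i * starSum y (Z.erase v) {i} * (y v i * y a b) -
      ∑ v ∈ Z, ∑ b ∈ Z.erase v,
        y a b * (y v i * starSum y (insert a ((Z.erase v).erase b)) {i} * y v i)) := by
    rw [E, ← Finset.sum_sub_distrib, ← Finset.sum_add_distrib]
    refine Finset.sum_congr rfl fun v hv => ?_
    rw [← Finset.sum_sub_distrib, mul_add, add_mul]
    congr 1
    · simp only [mul_assoc]
    rw [Finset.mul_sum, Finset.sum_mul]
    refine Finset.sum_congr rfl fun b hb => ?_
    obtain ⟨hbv, hb⟩ := Finset.mem_erase.1 hb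
    have c := hy.comm (ne_of_mem_of_not_mem hv ha).symm hai hbv (ne_of_mem_of_not_mem hb hiZ)
    have c' : ∀ r, y a b * (y v i * r) = y v i * (y a b * r) := fun r => by
      rw [← mul_assoc, c, mul_assoc]
    simp only [mul_sub, sub_mul, mul_assoc, c, c']
  rw [E0, E3, E1, E2, ← Finset.sum_neg_distrib, ← Finset.sum_neg_distrib,
    ← Finset.sum_sub_distrib, ← Finset.sum_add_distrib, ← Finset.sum_add_distrib]
  refine Finset.sum_eq_zero fun v hv => ?_
  have hav : a ≠ v := (ne_of_mem_of_not_mem hv ha).symm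
  have hvi : v ≠ i := ne_of_mem_of_not_mem hv hiZ
  have c := (hy.letter_comm_singleton (X := Z.erase v) (i := i)
    (fun h => ha (Finset.mem_of_mem_erase h)) (by simp) hai hvi).eq
  have := hy.exchange hav hai hvi
  rw [mul_assoc _ (y a i) (y v i), this]
  have c' : ∀ r, y a v * (starSum y (Z.erase v) {i} * r) =
      starSum y (Z.erase v) {i} * (y a v * r) := fun r => by rw [← mul_assoc, c, mul_assoc]
  simp only [mul_sub, sub_mul, mul_assoc, c']
  abel

/-- With the first letter `y w i` stripped, the factors `y v i` with `v ≠ w` contribute zero by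
induction, and `v = w` gives `sum_letter_starSum_letter`. -/
theorem starSum_singleton_mul_sum (hy : FKSystem y) {X : Finset ι} {i : ι} (hi : i ∉ X) :
    ∑ v ∈ X, starSum y X {i} * y v i = 0 := by
  induction X using Finset.strongInduction with
  | _ X ih =>
  rcases X.eq_empty_or_nonempty with rfl | hX
  · simp
  rw [hy.starSum_singleton hi hX]
  simp only [Finset.sum_mul]
  rw [Finset.sum_comm, ← hy.sum_letter_starSum_letter hi]
  refine Finset.sum_congr rfl fun v hv => ?_
  rw [← Finset.add_sum_erase X _ hv]
  have := ih (X.erase v) (Finset.erase_ssubset hv) (fun h => hi (Finset.mem_of_mem_erase h))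
  simp only [mul_assoc]
  rw [← Finset.mul_sum, this, mul_zero, add_zero]

end FKSystem

/-! ### Turning a column into a row -/

namespace FKSystem
variable {ι R : Type*} [Ring R] {y : ι → ι → R} [DecidableEq ι]

/-- By `exchange`, `y i u * y v u = y v i * y i u - y v u * y v i`. So a letter `y i u` that travels
through the word to the right turns column `u` into column `i`, and the corrections are words that
end with a letter of column `i`. -/
theorem letter_mul_starSum (hy : FKSystem y) {X Y : Finset ι} {i u : ι} (hd : Disjoint X Y)
    (hiX : i ∉ X) (hiY : i ∉ Y) (huX : u ∉ X) (huY : u ∉ Y) (hiu : i ≠ u) :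
    y i u * starSum y X (insert u Y) = starSum y X (insert i Y) * y i u -
      ∑ v ∈ X, y v u * starSum y (X.erase v) (insert u (insert i Y)) * y v i := by
  induction X using Finset.strongInduction with
  | _ X ih =>
  have L1 : ∀ {X' : Finset ι}, X' ⊆ X → ∀ {j}, j ∉ X → j ∉ Y →
      starSum y X' (insert j Y) = starSum y X' Y +
        ∑ v ∈ X', y v j * starSum y (X'.erase v) (insert j Y) := by
    intro X' hX' j hjX hjY
    rw [starSum_left hy.comm (Finset.disjoint_insert_right.2 ⟨fun h => hjX (hX' h),
      hd.mono_left hX'⟩) (Finset.mem_insert_self j Y), Finset.erase_insert hjY]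
  have L2 : ∀ v ∈ X, starSum y (X.erase v) (insert u (insert i Y)) =
      starSum y (X.erase v) (insert u Y) + ∑ w ∈ X.erase v, y w i *
        starSum y ((X.erase v).erase w) (insert u (insert i Y)) := by
    intro v _
    rw [starSum_left hy.comm (X := X.erase v) (u := i) _ (by simp)]
    · rw [Finset.erase_insert_of_ne hiu.symm, Finset.erase_insert hiY]
    · simp only [Finset.disjoint_insert_right, Finset.mem_erase]
      exact ⟨fun h => huX h.2, fun h => hiX h.2, hd.mono_left (Finset.erase_subset _ _)⟩
  have IH : ∀ v ∈ X, y i u * starSum y (X.erase v) (insert u Y) = _ := fun v hv =>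
    ih (X.erase v) (Finset.erase_ssubset hv) (hd.mono_left (Finset.erase_subset _ _))
      (fun h => hiX (Finset.mem_of_mem_erase h)) (fun h => huX (Finset.mem_of_mem_erase h))
  have c0 : y i u * starSum y X Y = starSum y X Y * y i u :=
    letter_commute_starSum hy.comm hiX hiY huX huY
  have E1 : ∑ v ∈ X, y i u * (y v u * starSum y (X.erase v) (insert u Y)) =
      ∑ v ∈ X, y v i * (starSum y (X.erase v) (insert i Y) * y i u) -
      ∑ v ∈ X, ∑ w ∈ X.erase v, y v i * (y w u *
        starSum y ((X.erase v).erase w) (insert u (insert i Y)) * y w i) -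
      ∑ v ∈ X, y v u * (y v i * starSum y (X.erase v) (insert u Y)) := by
    simp only [← Finset.sum_sub_distrib]
    refine Finset.sum_congr rfl fun v hv => ?_
    have hvi : v ≠ i := ne_of_mem_of_not_mem hv hiX
    have := hy.exchange hvi.symm hiu (ne_of_mem_of_not_mem hv huX)
    rw [hy.swap v i, mul_neg, neg_mul, sub_neg_eq_add] at this
    rw [← mul_assoc, this, add_mul, mul_assoc (y v i), IH v hv, mul_sub, Finset.mul_sum]
    simp only [neg_mul, mul_assoc]
    abel
  have E2 : ∑ v ∈ X, y v u * starSum y (X.erase v) (insert u (insert i Y)) * y v i =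
      ∑ v ∈ X, y v u * (y v i * starSum y (X.erase v) (insert u Y)) +
      ∑ v ∈ X, ∑ w ∈ X.erase v, y v i * (y w u *
        starSum y ((X.erase v).erase w) (insert u (insert i Y)) * y w i) := by
    rw [sum_erase_comm, ← Finset.sum_add_distrib]
    refine Finset.sum_congr rfl fun v hv => ?_
    have c : y v i * starSum y (X.erase v) (insert u Y) =
        starSum y (X.erase v) (insert u Y) * y v i := by
      refine letter_commute_starSum hy.comm (by simp) ?_
        (fun h => hiX (Finset.mem_of_mem_erase h)) (by simp [hiu, hiY])
      simp only [Finset.mem_insert, not_or]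
      exact ⟨ne_of_mem_of_not_mem hv huX, Finset.disjoint_left.1 hd hv⟩
    rw [L2 v hv, mul_add, add_mul, c, mul_assoc]
    congr 1
    rw [Finset.mul_sum, Finset.sum_mul]
    refine Finset.sum_congr rfl fun w hw => ?_
    obtain ⟨hwv, hw⟩ := Finset.mem_erase.1 hw
    rw [Finset.erase_right_comm, ← mul_assoc (y v u), ← mul_assoc (y w i), ← mul_assoc (y w i),
      hy.comm hwv (ne_of_mem_of_not_mem hw huX) (ne_of_mem_of_not_mem hv hiX).symm hiu]
  rw [L1 subset_rfl huX huY, L1 subset_rfl hiX hiY, mul_add, Finset.mul_sum, E1, E2, c0, add_mul,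
    Finset.sum_mul]
  simp only [mul_assoc]
  abel

/-- The core of the Pieri formula: the right factor is the Dunkl element of `i` for the index set
`insert i (X ∪ Y)`. The induction removes a column `u` from both sides; the new letter `y i u` is
then handled by `letter_mul_starSum`. -/
theorem starSum_insert (hy : FKSystem y) {X Y : Finset ι} {i : ι} (hd : Disjoint X Y)
    (hiX : i ∉ X) (hiY : i ∉ Y) : starSum y (insert i X) Y =
      starSum y X (insert i Y) * (∑ j ∈ Y, y i j - ∑ v ∈ X, y v i) := by
  induction hm : X.card + Y.card using Nat.strong_induction_on generalizing X Y with
  | _ m ih =>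
  rcases Y.eq_empty_or_nonempty with rfl | ⟨u, hu⟩
  -- Without columns the left side is zero because row `i` cannot be used, and the right side is the
  -- vanishing product of `starSum_singleton_mul_sum`.
  · have := hy.starSum_singleton_mul_sum hiX
    rw [← Finset.mul_sum] at this
    simp [starSum_right_empty, this]
  obtain ⟨Z, huZ, rfl⟩ : ∃ Z, u ∉ Z ∧ insert u Z = Y := ⟨Y.erase u, by simp, Finset.insert_erase hu⟩
  rw [Finset.card_insert_of_notMem huZ] at hm
  have huX : u ∉ X := fun h => Finset.disjoint_left.1 hd h hu
  have hiu : i ≠ u := fun e => hiY (by simp [e])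
  have hiZ : i ∉ Z := fun h => hiY (Finset.mem_insert_of_mem h)
  have hdZ : Disjoint X Z := hd.mono_right (Finset.subset_insert _ _)
  have A1 : starSum y (insert i X) (insert u Z) = starSum y (insert i X) Z +
      (y i u * starSum y X (insert u Z) +
        ∑ v ∈ X, y v u * starSum y (insert i (X.erase v)) (insert u Z)) := by
    rw [starSum_left hy.comm (Finset.disjoint_insert_left.2 ⟨hiY, hd⟩) hu,
      Finset.erase_insert huZ, Finset.sum_insert hiX, Finset.erase_insert hiX]
    congr 2
    refine Finset.sum_congr rfl fun v hv => ?_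
    rw [Finset.erase_insert_of_ne (ne_of_mem_of_not_mem hv hiX).symm]
  have A2 : starSum y X (insert i (insert u Z)) = starSum y X (insert i Z) +
      ∑ v ∈ X, y v u * starSum y (X.erase v) (insert u (insert i Z)) := by
    rw [Finset.insert_comm, starSum_left hy.comm _ (Finset.mem_insert_self u _),
      Finset.erase_insert (by simp [hiu.symm, huZ])]
    simp [Finset.disjoint_insert_right, *]
  have I1 := ih _ (by omega) hdZ hiX hiZ rfl
  have I2 := Finset.sum_congr (rfl : X = X) fun v hv => congrArg (y v u * ·) <|
    ih (X := X.erase v) (Y := insert u Z) _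
      (by rw [Finset.card_insert_of_notMem huZ]; have := Finset.card_erase_lt_of_mem hv; omega)
      (hd.mono_left (Finset.erase_subset _ _)) (fun h => hiX (Finset.mem_of_mem_erase h)) hiY rfl
  have I3 : ∑ v ∈ X, y v u * (starSum y (X.erase v) (insert i (insert u Z)) *
      (∑ j ∈ insert u Z, y i j - ∑ w ∈ X.erase v, y w i)) =
      (∑ v ∈ X, y v u * starSum y (X.erase v) (insert u (insert i Z))) *
      (∑ j ∈ insert u Z, y i j - ∑ w ∈ X, y w i) +
      ∑ v ∈ X, y v u * starSum y (X.erase v) (insert u (insert i Z)) * y v i := by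
    rw [Finset.sum_mul, ← Finset.sum_add_distrib]
    refine Finset.sum_congr rfl fun v hv => ?_
    rw [Finset.insert_comm, ← mul_assoc, ← mul_add, ← Finset.add_sum_erase X _ hv]
    congr 1
    abel
  rw [A1, A2, I1, I2, I3, hy.letter_mul_starSum hdZ hiX hiZ huX huZ hiu, Finset.sum_insert huZ]
  noncomm_ring

end FKSystem

/-! ### The Pieri formula for elementary symmetric polynomials in Dunkl elements -/

section Pieri
variable {ι R : Type*} [Ring R] [DecidableEq ι]

/-- The Dunkl elements of the index set `S`. -/
def dunklSum (y : ι → ι → R) (S : Finset ι) (i : ι) : R := ∑ j ∈ S, y i j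

/-- The expansion of the elementary symmetric polynomials in the Dunkl elements `dunklSum y S i`,
`i ∈ G`, into words. -/
def pieriSum (y : ι → ι → R) (S G : Finset ι) (p : ℕ) : R :=
  ∑ X ∈ G.powersetCard p, starSum y X (S \ G)

theorem pieriSum_zero (y : ι → ι → R) (S G : Finset ι) : pieriSum y S G 0 = 1 := by
  simp [pieriSum, starSum_left_empty]

theorem pieriSum_empty (y : ι → ι → R) (S : Finset ι) (p : ℕ) : pieriSum y S ∅ (p + 1) = 0 := by
  rw [pieriSum, Finset.powersetCard_eq_empty.2 (by simp), Finset.sum_empty]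

theorem pieriSum_of_card_lt (y : ι → ι → R) (S : Finset ι) {G : Finset ι} {p : ℕ}
    (h : G.card < p) : pieriSum y S G p = 0 := by
  rw [pieriSum, Finset.powersetCard_eq_empty.2 h, Finset.sum_empty]

theorem sum_powersetCard_succ_eq {M : Type*} [AddCommMonoid M] (G : Finset ι) (p : ℕ)
    (f : ι → Finset ι → M) :
    ∑ X ∈ G.powersetCard p, ∑ v ∈ G \ X, f v X =
      ∑ X ∈ G.powersetCard (p + 1), ∑ v ∈ X, f v (X.erase v) := by
  rw [Finset.sum_sigma', Finset.sum_sigma']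
  refine Finset.sum_bij' (fun a _ => ⟨insert a.2 a.1, a.2⟩) (fun a _ => ⟨a.1.erase a.2, a.2⟩)
    ?_ ?_ ?_ ?_ ?_
  · rintro ⟨X, v⟩ h
    simp only [Finset.mem_sigma, Finset.mem_powersetCard, Finset.mem_sdiff] at h ⊢
    refine ⟨⟨Finset.insert_subset h.2.1 h.1.1, ?_⟩, by simp⟩
    rw [Finset.card_insert_of_notMem h.2.2, h.1.2]
  · rintro ⟨X, v⟩ h
    simp only [Finset.mem_sigma, Finset.mem_powersetCard, Finset.mem_sdiff] at h ⊢
    refine ⟨⟨(Finset.erase_subset _ _).trans h.1.1, ?_⟩, h.1.1 h.2, by simp⟩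
    rw [Finset.card_erase_of_mem h.2, h.1.2]; rfl
  · rintro ⟨X, v⟩ h
    simp only [Finset.mem_sigma, Finset.mem_sdiff] at h
    simp [Finset.erase_insert h.2.2]
  · rintro ⟨X, v⟩ h
    simp only [Finset.mem_sigma] at h
    simp [Finset.insert_erase h.2]
  · rintro ⟨X, v⟩ h
    simp only [Finset.mem_sigma, Finset.mem_sdiff] at h
    simp [Finset.erase_insert h.2.2]

/-- The Pieri formula. -/
theorem FKSystem.pieriSum_insert {y : ι → ι → R} (hy : FKSystem y) {S G : Finset ι} {i : ι}
    (hG : G ⊆ S) (hiS : i ∈ S) (hi : i ∉ G) (p : ℕ) : pieriSum y S (insert i G) (p + 1) =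
      pieriSum y S G (p + 1) + pieriSum y S G p * dunklSum y S i := by
  obtain ⟨Y, hY⟩ : ∃ Y, Y = S \ insert i G := ⟨_, rfl⟩
  have hYG : S \ G = insert i Y := by
    rw [hY]; ext j; by_cases h : j = i <;> simp [h, hiS, hi]
  have hiY : i ∉ Y := by simp [hY]
  have hS : S = insert i (Y ∪ G) := by
    rw [← Finset.insert_union, ← hYG, Finset.sdiff_union_of_subset hG]
  have hdG : Disjoint G Y := by
    rw [hY]; exact Finset.disjoint_of_subset_left (Finset.subset_insert i G) Finset.disjoint_sdiff
  have hθ : dunklSum y S i = ∑ j ∈ Y, y i j - ∑ v ∈ G, y v i := by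
    rw [dunklSum, hS, Finset.sum_insert (by simp [hiY, hi]), hy.self, zero_add,
      Finset.sum_union hdG.symm, sub_eq_add_neg, ← Finset.sum_neg_distrib]
    simp only [hy.swap _ i]
  -- The rows chosen from `insert i G` contain `i` or not.
  have e1 : pieriSum y S (insert i G) (p + 1) = ∑ X ∈ G.powersetCard (p + 1), starSum y X Y +
      ∑ X ∈ G.powersetCard p, starSum y (insert i X) Y := by
    rw [pieriSum, Finset.powersetCard_succ_insert hi, Finset.sum_union, ← hY, Finset.sum_image]
    · intro X hX X' hX' e
      rw [← Finset.erase_insert (fun h => hi ((Finset.mem_powersetCard.1 hX).1 h)), e,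
        Finset.erase_insert (fun h => hi ((Finset.mem_powersetCard.1 hX').1 h))]
    · rw [Finset.disjoint_left]
      intro X hX hX'
      obtain ⟨Z, -, rfl⟩ := Finset.mem_image.1 hX'
      exact hi ((Finset.mem_powersetCard.1 hX).1 (Finset.mem_insert_self i Z))
  -- For `G` the index `i` is still a column. Its last letters `y v i`, reindexed by the set without
  -- `v`, supply the part `v ∈ G \ X` of the Dunkl element, which is cancelled against the same part
  -- of `dunklSum y S i`; what remains is the factor in `starSum_insert`.
  have e2 : pieriSum y S G (p + 1) = ∑ X ∈ G.powersetCard (p + 1), starSum y X Y +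
      ∑ X ∈ G.powersetCard p, ∑ v ∈ G \ X, starSum y X (insert i Y) * y v i := by
    rw [sum_powersetCard_succ_eq G p fun v X => starSum y X (insert i Y) * y v i,
      ← Finset.sum_add_distrib, pieriSum, hYG]
    refine Finset.sum_congr rfl fun X hX => ?_
    have hXG := (Finset.mem_powersetCard.1 hX).1
    rw [starSum_right hy.comm _ (Finset.mem_insert_self i Y), Finset.erase_insert hiY]
    exact Finset.disjoint_insert_right.2 ⟨fun h => hi (hXG h), hdG.mono_left hXG⟩
  rw [e1, e2, add_assoc]
  congr 1
  rw [pieriSum, Finset.sum_mul, ← Finset.sum_add_distrib, hYG, hθ]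
  refine Finset.sum_congr rfl fun X hX => ?_
  have hXG := (Finset.mem_powersetCard.1 hX).1
  rw [hy.starSum_insert (hdG.mono_left hXG) (fun h => hi (hXG h)) hiY, ← Finset.mul_sum, ← mul_add,
    ← Finset.sum_sdiff hXG]
  congr 1
  abel

end Pieri

/-! ### Consequences of the Pieri formula: commuting Dunkl elements and vanishing products -/

namespace FKSystem
variable {ι R : Type*} [Ring R] {y : ι → ι → R} [DecidableEq ι] {S G H : Finset ι}

theorem pieriSum_singleton (hy : FKSystem y) {i : ι} (hi : i ∈ S) :
    pieriSum y S {i} 1 = dunklSum y S i := by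
  have := hy.pieriSum_insert (Finset.empty_subset S) hi (Finset.notMem_empty i) 0
  simpa [pieriSum_empty, pieriSum_zero] using this

/-- The top Pieri sum of the unordered set `{i, j}` is the product of the two Dunkl elements in
either order. -/
theorem dunklSum_commute (hy : FKSystem y) {i j : ι} (hi : i ∈ S) (hj : j ∈ S) :
    Commute (dunklSum y S i) (dunklSum y S j) := by
  by_cases hij : i = j
  · rw [hij]
  have h : ∀ {i j : ι}, i ∈ S → j ∈ S → i ≠ j →
      pieriSum y S {j, i} 2 = dunklSum y S i * dunklSum y S j := by
    intro i j hi hj hij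
    rw [hy.pieriSum_insert (Finset.singleton_subset_iff.2 hi) hj (by simpa using Ne.symm hij) 1,
      hy.pieriSum_singleton hi, pieriSum_of_card_lt y S (by simp), zero_add]
  rw [Commute, SemiconjBy, ← h hi hj hij, ← h hj hi (Ne.symm hij), Finset.pair_comm]

/-- By the Pieri formula `pieriSum` is built from the Dunkl elements of `G` by sums and products. -/
theorem commute_pieriSum (hy : FKSystem y) (hG : G ⊆ S) {c : R}
    (hc : ∀ i ∈ G, Commute c (dunklSum y S i)) (p : ℕ) : Commute c (pieriSum y S G p) := by
  induction G using Finset.induction_on generalizing p with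
  | empty =>
    cases p with
    | zero => rw [pieriSum_zero]; exact Commute.one_right c
    | succ p => rw [pieriSum_empty]; exact Commute.zero_right c
  | insert i G hi ih =>
    cases p with
    | zero => rw [pieriSum_zero]; exact Commute.one_right c
    | succ p =>
      obtain ⟨hiS, hG⟩ := Finset.insert_subset_iff.1 hG
      rw [hy.pieriSum_insert hG hiS hi]
      have ih' := ih hG fun j hj => hc j (Finset.mem_insert_of_mem hj)
      exact (ih' _).add_right ((ih' p).mul_right (hc i (Finset.mem_insert_self i G)))

theorem dunklSum_flip (hy : FKSystem y) (i : ι) :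
    dunklSum (fun i j => y j i) S i = -dunklSum y S i := by
  simp only [dunklSum, hy.swap i, Finset.sum_neg_distrib]

theorem dunklSum_commute_pieriSum (hy : FKSystem y) (hG : G ⊆ S) {i : ι} (hi : i ∈ S) (p : ℕ) :
    Commute (dunklSum y S i) (pieriSum y S G p) :=
  hy.commute_pieriSum hG (fun _ hj => hy.dunklSum_commute hi (hG hj)) p

theorem pieriSum_card (y : ι → ι → R) (S G : Finset ι) :
    pieriSum y S G G.card = starSum y G (S \ G) := by
  rw [pieriSum, Finset.powersetCard_self, Finset.sum_singleton]

theorem pieriSum_card_insert (hy : FKSystem y) (hG : G ⊆ S) {i : ι} (hiS : i ∈ S) (hi : i ∉ G) :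
    pieriSum y S (insert i G) (insert i G).card = pieriSum y S G G.card * dunklSum y S i := by
  rw [Finset.card_insert_of_notMem hi, hy.pieriSum_insert hG hiS hi,
    pieriSum_of_card_lt y S (Nat.lt_succ_self _), zero_add]

/-- A top Pieri sum is the product of the Dunkl elements of its set, and transposing the letters
changes the sign of each of them. -/
theorem pieriSum_card_mul_flip (hy : FKSystem y) (hG : G ⊆ S) (hH : H ⊆ S) (hd : Disjoint G H) :
    pieriSum y S G G.card * pieriSum (fun i j => y j i) S H H.card =
      (-1) ^ H.card * pieriSum y S (G ∪ H) (G ∪ H).card := by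
  induction H using Finset.induction_on with
  | empty => simp [pieriSum_zero]
  | insert i H hi ih =>
    obtain ⟨hiS, hH⟩ := Finset.insert_subset_iff.1 hH
    obtain ⟨hiG, hd⟩ := Finset.disjoint_insert_right.1 hd
    rw [hy.flip.pieriSum_card_insert hH hiS hi, hy.dunklSum_flip, ← mul_assoc, ih hH hd,
      Finset.union_insert, hy.pieriSum_card_insert (Finset.union_subset hG hH) hiS (by simp [*]),
      Finset.card_insert_of_notMem hi, pow_succ]
    simp only [mul_neg, mul_one, neg_mul, mul_assoc]

/-- Up to sign this is the product of the Dunkl elements of all indices in `G ∪ H`, which is the sum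
of the words with every index used as a row; as no columns are left, there are none. -/
theorem starSum_mul_flip_eq_zero (hy : FKSystem y) (hd : Disjoint G H) (hne : (G ∪ H).Nonempty) :
    starSum y G H * starSum (fun i j => y j i) H G = 0 := by
  have := hy.pieriSum_card_mul_flip (S := G ∪ H) Finset.subset_union_left
    Finset.subset_union_right hd
  rw [pieriSum_card, pieriSum_card, pieriSum_card, Finset.union_sdiff_cancel_left hd,
    Finset.union_sdiff_cancel_right hd, Finset.sdiff_self, starSum_right_empty,
    if_neg hne.ne_empty, mul_zero] at this
  exact this

end FKSystem

theorem starSum_op {ι R : Type*} [Ring R] [DecidableEq ι] {z : ι → ι → R} (hz : LettersCommute z)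
    {X Y : Finset ι} (hd : Disjoint X Y) :
    starSum (fun i j => MulOpposite.op (z i j)) X Y = MulOpposite.op (starSum z X Y) := by
  induction hm : X.card + Y.card using Nat.strong_induction_on generalizing X Y with
  | _ m ih =>
  rcases Y.eq_empty_or_nonempty with rfl | ⟨u, hu⟩
  · simp only [starSum_right_empty]; split_ifs <;> simp
  have hz' : LettersCommute fun i j => MulOpposite.op (z i j) := fun i j k l h1 h2 h3 h4 => by
    rw [← MulOpposite.op_mul, ← MulOpposite.op_mul, hz h1 h2 h3 h4]
  rw [starSum_left hz' hd hu, starSum_right hz hd hu, ih _ _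
    (hd.mono_right (Finset.erase_subset _ _)) rfl, MulOpposite.op_add, Finset.op_sum]
  · congr 1
    refine Finset.sum_congr rfl fun v hv => ?_
    rw [ih _ _ (hd.mono_left (Finset.erase_subset _ _)) rfl, MulOpposite.op_mul]
    have := Finset.card_erase_lt_of_mem hv; omega
  · have := Finset.card_erase_lt_of_mem hu; omega

/-! ### Rooted forests -/

section Forest
variable {ι R : Type*} [Ring R] [DecidableEq ι]

/-- The sum of the words of all forests with vertex set `S` and set of roots `Q`, with rows `I`
and columns `J`. Every row that is not a root has an edge to its parent, and this edge comes
before all other edges at the row; every column that is not a root has an edge to its parent, and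
this edge comes after all other edges at the column. -/
def forest (y : ι → ι → R) (I J Q S : Finset ι) : R :=
  starSum y ((S ∩ I) \ Q) (S ∩ J) * starSum (fun i j => y j i) ((S ∩ J) \ Q) (S ∩ I)

theorem forest_mem {y : ι → ι → R} {I J S : Finset ι} (C : Subsemiring R) (Q : Finset ι)
    (h : ∀ v ∈ S ∩ I, ∀ u ∈ S ∩ J, y v u ∈ C) : forest y I J Q S ∈ C :=
  C.mul_mem (starSum_mem C fun v hv u hu => h v (Finset.sdiff_subset hv) u hu)
    (starSum_mem C fun v hv u hu => h u hu v (Finset.sdiff_subset hv))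

theorem forest_root (y : ι → ι → R) (I J : Finset ι) (q : ι) : forest y I J {q} {q} = 1 := by
  have : ∀ K : Finset ι, ({q} ∩ K) \ {q} = ∅ := fun K => by ext; simp; tauto
  rw [forest, this, this, starSum_left_empty, starSum_left_empty, one_mul]

theorem forest_empty (y : ι → ι → R) (I J : Finset ι) : forest y I J ∅ ∅ = 1 := by
  simp [forest, starSum_left_empty]

namespace FKSystem
variable {y : ι → ι → R} {I J Q S S' : Finset ι}

theorem letter_commute_forest (hy : FKSystem y) {i j : ι} (hi : i ∉ S) (hj : j ∉ S) :
    Commute (y i j) (forest y I J Q S) := by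
  have h : ∀ {k : ι} {K : Finset ι}, k ∉ S → k ∉ S ∩ K :=
    fun hk h => hk (Finset.mem_of_mem_inter_left h)
  have h' : ∀ {k : ι} {K : Finset ι}, k ∉ S → k ∉ (S ∩ K) \ Q :=
    fun hk h => hk (Finset.mem_of_mem_inter_left (Finset.sdiff_subset h))
  exact (letter_commute_starSum hy.comm (h' hi) (h hi) (h' hj) (h hj)).mul_right
    (letter_commute_starSum hy.flip.comm (h' hj) (h hj) (h' hi) (h hi))

theorem commute_forest (hy : FKSystem y) (hd : Disjoint S S') (Q Q' : Finset ι) :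
    Commute (forest y I J Q S) (forest y I J Q' S') :=
  (Subsemiring.mem_centralizer_iff (s := {forest y I J Q S})).1
    (forest_mem (Subsemiring.centralizer {forest y I J Q S}) Q' fun v hv u hu =>
      Subsemiring.mem_centralizer_iff.2 fun g hg => by
        rw [Set.mem_singleton_iff.1 hg]
        exact (hy.letter_commute_forest
          (Finset.disjoint_right.1 hd (Finset.mem_of_mem_inter_left hv))
          (Finset.disjoint_right.1 hd (Finset.mem_of_mem_inter_left hu))).symm.eq) _ rfl

/-- This is `starSum_mul_flip_eq_zero` in the language of forests: if every vertex has an edge to a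
parent, there is a cycle, and these words cancel. -/
theorem forest_no_root (hy : FKSystem y) (hIJ : ∀ i, i ∈ I ↔ i ∉ J) (hS : S.Nonempty) :
    forest y I J ∅ S = 0 := by
  rw [forest, Finset.sdiff_empty, Finset.sdiff_empty]
  refine hy.starSum_mul_flip_eq_zero ?_ ?_
  · exact Finset.disjoint_left.2 fun i h h' =>
      (hIJ i).1 (Finset.mem_of_mem_inter_right h) (Finset.mem_of_mem_inter_right h')
  · obtain ⟨i, hi⟩ := hS
    refine ⟨i, ?_⟩
    have := hIJ i
    simp only [Finset.mem_union, Finset.mem_inter]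
    tauto

theorem forest_op (hy : FKSystem y) (hIJ : ∀ i, i ∈ I ↔ i ∉ J) :
    forest (fun i j => MulOpposite.op (y j i)) J I Q S = MulOpposite.op (forest y I J Q S) := by
  have hd : Disjoint (S ∩ I) (S ∩ J) := Finset.disjoint_left.2 fun i h h' =>
      (hIJ i).1 (Finset.mem_of_mem_inter_right h) (Finset.mem_of_mem_inter_right h')
  rw [forest, forest, MulOpposite.op_mul, starSum_op hy.comm (hd.mono_left Finset.sdiff_subset),
    starSum_op hy.flip.comm (hd.symm.mono_left Finset.sdiff_subset)]

/-- If the root `v` has no child it is isolated and can be deleted. Otherwise the last edge at `v`,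
to a child `u`, can be moved to the end of the word; deleting it makes `u` a root. -/
theorem forest_row (hy : FKSystem y) (hIJ : ∀ i, i ∈ I ↔ i ∉ J) {v : ι} (hvI : v ∈ I) (hvQ : v ∈ Q)
    (hvS : v ∈ S) : forest y I J Q S = forest y I J (Q.erase v) (S.erase v) +
      ∑ u ∈ (S ∩ J) \ Q, forest y I J (insert u Q) S * y v u := by
  have hd : Disjoint (S ∩ J) (S ∩ I) := Finset.disjoint_left.2 fun i h h' =>
      (hIJ i).1 (Finset.mem_of_mem_inter_right h') (Finset.mem_of_mem_inter_right h)
  have hvJ := (hIJ v).1 hvI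
  rw [forest, starSum_right hy.flip.comm (hd.mono_left Finset.sdiff_subset)
    (Finset.mem_inter.2 ⟨hvS, hvI⟩), mul_add, Finset.mul_sum, forest]
  have e1 : S.erase v ∩ J = S ∩ J := by ext i; simp only [Finset.mem_inter, Finset.mem_erase]; grind
  have e2 : (S.erase v ∩ I) \ Q.erase v = (S ∩ I) \ Q := by
    ext i; simp only [Finset.mem_inter, Finset.mem_erase, Finset.mem_sdiff]; grind
  have e3 : (S ∩ J) \ Q.erase v = (S ∩ J) \ Q := by
    ext i; simp only [Finset.mem_inter, Finset.mem_erase, Finset.mem_sdiff]; grind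
  rw [e1, e2, e3, ← Finset.erase_inter]
  congr 1
  refine Finset.sum_congr rfl fun u hu => ?_
  have huJ := Finset.mem_of_mem_inter_right (Finset.sdiff_subset hu)
  have e4 : (S ∩ I) \ insert u Q = (S ∩ I) \ Q := by
    have := hIJ u
    ext i; simp only [Finset.mem_inter, Finset.mem_insert, Finset.mem_sdiff]; grind
  have e5 : (S ∩ J) \ insert u Q = ((S ∩ J) \ Q).erase u := by
    ext i; simp only [Finset.mem_inter, Finset.mem_insert, Finset.mem_sdiff, Finset.mem_erase]; grind
  rw [forest, e4, e5, mul_assoc]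

/-- Trees that are rooted at a row. -/
def _root_.FominKirillov.rowTree (y : ι → ι → R) (I J S : Finset ι) : R :=
  ∑ v ∈ S ∩ I, forest y I J {v} S

/-- Trees that are rooted at a column. -/
def _root_.FominKirillov.colTree (y : ι → ι → R) (I J S : Finset ι) : R :=
  ∑ u ∈ S ∩ J, forest y I J {u} S

theorem rowTree_op (hy : FKSystem y) (hIJ : ∀ i, i ∈ I ↔ i ∉ J) :
    rowTree (fun i j => MulOpposite.op (y j i)) J I S = MulOpposite.op (colTree y I J S) := by
  simp only [rowTree, colTree, hy.forest_op hIJ, Finset.op_sum]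

/-- The column edges of a tree rooted at `v` are expanded by the first one that ends at `v`; the
part without such an edge is a forest on `S.erase v` without roots. The result has a marked edge `y
v u` between the row edges and the column edges, and it is symmetric under exchanging rows and
columns. -/
theorem rowTree_eq_sum (hy : FKSystem y) (hIJ : ∀ i, i ∈ I ↔ i ∉ J) (hS : 2 ≤ S.card) :
    rowTree y I J S = ∑ v ∈ S ∩ I, ∑ u ∈ S ∩ J, starSum y ((S ∩ I).erase v) (S ∩ J) * y v u *
      starSum (fun i j => y j i) ((S ∩ J).erase u) (S ∩ I) := by
  have hd : Disjoint (S ∩ J) (S ∩ I) := Finset.disjoint_left.2 fun i h h' =>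
      (hIJ i).1 (Finset.mem_of_mem_inter_right h') (Finset.mem_of_mem_inter_right h)
  refine Finset.sum_congr rfl fun v hv => ?_
  obtain ⟨hvS, hvI⟩ := Finset.mem_inter.1 hv
  have h0 := hy.forest_no_root (S := S.erase v) hIJ (by
    rw [← Finset.card_pos, Finset.card_erase_of_mem hvS]; omega)
  have e1 : S.erase v ∩ J = S ∩ J := by
    have := hIJ v
    ext i; simp only [Finset.mem_inter, Finset.mem_erase]; grind
  rw [forest, e1, Finset.erase_inter, Finset.sdiff_empty, Finset.sdiff_empty] at h0
  rw [forest, Finset.sdiff_singleton_eq_erase, Finset.sdiff_singleton_eq_erase,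
    Finset.erase_eq_of_notMem (Finset.disjoint_right.1 hd hv), starSum_left hy.flip.comm hd hv,
    mul_add, h0, zero_add, Finset.mul_sum]
  simp only [mul_assoc]

/-- The symmetric expression in `rowTree_eq_sum` is compared with its image under word reversal: the
root may be moved along the marked edge. -/
theorem colTree_eq_rowTree (hy : FKSystem y) (hIJ : ∀ i, i ∈ I ↔ i ∉ J) (hS : 2 ≤ S.card) :
    colTree y I J S = rowTree y I J S := by
  have hJI : ∀ i, i ∈ J ↔ i ∉ I := fun i => by rw [hIJ, not_not]
  have := hy.op.rowTree_eq_sum hJI hS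
  rw [hy.rowTree_op hIJ] at this
  apply MulOpposite.op_injective
  rw [this, hy.rowTree_eq_sum hIJ hS, Finset.sum_comm, Finset.op_sum]
  refine Finset.sum_congr rfl fun v hv => ?_
  rw [Finset.op_sum]
  refine Finset.sum_congr rfl fun u hu => ?_
  have hd : Disjoint (S ∩ I) (S ∩ J) := Finset.disjoint_left.2 fun i h h' =>
      (hIJ i).1 (Finset.mem_of_mem_inter_right h) (Finset.mem_of_mem_inter_right h')
  rw [starSum_op hy.comm (hd.mono_left (Finset.erase_subset _ _)),
    starSum_op hy.flip.comm (hd.symm.mono_left (Finset.erase_subset _ _)), MulOpposite.op_mul,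
    MulOpposite.op_mul, mul_assoc]

end FKSystem
end Forest

theorem sum_powerset_powerset {ι M : Type*} [DecidableEq ι] [AddCommMonoid M] (S : Finset ι)
    (f : Finset ι → Finset ι → M) :
    ∑ B ∈ S.powerset, ∑ C ∈ B.powerset, f C (B \ C) =
      ∑ C ∈ S.powerset, ∑ D ∈ (S \ C).powerset, f C D := by
  rw [Finset.sum_sigma', Finset.sum_sigma']
  refine Finset.sum_bij' (fun a _ => ⟨a.2, a.1 \ a.2⟩) (fun a _ => ⟨a.1 ∪ a.2, a.1⟩)
    ?_ ?_ ?_ ?_ ?_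
  · rintro ⟨B, C⟩ h
    simp only [Finset.mem_sigma, Finset.mem_powerset] at h ⊢
    exact ⟨h.2.trans h.1, Finset.sdiff_subset_sdiff h.1 subset_rfl⟩
  · rintro ⟨C, D⟩ h
    simp only [Finset.mem_sigma, Finset.mem_powerset] at h ⊢
    exact ⟨Finset.union_subset h.1 (h.2.trans Finset.sdiff_subset), Finset.subset_union_left⟩
  · rintro ⟨B, C⟩ h
    simp only [Finset.mem_sigma, Finset.mem_powerset] at h
    simp [Finset.union_sdiff_of_subset h.2]
  · rintro ⟨C, D⟩ h
    simp only [Finset.mem_sigma, Finset.mem_powerset] at h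
    have : Disjoint C D := (Finset.disjoint_of_subset_right h.2 Finset.disjoint_sdiff)
    simp [Finset.union_sdiff_cancel_left this]
  · intros; rfl

/-! ### Splitting off the tree of one root from a forest -/

section Split
variable {ι R : Type*} [Ring R] [DecidableEq ι]

/-- The decomposition of the forests on `S` according to the tree with root `q`. -/
def SplitsAt (y : ι → ι → R) (I J Q S : Finset ι) (q : ι) : Prop :=
  forest y I J Q S = ∑ B ∈ S.powerset,
    if B ∩ Q = {q} then forest y I J {q} B * forest y I J (Q.erase q) (S \ B) else 0

namespace FKSystem
variable {y : ι → ι → R} {I J Q S S' : Finset ι}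

theorem splitsAt_op (hy : FKSystem y) (hIJ : ∀ i, i ∈ I ↔ i ∉ J) {q : ι} :
    SplitsAt (fun i j => MulOpposite.op (y j i)) J I Q S q ↔ SplitsAt y I J Q S q := by
  rw [SplitsAt, SplitsAt, hy.forest_op hIJ, ← MulOpposite.op_inj (x := forest y I J Q S),
    Finset.op_sum]
  refine Eq.congr_right (Finset.sum_congr (M := Rᵐᵒᵖ) rfl fun B _ => ?_)
  split_ifs
  · rw [hy.forest_op hIJ, hy.forest_op hIJ, ← MulOpposite.op_mul,
      (hy.commute_forest Finset.disjoint_sdiff _ _).eq]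
  · rfl

/-- Both sides are expanded by the last edge `y v u` at the root `v`. Making `u` a root lowers the
number of vertices that are not roots, so by induction the trees of `v` and `u` split off in turn;
together they form the tree of `v` in the original forest. -/
theorem splitsAt_row (hy : FKSystem y) (hIJ : ∀ i, i ∈ I ↔ i ∉ J) {m : ℕ}
    (ih : ∀ Q S q, Q ⊆ S → q ∈ Q → (S \ Q).card < m → SplitsAt y I J Q S q)
    {v : ι} (hvI : v ∈ I) (hvQ : v ∈ Q) (hQS : Q ⊆ S) (hm : (S \ Q).card = m) :
    SplitsAt y I J Q S v := by
  have hvJ : v ∉ J := (hIJ v).1 hvI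
  have hvS := hQS hvQ
  -- `C` is the vertex set of the tree of `v` once the edge to `u` is cut, and `D` that of the tree
  -- of `u`.
  let cond : ι → Finset ι → Finset ι → Prop := fun u C D =>
    C ∩ insert u Q = {v} ∧ D ∩ insert u (Q.erase v) = {u}
  let T : ι → Finset ι → Finset ι → R := fun u C D =>
    forest y I J {v} C * forest y I J {u} D * forest y I J (Q.erase v) (S \ (C ∪ D)) * y v u
  have lhs : ∀ u ∈ (S ∩ J) \ Q, forest y I J (insert u Q) S * y v u =
      ∑ C ∈ S.powerset, ∑ D ∈ (S \ C).powerset, if cond u C D then T u C D else 0 := by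
    intro u hu
    obtain ⟨huSJ, huQ⟩ := Finset.mem_sdiff.1 hu
    obtain ⟨huS, huJ⟩ := Finset.mem_inter.1 huSJ
    have huv : u ≠ v := fun e => huQ (e ▸ hvQ)
    have hlt : (S \ insert u Q).card < m := by
      rw [← hm]
      refine Finset.card_lt_card (Finset.ssubset_iff_of_subset
        (Finset.sdiff_subset_sdiff subset_rfl (Finset.subset_insert u Q)) |>.2 ⟨u, ?_, ?_⟩) <;>
        simp [huS, huQ]
    rw [ih (insert u Q) S v (Finset.insert_subset huS hQS) (Finset.mem_insert_of_mem hvQ) hlt,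
      Finset.sum_mul]
    refine Finset.sum_congr rfl fun C hC => ?_
    by_cases hCQ : C ∩ insert u Q = {v}
    · rw [if_pos hCQ]
      have e : (insert u Q).erase v = insert u (Q.erase v) := Finset.erase_insert_of_ne huv
      have hsub : insert u (Q.erase v) ⊆ S \ C := by
        intro i hi
        rw [← e] at hi
        obtain ⟨h1, h2⟩ := Finset.mem_erase.1 hi
        refine Finset.mem_sdiff.2 ⟨Finset.insert_subset huS hQS h2, fun h3 => h1 ?_⟩
        have := Finset.mem_inter.2 ⟨h3, h2⟩
        rwa [hCQ, Finset.mem_singleton] at this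
      rw [e, ih (insert u (Q.erase v)) (S \ C) u hsub (Finset.mem_insert_self _ _)
        ((Finset.card_le_card ?_).trans_lt hlt), Finset.mul_sum, Finset.sum_mul]
      · refine Finset.sum_congr rfl fun D _ => ?_
        by_cases hD : D ∩ insert u (Q.erase v) = {u}
        · rw [if_pos hD, if_pos ⟨hCQ, hD⟩, Finset.erase_insert (by simp [huQ]),
            Finset.sdiff_sdiff_left']
          simp only [T, mul_assoc, Finset.sdiff_union_distrib]
        · rw [if_neg hD, if_neg fun h => hD h.2, mul_zero, zero_mul]
      · have hvC : v ∈ C := by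
          have := Finset.mem_singleton_self v
          rw [← hCQ] at this; exact Finset.mem_of_mem_inter_left this
        intro i hi
        simp only [Finset.mem_sdiff, Finset.mem_insert, Finset.mem_erase, not_or, not_and] at hi ⊢
        exact ⟨hi.1.1, hi.2.1, fun h => hi.2.2 (fun e => hi.1.2 (e ▸ hvC)) h⟩
    · rw [if_neg hCQ, zero_mul]
      exact (Finset.sum_eq_zero fun D _ => if_neg fun h => hCQ h.1).symm
  have rhs : ∀ B ∈ S.powerset, (if B ∩ Q = {v} then
      forest y I J {v} B * forest y I J (Q.erase v) (S \ B) else 0) =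
      (if B = {v} then forest y I J (Q.erase v) (S.erase v) else 0) +
      ∑ u ∈ (S ∩ J) \ Q, ∑ C ∈ B.powerset, if cond u C (B \ C) then T u C (B \ C) else 0 := by
    intro B hB
    have hBS := Finset.mem_powerset.1 hB
    by_cases hBQ : B ∩ Q = {v}
    · have hvB : v ∈ B := by
        have := Finset.mem_singleton_self v
        rw [← hBQ] at this; exact Finset.mem_of_mem_inter_left this
      rw [if_pos hBQ, hy.forest_row hIJ hvI (Finset.mem_singleton_self v) hvB, add_mul]
      congr 1
      · rw [Finset.erase_singleton]
        by_cases hBv : B = {v}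
        · rw [if_pos hBv, hBv, Finset.erase_singleton, forest_empty, one_mul,
            Finset.sdiff_singleton_eq_erase]
        -- If `v` is isolated but `B` has further vertices, a forest without roots remains.
        · rw [if_neg hBv, hy.forest_no_root hIJ, zero_mul]
          exact (Finset.erase_nonempty hvB).2 ((Finset.nontrivial_iff_ne_singleton hvB).2 hBv)
      · have hsub : (B ∩ J) \ {v} ⊆ (S ∩ J) \ Q := by
          intro i hi
          simp only [Finset.mem_sdiff, Finset.mem_inter, Finset.mem_singleton] at hi ⊢
          refine ⟨⟨hBS hi.1.1, hi.1.2⟩, fun h => hi.2 ?_⟩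
          have := Finset.mem_inter.2 ⟨hi.1.1, h⟩
          rwa [hBQ, Finset.mem_singleton] at this
        rw [Finset.sum_mul]
        refine Finset.sum_subset_zero_on_sdiff hsub (fun u hu => ?_) fun u hu => ?_
        -- Vertices `u` outside of `B` are added to the range of summation without changing the sum,
        -- so that it no longer depends on `B`.
        · refine Finset.sum_eq_zero fun C _ => if_neg fun h => ?_
          have huB : u ∈ (B \ C) ∩ insert u (Q.erase v) := by
            rw [h.2]; exact Finset.mem_singleton_self u
          have huB := (Finset.mem_sdiff.1 (Finset.mem_of_mem_inter_left huB)).1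
          simp only [Finset.mem_sdiff, Finset.mem_inter, Finset.mem_singleton] at hu
          exact hu.2 ⟨⟨huB, hu.1.1.2⟩, fun e => hvJ (e ▸ hu.1.1.2)⟩
        · have huQ := (Finset.mem_sdiff.1 (hsub hu)).2
          simp only [Finset.mem_sdiff, Finset.mem_inter, Finset.mem_singleton] at hu
          have hlt : (B \ insert u {v}).card < m := by
            rw [← hm]
            refine Finset.card_lt_card ((Finset.ssubset_iff_of_subset ?_).2 ⟨u, ?_, ?_⟩)
            · intro i hi
              simp only [Finset.mem_sdiff, Finset.mem_insert, Finset.mem_singleton] at hi ⊢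
              refine ⟨hBS hi.1, fun h => hi.2 (Or.inr ?_)⟩
              have := Finset.mem_inter.2 ⟨hi.1, h⟩
              rwa [hBQ, Finset.mem_singleton] at this
            · exact Finset.mem_sdiff.2 ⟨hBS hu.1.1, huQ⟩
            · simp
          rw [ih (insert u {v}) B v (Finset.insert_subset hu.1.1 (Finset.singleton_subset_iff.2 hvB))
            (by simp) hlt, mul_assoc, (hy.letter_commute_forest (i := v) (j := u)
              (fun h => (Finset.mem_sdiff.1 h).2 hvB)
              (fun h => (Finset.mem_sdiff.1 h).2 hu.1.1)).eq, Finset.sum_mul]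
          refine Finset.sum_congr rfl fun C hC => ?_
          have hCB := Finset.mem_powerset.1 hC
          have hiff : C ∩ insert u {v} = {v} ↔ cond u C (B \ C) := by
            simp only [cond, Finset.ext_iff, Finset.mem_inter, Finset.mem_insert, Finset.mem_sdiff,
              Finset.mem_erase, Finset.mem_singleton] at hBQ ⊢
            constructor
            · intro h
              exact ⟨fun i => by have := h i; have := hBQ i; have := @hCB i; grind,
                fun i => by have := h i; have := h u; have := h v; have := hBQ i; grind⟩
            · rintro ⟨h, -⟩ i
              have := h i; have := h v; grind
          by_cases hc : cond u C (B \ C)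
          · rw [if_pos hc, if_pos (hiff.2 hc)]
            have e : (insert u {v} : Finset ι).erase v = {u} := by
              rw [Finset.erase_insert_of_ne hu.2, Finset.erase_singleton]; rfl
            simp only [T, e, Finset.union_sdiff_of_subset hCB, mul_assoc]
          · rw [if_neg hc, if_neg fun h => hc (hiff.1 h), zero_mul]
    · rw [if_neg hBQ, if_neg, zero_add]
      · refine (Finset.sum_eq_zero fun u hu => Finset.sum_eq_zero fun C hC => if_neg ?_).symm
        rintro ⟨h1, h2⟩
        have hCB := Finset.mem_powerset.1 hC
        refine hBQ ?_
        simp only [Finset.ext_iff, Finset.mem_inter, Finset.mem_insert, Finset.mem_sdiff,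
          Finset.mem_erase, Finset.mem_singleton] at h1 h2 hu ⊢
        intro i
        have := h1 i; have := h2 i; have := h1 v; have := @hCB i
        grind
      · rintro rfl
        exact hBQ (by simpa using hvQ)
  rw [SplitsAt, hy.forest_row hIJ hvI hvQ hvS, Finset.sum_congr rfl lhs,
    Finset.sum_congr rfl rhs, Finset.sum_add_distrib]
  congr 1
  · rw [Finset.sum_ite_eq', if_pos (by simpa using hvS)]
  · rw [Finset.sum_comm (s := S.powerset) (t := (S ∩ J) \ Q)]
    refine Finset.sum_congr rfl fun u _ => ?_
    exact (sum_powerset_powerset S fun C D => if cond u C D then T u C D else 0).symm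

/-- For a column root the row case is applied in the opposite ring, so the induction has to run over
both kinds of roots simultaneously. -/
theorem splitsAt (hy : FKSystem y) (hIJ : ∀ i, i ∈ I ↔ i ∉ J) (hQS : Q ⊆ S) {q : ι} (hq : q ∈ Q) :
    SplitsAt y I J Q S q := by
  induction hm : (S \ Q).card using Nat.strong_induction_on generalizing Q S q with
  | _ m ih =>
  by_cases hqI : q ∈ I
  · exact hy.splitsAt_row hIJ (fun Q S q h1 h2 h3 => ih _ h3 h1 h2 rfl) hqI hq hQS hm
  · have hJI : ∀ i, i ∈ J ↔ i ∉ I := fun i => by rw [hIJ, not_not]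
    exact (hy.splitsAt_op hIJ).1 (hy.op.splitsAt_row hJI
      (fun Q S q h1 h2 h3 => (hy.splitsAt_op hIJ).2 (ih _ h3 h1 h2 rfl)) ((hJI q).2 hqI) hq hQS hm)

end FKSystem
end Split

/-! ### Domination with respect to a cone -/

section Dom
variable {R : Type*} [Ring R]

/-- `b` exceeds `a` by an element of the cone `C`. -/
def Dom (C : Subsemiring R) (a b : R) : Prop := b - a ∈ C

namespace Dom
variable {C : Subsemiring R} {a b c d : R}

theorem refl (C : Subsemiring R) (a : R) : Dom C a a := by
  rw [Dom, sub_self]; exact C.zero_mem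

theorem trans (h : Dom C a b) (h' : Dom C b c) : Dom C a c := by
  rw [Dom, ← sub_add_sub_cancel c b a]; exact C.add_mem h' h

theorem add (h : Dom C a b) (h' : Dom C c d) : Dom C (a + c) (b + d) := by
  rw [Dom, add_sub_add_comm]; exact C.add_mem h h'

theorem of_mem (h : a ∈ C) : Dom C 0 a := by rwa [Dom, sub_zero]

theorem sum {α : Type*} {s : Finset α} {f g : α → R} (h : ∀ i ∈ s, Dom C (f i) (g i)) :
    Dom C (∑ i ∈ s, f i) (∑ i ∈ s, g i) := by
  rw [Dom, ← Finset.sum_sub_distrib]; exact C.sum_mem h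

theorem mul_left (hc : c ∈ C) (h : Dom C a b) : Dom C (c * a) (c * b) := by
  rw [Dom, ← mul_sub]; exact C.mul_mem hc h

theorem mul_right (hc : c ∈ C) (h : Dom C a b) : Dom C (a * c) (b * c) := by
  rw [Dom, ← sub_mul]; exact C.mul_mem h hc

theorem mul (h : Dom C a b) (h' : Dom C c d) (ha : a ∈ C) (hd : d ∈ C) :
    Dom C (a * c) (b * d) :=
  (mul_left ha h').trans (mul_right hd h)

theorem sum_subset {α : Type*} {s t : Finset α} {f : α → R} (hst : s ⊆ t)
    (h : ∀ i ∈ t, f i ∈ C) : Dom C (∑ i ∈ s, f i) (∑ i ∈ t, f i) := by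
  classical
  rw [Dom, ← Finset.sum_sdiff hst, add_sub_cancel_right]
  exact C.sum_mem fun i hi => h i (Finset.sdiff_subset hi)

theorem single_le_sum {α : Type*} {s : Finset α} {f : α → R} {i : α} (hi : i ∈ s)
    (h : ∀ i ∈ s, f i ∈ C) : Dom C (f i) (∑ i ∈ s, f i) := by
  rw [← Finset.sum_singleton f i]
  exact sum_subset (Finset.singleton_subset_iff.2 hi) h

end Dom
end Dom

theorem sum_powerset_sdiff {ι M : Type*} [DecidableEq ι] [AddCommMonoid M] (S : Finset ι)
    (f : Finset ι → M) : ∑ B ∈ S.powerset, f (S \ B) = ∑ B ∈ S.powerset, f B := by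
  refine Finset.sum_nbij' (S \ ·) (S \ ·) ?_ ?_ ?_ ?_ ?_
  · intro B _; exact Finset.mem_powerset.2 Finset.sdiff_subset
  · intro B _; exact Finset.mem_powerset.2 Finset.sdiff_subset
  · intro B hB; exact Finset.sdiff_sdiff_eq_self (Finset.mem_powerset.1 hB)
  · intro B hB; exact Finset.sdiff_sdiff_eq_self (Finset.mem_powerset.1 hB)
  · intros; rfl

/-! ### Cutting trees at an edge -/

section Trees
variable {ι R : Type*} [Ring R] [DecidableEq ι]

/-- The sum of the words of all trees with vertex set `S`, with one term for each of them; it is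
set to `1` for a single vertex. -/
def tree (y : ι → ι → R) (I J S : Finset ι) : R := if S.card = 1 then 1 else rowTree y I J S

/-- The sum of all ways to split `S` into two sets and to connect these by an edge at the end. -/
def mergeRight (y : ι → ι → R) (I J : Finset ι) (f g : Finset ι → R) (S : Finset ι) : R :=
  ∑ B ∈ S.powerset, ∑ v ∈ B ∩ I, ∑ u ∈ (S \ B) ∩ J, f B * g (S \ B) * y v u

/-- The sum of all ways to split `S` into two sets and to connect these by an edge at the
beginning. -/
def mergeLeft (y : ι → ι → R) (I J : Finset ι) (f g : Finset ι → R) (S : Finset ι) : R :=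
  ∑ B ∈ S.powerset, ∑ v ∈ B ∩ I, ∑ u ∈ (S \ B) ∩ J, y v u * (f B * g (S \ B))

namespace FKSystem
variable {y : ι → ι → R} {I J Q S S' : Finset ι}

/-- In a tree with at least two vertices the row root `v` is not isolated. The last edge at `v` is
cut, and the forest with the two roots `v` and `u` is split by `splitsAt`. -/
theorem forest_row_eq_sum (hy : FKSystem y) (hIJ : ∀ i, i ∈ I ↔ i ∉ J) (hS : 2 ≤ S.card) {v : ι}
    (hvS : v ∈ S) (hvI : v ∈ I) : forest y I J {v} S = ∑ u ∈ S ∩ J, ∑ B ∈ S.powerset,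
      if v ∈ B ∧ u ∉ B then forest y I J {v} B * forest y I J {u} (S \ B) * y v u else 0 := by
  have h0 := hy.forest_no_root (S := S.erase v) hIJ (by
    rw [← Finset.card_pos, Finset.card_erase_of_mem hvS]; omega)
  have hvJ : v ∉ S ∩ J := fun h => (hIJ v).1 hvI (Finset.mem_of_mem_inter_right h)
  rw [hy.forest_row hIJ hvI (Finset.mem_singleton_self v) hvS, Finset.erase_singleton, h0,
    zero_add, Finset.sdiff_singleton_eq_erase, Finset.erase_eq_of_notMem hvJ]
  refine Finset.sum_congr rfl fun u hu => ?_
  have huv : u ≠ v := ne_of_mem_of_not_mem hu hvJ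
  rw [show forest y I J (insert u {v}) S = _ from hy.splitsAt hIJ (q := v) (Finset.insert_subset
    (Finset.mem_of_mem_inter_left hu) (Finset.singleton_subset_iff.2 hvS)) (by simp),
    Finset.sum_mul]
  refine Finset.sum_congr rfl fun B _ => ?_
  have e : (insert u {v} : Finset ι).erase v = {u} := by
    rw [Finset.erase_insert_of_ne huv, Finset.erase_singleton]; rfl
  have hiff : B ∩ insert u {v} = {v} ↔ v ∈ B ∧ u ∉ B := by
    simp only [Finset.ext_iff, Finset.mem_inter, Finset.mem_insert, Finset.mem_singleton]
    constructor
    · intro h; have := h u; have := h v; grind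
    · intro h i; grind
  simp only [hiff, e, ite_mul, zero_mul]

/-- The mirror image of `forest_row_eq_sum`: at a column root it is the first edge that is cut. -/
theorem forest_col_eq_sum (hy : FKSystem y) (hIJ : ∀ i, i ∈ I ↔ i ∉ J) (hS : 2 ≤ S.card) {u : ι}
    (huS : u ∈ S) (huJ : u ∈ J) : forest y I J {u} S = ∑ v ∈ S ∩ I, ∑ B ∈ S.powerset,
      if u ∈ B ∧ v ∉ B then y v u * (forest y I J {v} (S \ B) * forest y I J {u} B) else 0 := by
  have hJI : ∀ i, i ∈ J ↔ i ∉ I := fun i => by rw [hIJ, not_not]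
  have := hy.op.forest_row_eq_sum hJI hS huS huJ
  simp only [hy.forest_op hIJ] at this
  apply MulOpposite.op_injective
  rw [this, Finset.op_sum]
  refine Finset.sum_congr rfl fun v _ => ?_
  rw [Finset.op_sum]
  refine Finset.sum_congr rfl fun B _ => ?_
  split_ifs <;> simp

variable {C : Subsemiring R}

theorem _root_.FominKirillov.forest_mem_cone (hC : ∀ v ∈ I, ∀ u ∈ J, y v u ∈ C)
    (Q S : Finset ι) : forest y I J Q S ∈ C :=
  forest_mem C Q fun v hv u hu =>
    hC v (Finset.mem_of_mem_inter_right hv) u (Finset.mem_of_mem_inter_right hu)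

theorem _root_.FominKirillov.rowTree_mem (hC : ∀ v ∈ I, ∀ u ∈ J, y v u ∈ C) (S : Finset ι) :
    rowTree y I J S ∈ C := C.sum_mem fun v _ => forest_mem_cone hC {v} S

theorem _root_.FominKirillov.colTree_mem (hC : ∀ v ∈ I, ∀ u ∈ J, y v u ∈ C) (S : Finset ι) :
    colTree y I J S ∈ C := C.sum_mem fun v _ => forest_mem_cone hC {v} S

theorem _root_.FominKirillov.tree_mem (hC : ∀ v ∈ I, ∀ u ∈ J, y v u ∈ C) (S : Finset ι) :
    tree y I J S ∈ C := by
  rw [tree]; split_ifs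
  exacts [C.one_mem, rowTree_mem hC S]

theorem _root_.FominKirillov.forest_dom_tree_of_row (hC : ∀ v ∈ I, ∀ u ∈ J, y v u ∈ C) {v : ι}
    (hvS : v ∈ S) (hvI : v ∈ I) : Dom C (forest y I J {v} S) (tree y I J S) := by
  rw [tree]
  split_ifs with h
  · obtain ⟨w, rfl⟩ := Finset.card_eq_one.1 h
    rw [Finset.mem_singleton.1 hvS, forest_root]
    exact Dom.refl C 1
  · exact Dom.single_le_sum (f := fun v => forest y I J {v} S) (Finset.mem_inter.2 ⟨hvS, hvI⟩)
      fun _ _ => forest_mem_cone hC _ _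

theorem forest_dom_tree_of_col (hy : FKSystem y) (hIJ : ∀ i, i ∈ I ↔ i ∉ J)
    (hC : ∀ v ∈ I, ∀ u ∈ J, y v u ∈ C) {u : ι}
    (huS : u ∈ S) (huJ : u ∈ J) : Dom C (forest y I J {u} S) (tree y I J S) := by
  rw [tree]
  split_ifs with h
  · obtain ⟨w, rfl⟩ := Finset.card_eq_one.1 h
    rw [Finset.mem_singleton.1 huS, forest_root]
    exact Dom.refl C 1
  · rw [← hy.colTree_eq_rowTree hIJ]
    · exact Dom.single_le_sum (f := fun v => forest y I J {v} S) (Finset.mem_inter.2 ⟨huS, huJ⟩)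
        fun _ _ => forest_mem_cone hC _ _
    · have := Finset.card_pos.2 ⟨u, huS⟩; omega

theorem rowTree_eq_merge (hy : FKSystem y) (hIJ : ∀ i, i ∈ I ↔ i ∉ J) (hS : 2 ≤ S.card) :
    rowTree y I J S = ∑ B ∈ S.powerset, ∑ v ∈ B ∩ I, ∑ u ∈ (S \ B) ∩ J,
      forest y I J {v} B * forest y I J {u} (S \ B) * y v u := by
  rw [rowTree, Finset.sum_congr rfl fun v hv => hy.forest_row_eq_sum hIJ hS
    (Finset.mem_of_mem_inter_left hv) (Finset.mem_of_mem_inter_right hv)]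
  rw [Finset.sum_congr rfl fun v _ => Finset.sum_comm, Finset.sum_comm]
  refine Finset.sum_congr rfl fun B hB => ?_
  have hBS := Finset.mem_powerset.1 hB
  have e1 : B ∩ I = (S ∩ I).filter (· ∈ B) := by
    ext i; simp only [Finset.mem_inter, Finset.mem_filter]; have := @hBS i; tauto
  have e2 : (S \ B) ∩ J = (S ∩ J).filter (· ∉ B) := by
    ext i; simp only [Finset.mem_inter, Finset.mem_filter, Finset.mem_sdiff]; tauto
  rw [e1, e2, Finset.sum_filter]
  refine Finset.sum_congr rfl fun v _ => ?_
  rw [Finset.sum_filter]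
  split_ifs with h <;> simp [h]

/-- Every tree arises by connecting two trees with the last edge. -/
theorem tree_dom_mergeRight (hy : FKSystem y) (hIJ : ∀ i, i ∈ I ↔ i ∉ J)
    (hC : ∀ v ∈ I, ∀ u ∈ J, y v u ∈ C) (hS : 2 ≤ S.card) :
    Dom C (tree y I J S) (mergeRight y I J (tree y I J) (tree y I J) S) := by
  rw [tree, if_neg (by omega), hy.rowTree_eq_merge hIJ hS]
  refine Dom.sum fun B _ => Dom.sum fun v hv => Dom.sum fun u hu => ?_
  obtain ⟨hvB, hvI⟩ := Finset.mem_inter.1 hv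
  obtain ⟨huB, huJ⟩ := Finset.mem_inter.1 hu
  exact Dom.mul_right (hC v hvI u huJ) (Dom.mul (forest_dom_tree_of_row hC hvB hvI)
    (hy.forest_dom_tree_of_col hIJ hC huB huJ) (forest_mem_cone hC _ _) (tree_mem hC _))

/-- A tree rooted at a column `u` also arises by a last edge that joins a row `w` of a tree rooted
at `u` to the root `t` of another tree rooted at a column. The first edge `y v u` is cut, and the
last edge is searched for in one of the two parts, depending on which of them is sure to have
another column. The right side is expanded by the first edge at `u` as well, and the terms found are
distinct terms of that expansion. -/
theorem forest_col_dom (hy : FKSystem y) (hIJ : ∀ i, i ∈ I ↔ i ∉ J)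
    (hC : ∀ v ∈ I, ∀ u ∈ J, y v u ∈ C) {u : ι} (huS : u ∈ S) (huJ : u ∈ J)
    (hS : 2 ≤ (S ∩ J).card) :
    Dom C (forest y I J {u} S) (∑ B ∈ S.powerset with u ∈ B, ∑ w ∈ B ∩ I, ∑ t ∈ (S \ B) ∩ J,
      forest y I J {u} B * forest y I J {t} (S \ B) * y w t) := by
  induction hm : S.card using Nat.strong_induction_on generalizing S with
  | _ m ih =>
  have hS2 : 2 ≤ S.card := hS.trans (Finset.card_le_card Finset.inter_subset_left)
  -- `X` is the part that keeps `u`, `Y` the part with the other end `v` of the first edge, and the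
  -- rest is rooted at `t`. In `a` the last edge starts at a row of `X`, in `b` it starts at `v`.
  let a : ι → Finset ι → Finset ι → R := fun v X Y =>
    ∑ w ∈ X ∩ I, ∑ t ∈ ((S \ X) \ Y) ∩ J, y v u * (forest y I J {v} Y * forest y I J {u} X *
      forest y I J {t} ((S \ X) \ Y)) * y w t
  let b : ι → Finset ι → Finset ι → R := fun v X Y =>
    ∑ t ∈ ((S \ X) \ Y) ∩ J, y v u * (forest y I J {v} Y * forest y I J {u} X *
      forest y I J {t} ((S \ X) \ Y)) * y v t
  have haC : ∀ v ∈ I, ∀ X Y, a v X Y ∈ C := fun v hv X Y => C.sum_mem fun w hw =>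
    C.sum_mem fun t ht => C.mul_mem (C.mul_mem (hC v hv u huJ) (C.mul_mem (C.mul_mem
      (forest_mem_cone hC _ _) (forest_mem_cone hC _ _)) (forest_mem_cone hC _ _)))
      (hC w (Finset.mem_of_mem_inter_right hw) t (Finset.mem_of_mem_inter_right ht))
  have hbC : ∀ v ∈ I, ∀ X Y, b v X Y ∈ C := fun v hv X Y =>
    C.sum_mem fun t ht => C.mul_mem (C.mul_mem (hC v hv u huJ) (C.mul_mem (C.mul_mem
      (forest_mem_cone hC _ _) (forest_mem_cone hC _ _)) (forest_mem_cone hC _ _)))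
      (hC v hv t (Finset.mem_of_mem_inter_right ht))
  have key : ∀ v ∈ S ∩ I, ∀ A ∈ S.powerset, Dom C
      (if u ∈ A ∧ v ∉ A then y v u * (forest y I J {v} (S \ A) * forest y I J {u} A) else 0)
      ((∑ B ∈ A.powerset, if u ∈ B ∧ v ∈ S \ A then a v B (S \ A) else 0) +
        ∑ Y ∈ (S \ A).powerset, if u ∈ A ∧ v ∈ Y then b v A Y else 0) := by
    intro v hv A hA
    obtain ⟨hvS, hvI⟩ := Finset.mem_inter.1 hv
    have hAS := Finset.mem_powerset.1 hA
    have m1 : ∑ B ∈ A.powerset, (if u ∈ B ∧ v ∈ S \ A then a v B (S \ A) else 0) ∈ C :=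
      C.sum_mem fun B _ => by split_ifs; exacts [haC v hvI _ _, C.zero_mem]
    have m2 : ∑ Y ∈ (S \ A).powerset, (if u ∈ A ∧ v ∈ Y then b v A Y else 0) ∈ C :=
      C.sum_mem fun B _ => by split_ifs; exacts [hbC v hvI _ _, C.zero_mem]
    by_cases hc : u ∈ A ∧ v ∉ A
    swap
    · rw [if_neg hc]; exact Dom.of_mem (C.add_mem m1 m2)
    obtain ⟨huA, hvA⟩ := hc
    rw [if_pos ⟨huA, hvA⟩]
    have hvSA : v ∈ S \ A := Finset.mem_sdiff.2 ⟨hvS, hvA⟩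
    -- If the part `A` of `u` has two columns, the induction hypothesis applies to it. Otherwise `u`
    -- is its only column, so the part of `v` has a column, and the last edge at the row root `v`
    -- can be cut.
    by_cases hA2 : 2 ≤ (A ∩ J).card
    · rw [← add_zero (y v u * _)]
      refine Dom.add ?_ (Dom.of_mem m2)
      have hlt : A.card < m := by
        rw [← hm]
        exact Finset.card_lt_card ((Finset.ssubset_iff_of_subset hAS).2 ⟨v, hvS, hvA⟩)
      have := Dom.mul_left (c := y v u * forest y I J {v} (S \ A))
        (C.mul_mem (hC v hvI u huJ) (forest_mem_cone hC _ _)) (ih _ hlt huA hA2 rfl)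
      rw [mul_assoc] at this
      convert this using 1
      rw [Finset.sum_filter, Finset.mul_sum]
      refine Finset.sum_congr rfl fun B hB => ?_
      have hBA := Finset.mem_powerset.1 hB
      have e : (S \ B) \ (S \ A) = A \ B := by
        ext i; simp only [Finset.mem_sdiff]; have := @hAS i; tauto
      simp only [hvSA, and_true, mul_ite, mul_zero]
      refine if_congr Iff.rfl ?_ rfl
      simp only [a, e, Finset.mul_sum, mul_assoc]
    · rw [← zero_add (y v u * _)]
      refine Dom.add (Dom.of_mem m1) ?_
      have hcard : 2 ≤ (S \ A).card := by
        have h1 : (S ∩ J).card ≤ (A ∩ J).card + ((S \ A) ∩ J).card := by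
          rw [← Finset.card_union_of_disjoint]
          · refine Finset.card_le_card fun i => ?_
            simp only [Finset.mem_union, Finset.mem_inter, Finset.mem_sdiff]; tauto
          · exact (Finset.disjoint_sdiff.mono Finset.inter_subset_left Finset.inter_subset_left)
        have h2 : ((S \ A) ∩ J).card < (S \ A).card := Finset.card_lt_card
          ((Finset.ssubset_iff_of_subset Finset.inter_subset_left).2
            ⟨v, hvSA, fun h => (hIJ v).1 hvI (Finset.mem_of_mem_inter_right h)⟩)
        omega
      rw [hy.forest_row_eq_sum hIJ hcard hvSA hvI, Finset.sum_mul, Finset.mul_sum]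
      simp only [Finset.sum_mul, Finset.mul_sum]
      rw [Finset.sum_comm]
      convert Dom.refl C _ using 1
      refine Finset.sum_congr rfl fun Y hY => ?_
      have hYS := Finset.mem_powerset.1 hY
      by_cases hvY : v ∈ Y
      · have e2 : ((S \ A) \ Y) ∩ J = ((S \ A) ∩ J).filter (· ∉ Y) := by
          ext i; simp only [Finset.mem_inter, Finset.mem_filter, Finset.mem_sdiff]; tauto
        rw [if_pos ⟨huA, hvY⟩]
        simp only [b]
        rw [e2, Finset.sum_filter]
        refine Finset.sum_congr rfl fun t ht => ?_
        by_cases htY : t ∈ Y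
        · simp [htY]
        rw [if_pos htY, if_pos ⟨hvY, htY⟩]
        have c1 := hy.letter_commute_forest (I := I) (J := J) (Q := {u}) hvA
          (Finset.mem_sdiff.1 (Finset.mem_of_mem_inter_left ht)).2
        have c2 := hy.commute_forest (I := I) (J := J) (S := (S \ A) \ Y) (S' := A)
          (Finset.sdiff_disjoint.mono_left Finset.sdiff_subset) {t} {u}
        rw [mul_assoc _ (y v t), c1.eq, ← mul_assoc _ _ (y v t), mul_assoc (forest y I J {v} Y),
          ← c2.eq]
        simp only [mul_assoc]
      · simp [hvY]
  -- Here the last edge starts at any row of `X ∪ Y`. As `v` is not in `X`, the terms of `a` and `b`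
  -- are different terms of `c`.
  let c : ι → Finset ι → Finset ι → R := fun v X Y =>
    ∑ w ∈ (X ∪ Y) ∩ I, ∑ t ∈ ((S \ X) \ Y) ∩ J, y v u * (forest y I J {v} Y * forest y I J {u} X *
      forest y I J {t} ((S \ X) \ Y)) * y w t
  have habc : ∀ v ∈ S ∩ I, ∀ X ∈ S.powerset, ∀ Y ∈ (S \ X).powerset,
      Dom C ((if u ∈ X ∧ v ∈ Y then a v X Y else 0) + (if u ∈ X ∧ v ∈ Y then b v X Y else 0))
        (if u ∈ X ∧ v ∈ Y then c v X Y else 0) := by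
    intro v hv X _ Y hY
    have hvI := Finset.mem_of_mem_inter_right hv
    by_cases hc : u ∈ X ∧ v ∈ Y
    · simp only [if_pos hc]
      have hvX : v ∉ X := fun h => (Finset.mem_sdiff.1 (Finset.mem_powerset.1 hY hc.2)).2 h
      let s : ι → R := fun w => ∑ t ∈ ((S \ X) \ Y) ∩ J, y v u * (forest y I J {v} Y *
        forest y I J {u} X * forest y I J {t} ((S \ X) \ Y)) * y w t
      have h1 : a v X Y + b v X Y = ∑ w ∈ insert v (X ∩ I), s w := by
        rw [Finset.sum_insert fun h => hvX (Finset.mem_of_mem_inter_left h), add_comm]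
      rw [h1]
      refine Dom.sum_subset ?_ fun w hw => ?_
      · refine Finset.insert_subset (by simp [hc.2, hvI]) fun i => ?_
        simp only [Finset.mem_inter, Finset.mem_union]; tauto
      · exact C.sum_mem fun t ht => C.mul_mem (C.mul_mem (hC v hvI u huJ) (C.mul_mem (C.mul_mem
          (forest_mem_cone hC _ _) (forest_mem_cone hC _ _)) (forest_mem_cone hC _ _)))
          (hC w (Finset.mem_of_mem_inter_right hw) t (Finset.mem_of_mem_inter_right ht))
    · simp only [if_neg hc, add_zero]; exact Dom.refl C 0
  have rhs : (∑ B ∈ S.powerset with u ∈ B, ∑ w ∈ B ∩ I, ∑ t ∈ (S \ B) ∩ J,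
      forest y I J {u} B * forest y I J {t} (S \ B) * y w t) =
      ∑ v ∈ S ∩ I, ∑ X ∈ S.powerset, ∑ Y ∈ (S \ X).powerset,
        if u ∈ X ∧ v ∈ Y then c v X Y else 0 := by
    rw [Finset.sum_congr rfl fun v _ => (sum_powerset_powerset S
      fun X Y => if u ∈ X ∧ v ∈ Y then c v X Y else 0).symm, Finset.sum_comm, Finset.sum_filter]
    refine Finset.sum_congr rfl fun B hB => ?_
    have hBS := Finset.mem_powerset.1 hB
    by_cases huB : u ∈ B
    · rw [if_pos huB]
      have h0 : ∀ v X, X ∈ B.powerset → (if u ∈ X ∧ v ∈ B \ X then c v X (B \ X) else 0) =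
          (if u ∈ X ∧ v ∈ B \ X then y v u * (forest y I J {v} (B \ X) * forest y I J {u} X)
            else 0) * ∑ w ∈ B ∩ I, ∑ t ∈ (S \ B) ∩ J, forest y I J {t} (S \ B) * y w t := by
        intro v X hX
        have hXB := Finset.mem_powerset.1 hX
        have e : (S \ X) \ (B \ X) = S \ B := by
          ext i; simp only [Finset.mem_sdiff]; have := @hXB i; tauto
        rw [ite_mul, zero_mul]
        refine if_congr Iff.rfl ?_ rfl
        simp only [c, e, Finset.union_sdiff_of_subset hXB, Finset.mul_sum, mul_assoc]
      rw [Finset.sum_congr rfl fun v _ => Finset.sum_congr rfl (h0 v)]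
      simp only [← Finset.sum_mul]
      simp only [mul_assoc, ← Finset.mul_sum]
      -- A row `w` in `B` guarantees that `B` has at least two vertices, so that the tree of `u` on
      -- `B` has a first edge; without it the sum over `w` is empty.
      rcases (B ∩ I).eq_empty_or_nonempty with hBI | ⟨w, hw⟩
      · simp [hBI]
      · congr 1
        have hcard : 2 ≤ B.card := Finset.one_lt_card.2 ⟨u, huB, w, Finset.mem_of_mem_inter_left hw,
          fun e => (hIJ w).1 (Finset.mem_of_mem_inter_right hw) (e ▸ huJ)⟩
        rw [hy.forest_col_eq_sum hIJ hcard huB huJ]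
        have e : B ∩ I = (S ∩ I).filter (· ∈ B) := by
          ext i; simp only [Finset.mem_inter, Finset.mem_filter]; have := @hBS i; tauto
        rw [e, Finset.sum_filter]
        refine Finset.sum_congr rfl fun v _ => ?_
        by_cases hvB : v ∈ B <;> simp [hvB]
    · rw [if_neg huB]
      refine (Finset.sum_eq_zero fun v _ => Finset.sum_eq_zero fun X hX => if_neg fun h => ?_).symm
      exact huB (Finset.mem_powerset.1 hX h.1)
  rw [hy.forest_col_eq_sum hIJ hS2 huS huJ, rhs]
  refine Dom.sum fun v hv => ?_
  refine (Dom.sum (key v hv)).trans ?_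
  have e1 := sum_powerset_powerset S
    fun X Z => if u ∈ X ∧ v ∈ (S \ X) \ Z then a v X ((S \ X) \ Z) else 0
  have e2 : ∀ A ∈ S.powerset, ∑ B ∈ A.powerset, (if u ∈ B ∧ v ∈ S \ A then a v B (S \ A) else 0) =
      ∑ B ∈ A.powerset, if u ∈ B ∧ v ∈ (S \ B) \ (A \ B) then a v B ((S \ B) \ (A \ B)) else 0 := by
    intro A _
    refine Finset.sum_congr rfl fun B hB => ?_
    have hBA := Finset.mem_powerset.1 hB
    have e : (S \ B) \ (A \ B) = S \ A := by
      ext i; simp only [Finset.mem_sdiff]; have := @hBA i; tauto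
    rw [e]
  rw [Finset.sum_add_distrib, Finset.sum_congr rfl e2, e1, ← Finset.sum_add_distrib]
  refine Dom.sum fun X hX => ?_
  rw [sum_powerset_sdiff (S \ X) fun Y => if u ∈ X ∧ v ∈ Y then a v X Y else 0,
    ← Finset.sum_add_distrib]
  exact Dom.sum fun Y hY => habc v hv X hX Y hY

end FKSystem
end Trees

/-! ### Merging two trees by an edge, and the commutator with the sum of all edges -/

section Merge
variable {ι R : Type*} [Ring R] [DecidableEq ι] {y : ι → ι → R} {I J Q S S' : Finset ι}

/-- The sum of all edges inside `S`. -/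
def edgeSum (y : ι → ι → R) (I J S : Finset ι) : R := ∑ v ∈ S ∩ I, ∑ u ∈ S ∩ J, y v u

theorem sum_erase_eq_sum_powersetCard {M : Type*} [AddCommMonoid M] {G : Finset ι} {p : ℕ}
    (hG : G.card = p + 1) (g : Finset ι → M) :
    ∑ v ∈ G, g (G.erase v) = ∑ X ∈ G.powersetCard p, g X := by
  have := sum_powersetCard_succ_eq G p fun _ X => g X
  rw [← hG, Finset.powersetCard_self, Finset.sum_singleton] at this
  rw [← this]
  refine Finset.sum_congr rfl fun X hX => ?_
  obtain ⟨h1, h2⟩ := Finset.mem_powersetCard.1 hX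
  rw [Finset.sum_const, Finset.card_sdiff_of_subset h1, hG, h2, Nat.add_sub_cancel_left, one_smul]

theorem sum_erase_erase_eq_sum_powersetCard {M : Type*} [AddCommMonoid M] {G : Finset ι} {p : ℕ}
    (hG : G.card = p + 2) (g : Finset ι → M) :
    ∑ v ∈ G, ∑ w ∈ G.erase v, g ((G.erase v).erase w) = 2 • ∑ X ∈ G.powersetCard p, g X := by
  rw [sum_erase_eq_sum_powersetCard hG fun X => ∑ w ∈ X, g (X.erase w),
    ← sum_powersetCard_succ_eq G p fun _ X => g X, Finset.smul_sum]
  refine Finset.sum_congr rfl fun X hX => ?_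
  obtain ⟨h1, h2⟩ := Finset.mem_powersetCard.1 hX
  rw [Finset.sum_const, Finset.card_sdiff_of_subset h1, hG, h2, Nat.add_sub_cancel_left]

theorem sdiff_inter_rows (hIJ : ∀ i, i ∈ I ↔ i ∉ J) : S \ (S ∩ I) = S ∩ J := by
  ext i; have := hIJ i; simp only [Finset.mem_sdiff, Finset.mem_inter]; tauto

theorem starSum_singleton_left {z : ι → ι → R} (hz : LettersCommute z) {v : ι} {Y : Finset ι}
    (hv : v ∉ Y) : starSum z {v} Y = ∑ u ∈ Y, z v u := by
  induction Y using Finset.induction_on with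
  | empty => simp [starSum_right_empty]
  | insert u Y hu ih =>
    rw [starSum_left hz (by simpa using hv) (Finset.mem_insert_self u Y), Finset.erase_insert hu,
      ih fun h => hv (Finset.mem_insert_of_mem h), Finset.sum_insert hu]
    simp [starSum_left_empty, add_comm]

namespace FKSystem

/-- The edges inside `S` form the first elementary symmetric polynomial in the Dunkl elements of the
rows of `S`, which accounts for the commutation lemmas that follow. -/
theorem edgeSum_eq (hy : FKSystem y) (hIJ : ∀ i, i ∈ I ↔ i ∉ J) :
    edgeSum y I J S = pieriSum y S (S ∩ I) 1 := by
  rw [pieriSum, Finset.powersetCard_one, Finset.sum_map, sdiff_inter_rows hIJ]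
  refine Finset.sum_congr rfl fun v hv => ?_
  exact (starSum_singleton_left hy.comm fun h =>
    (hIJ v).1 (Finset.mem_of_mem_inter_right hv) (Finset.mem_of_mem_inter_right h)).symm

theorem edgeSum_commute_pieriSum (hy : FKSystem y) (hIJ : ∀ i, i ∈ I ↔ i ∉ J) (p : ℕ) :
    Commute (edgeSum y I J S) (pieriSum y S (S ∩ I) p) := by
  rw [hy.edgeSum_eq hIJ]
  exact hy.commute_pieriSum Finset.inter_subset_left (fun i hi =>
    (hy.dunklSum_commute_pieriSum Finset.inter_subset_left
      (Finset.mem_of_mem_inter_left hi) 1).symm) p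

theorem edgeSum_commute_starSum (hy : FKSystem y) (hIJ : ∀ i, i ∈ I ↔ i ∉ J) :
    Commute (edgeSum y I J S) (starSum (fun i j => y j i) (S ∩ J) (S ∩ I)) := by
  have hJI : ∀ i, i ∈ J ↔ i ∉ I := fun i => by rw [hIJ, not_not]
  have := pieriSum_card (fun i j => y j i) S (S ∩ J)
  rw [sdiff_inter_rows hJI] at this
  rw [← this, hy.edgeSum_eq hIJ]
  refine hy.flip.commute_pieriSum Finset.inter_subset_left (fun i hi => ?_) _
  rw [hy.dunklSum_flip]
  exact (hy.dunklSum_commute_pieriSum Finset.inter_subset_left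
    (Finset.mem_of_mem_inter_left hi) 1).symm.neg_right

/-- Summed over the root, the row edges give the Pieri sum of degree one less than the number of
rows, and the column edges give a top Pieri sum. Both are polynomials in the commuting Dunkl
elements of `S`. -/
theorem edgeSum_commute_rowTree (hy : FKSystem y) (hIJ : ∀ i, i ∈ I ↔ i ∉ J) (S : Finset ι) :
    Commute (edgeSum y I J S) (rowTree y I J S) := by
  have e : rowTree y I J S = (∑ v ∈ S ∩ I, starSum y ((S ∩ I).erase v) (S ∩ J)) *
      starSum (fun i j => y j i) (S ∩ J) (S ∩ I) := by
    rw [Finset.sum_mul]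
    refine Finset.sum_congr rfl fun v hv => ?_
    have hvJ : v ∉ S ∩ J := fun h =>
      (hIJ v).1 (Finset.mem_of_mem_inter_right hv) (Finset.mem_of_mem_inter_right h)
    rw [forest, Finset.sdiff_singleton_eq_erase, Finset.sdiff_singleton_eq_erase,
      Finset.erase_eq_of_notMem hvJ]
  rw [e]
  refine Commute.mul_right ?_ (hy.edgeSum_commute_starSum hIJ)
  rcases h : (S ∩ I).card with _ | p
  · rw [Finset.card_eq_zero.1 h, Finset.sum_empty]; exact Commute.zero_right _
  · rw [sum_erase_eq_sum_powersetCard h fun X => starSum y X (S ∩ J), ← sdiff_inter_rows hIJ]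
    exact hy.edgeSum_commute_pieriSum hIJ p

/-- By `splitsAt` the sum over `B` is the sum of all forests with an ordered pair of row roots. This
is twice a Pieri sum of degree two less than the number of rows, times a top Pieri sum. -/
theorem edgeSum_commute_sum_rowTree (hy : FKSystem y) (hIJ : ∀ i, i ∈ I ↔ i ∉ J) (S : Finset ι) :
    Commute (edgeSum y I J S) (∑ B ∈ S.powerset, rowTree y I J B * rowTree y I J (S \ B)) := by
  have h1 : ∑ B ∈ S.powerset, rowTree y I J B * rowTree y I J (S \ B) =
      ∑ v ∈ S ∩ I, ∑ w ∈ (S ∩ I).erase v, forest y I J {w, v} S := by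
    have h2 : ∀ v ∈ S ∩ I, ∀ w ∈ (S ∩ I).erase v, forest y I J {w, v} S = ∑ B ∈ S.powerset,
        if v ∈ B ∧ w ∉ B then forest y I J {v} B * forest y I J {w} (S \ B) else 0 := by
      intro v hv w hw
      obtain ⟨hwv, hw⟩ := Finset.mem_erase.1 hw
      rw [show forest y I J {w, v} S = _ from hy.splitsAt hIJ (q := v)
        (Finset.insert_subset (Finset.mem_of_mem_inter_left hw)
          (Finset.singleton_subset_iff.2 (Finset.mem_of_mem_inter_left hv))) (by simp)]
      refine Finset.sum_congr rfl fun B _ => ?_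
      have e : (insert w {v} : Finset ι).erase v = {w} := by
        rw [Finset.erase_insert_of_ne hwv, Finset.erase_singleton]; rfl
      have hiff : B ∩ insert w {v} = {v} ↔ v ∈ B ∧ w ∉ B := by
        simp only [Finset.ext_iff, Finset.mem_inter, Finset.mem_insert, Finset.mem_singleton]
        constructor
        · intro h; have := h w; have := h v; grind
        · intro h i; grind
      simp only [hiff, e]
    rw [Finset.sum_congr rfl fun v hv => Finset.sum_congr rfl (h2 v hv),
      Finset.sum_congr rfl fun v _ => Finset.sum_comm, Finset.sum_comm]
    refine Finset.sum_congr rfl fun B hB => ?_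
    have hBS := Finset.mem_powerset.1 hB
    have e1 : B ∩ I = (S ∩ I).filter (· ∈ B) := by
      ext i; simp only [Finset.mem_inter, Finset.mem_filter]; have := @hBS i; tauto
    rw [rowTree, rowTree, Finset.sum_mul_sum, e1, Finset.sum_filter]
    refine Finset.sum_congr rfl fun v _ => ?_
    by_cases hvB : v ∈ B
    · have e2 : (S \ B) ∩ I = ((S ∩ I).erase v).filter (· ∉ B) := by
        ext i; simp only [Finset.mem_inter, Finset.mem_filter, Finset.mem_sdiff, Finset.mem_erase]
        by_cases h : i = v
        · subst h; tauto
        · tauto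
      rw [if_pos hvB, e2, Finset.sum_filter]
      simp only [hvB, true_and]
    · simp [hvB]
  have h3 : ∑ v ∈ S ∩ I, ∑ w ∈ (S ∩ I).erase v, forest y I J {w, v} S =
      (∑ v ∈ S ∩ I, ∑ w ∈ (S ∩ I).erase v, starSum y (((S ∩ I).erase v).erase w) (S ∩ J)) *
      starSum (fun i j => y j i) (S ∩ J) (S ∩ I) := by
    rw [Finset.sum_mul]
    refine Finset.sum_congr rfl fun v hv => ?_
    rw [Finset.sum_mul]
    refine Finset.sum_congr rfl fun w hw => ?_
    have hwS := Finset.mem_of_mem_erase hw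
    have h : ∀ {i}, i ∈ S ∩ I → i ∉ S ∩ J := fun hi h =>
      (hIJ _).1 (Finset.mem_of_mem_inter_right hi) (Finset.mem_of_mem_inter_right h)
    have e : ∀ X : Finset ι, X \ {w, v} = (X.erase v).erase w := fun X => by
      ext i; simp only [Finset.mem_sdiff, Finset.mem_insert, Finset.mem_singleton,
        Finset.mem_erase]; tauto
    rw [forest, e, e, Finset.erase_eq_of_notMem (h hv), Finset.erase_eq_of_notMem (h hwS)]
  rw [h1, h3]
  refine Commute.mul_right ?_ (hy.edgeSum_commute_starSum hIJ)
  rcases h : (S ∩ I).card with _ | _ | p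
  · rw [Finset.card_eq_zero.1 h, Finset.sum_empty]; exact Commute.zero_right _
  · obtain ⟨v, hv⟩ := Finset.card_eq_one.1 h
    rw [hv]; simp
  · rw [sum_erase_erase_eq_sum_powersetCard h fun X => starSum y X (S ∩ J), ← sdiff_inter_rows hIJ]
    exact (hy.edgeSum_commute_pieriSum hIJ p).smul_right 2

theorem rowTree_commute (hy : FKSystem y) (h : Disjoint S S') :
    Commute (rowTree y I J S) (rowTree y I J S') :=
  Commute.sum_left _ _ _ fun _ _ => Commute.sum_right _ _ _ fun _ _ => hy.commute_forest h _ _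

theorem edgeSum_commute_of_disjoint (hy : FKSystem y) (h : Disjoint S S') :
    Commute (edgeSum y I J S) (rowTree y I J S') :=
  Commute.sum_left _ _ _ fun _ hv => Commute.sum_left _ _ _ fun _ hu =>
    Commute.sum_right _ _ _ fun _ _ =>
      hy.letter_commute_forest (Finset.disjoint_left.1 h (Finset.mem_of_mem_inter_left hv))
        (Finset.disjoint_left.1 h (Finset.mem_of_mem_inter_left hu))

theorem edgeSum_eq_of_subset {B : Finset ι} (hB : B ⊆ S) : edgeSum y I J S =
    edgeSum y I J B + edgeSum y I J (S \ B) + ∑ v ∈ B ∩ I, ∑ u ∈ (S \ B) ∩ J, y v u +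
      ∑ v ∈ (S \ B) ∩ I, ∑ u ∈ B ∩ J, y v u := by
  have e : ∀ (K : Finset ι) (f : ι → R), ∑ i ∈ S ∩ K, f i =
      ∑ i ∈ B ∩ K, f i + ∑ i ∈ (S \ B) ∩ K, f i := by
    intro K f
    rw [← Finset.sum_union]
    · rw [← Finset.union_inter_distrib_right, Finset.union_sdiff_of_subset hB]
    · exact Finset.disjoint_sdiff.mono Finset.inter_subset_left Finset.inter_subset_left
  simp only [edgeSum, e, Finset.sum_add_distrib]
  abel

/-- The sum of all edges commutes with the sum of the products `f B * f (S \ B)`. The edges inside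
`B` and inside `S \ B` commute with each product, so the edges between the parts commute with the
whole sum. Both directions of such edges contribute equally under `B ↦ S \ B`, and the resulting
factor two is cancelled by `h2`. -/
theorem mergeRight_rowTree (hy : FKSystem y) (hIJ : ∀ i, i ∈ I ↔ i ∉ J)
    (h2 : ∀ r : R, r + r = 0 → r = 0) (S : Finset ι) :
    mergeRight y I J (rowTree y I J) (rowTree y I J) S =
      mergeLeft y I J (rowTree y I J) (rowTree y I J) S := by
  let f := rowTree y I J
  have hc : ∀ B, f B * f (S \ B) = f (S \ B) * f B := fun B =>
    (hy.rowTree_commute Finset.disjoint_sdiff).eq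
  have r1 : mergeRight y I J f f S =
      ∑ B ∈ S.powerset, f B * f (S \ B) * ∑ v ∈ B ∩ I, ∑ u ∈ (S \ B) ∩ J, y v u := by
    simp only [mergeRight, Finset.mul_sum]
  have r2 : mergeRight y I J f f S =
      ∑ B ∈ S.powerset, f B * f (S \ B) * ∑ v ∈ (S \ B) ∩ I, ∑ u ∈ B ∩ J, y v u := by
    rw [r1, ← sum_powerset_sdiff]
    refine Finset.sum_congr rfl fun B hB => ?_
    rw [Finset.sdiff_sdiff_eq_self (Finset.mem_powerset.1 hB), hc]
  have l1 : mergeLeft y I J f f S =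
      ∑ B ∈ S.powerset, (∑ v ∈ B ∩ I, ∑ u ∈ (S \ B) ∩ J, y v u) * (f B * f (S \ B)) := by
    simp only [mergeLeft, Finset.sum_mul]
  have l2 : mergeLeft y I J f f S =
      ∑ B ∈ S.powerset, (∑ v ∈ (S \ B) ∩ I, ∑ u ∈ B ∩ J, y v u) * (f B * f (S \ B)) := by
    rw [l1, ← sum_powerset_sdiff]
    refine Finset.sum_congr rfl fun B hB => ?_
    rw [Finset.sdiff_sdiff_eq_self (Finset.mem_powerset.1 hB), hc]
  have comm := (hy.edgeSum_commute_sum_rowTree hIJ S).eq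
  have eL : edgeSum y I J S * ∑ B ∈ S.powerset, f B * f (S \ B) =
      ∑ B ∈ S.powerset, (edgeSum y I J B + edgeSum y I J (S \ B)) * (f B * f (S \ B)) +
        mergeLeft y I J f f S + mergeLeft y I J f f S := by
    nth_rewrite 1 [l1]
    rw [l2, Finset.mul_sum, ← Finset.sum_add_distrib, ← Finset.sum_add_distrib]
    refine Finset.sum_congr rfl fun B hB => ?_
    rw [edgeSum_eq_of_subset (Finset.mem_powerset.1 hB), add_mul, add_mul]
  have eR : (∑ B ∈ S.powerset, f B * f (S \ B)) * edgeSum y I J S =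
      ∑ B ∈ S.powerset, f B * f (S \ B) * (edgeSum y I J B + edgeSum y I J (S \ B)) +
        mergeRight y I J f f S + mergeRight y I J f f S := by
    nth_rewrite 1 [r1]
    rw [r2, Finset.sum_mul, ← Finset.sum_add_distrib, ← Finset.sum_add_distrib]
    refine Finset.sum_congr rfl fun B hB => ?_
    rw [edgeSum_eq_of_subset (Finset.mem_powerset.1 hB), mul_add, mul_add]
  have comm' : ∑ B ∈ S.powerset, (edgeSum y I J B + edgeSum y I J (S \ B)) * (f B * f (S \ B)) =
      ∑ B ∈ S.powerset, f B * f (S \ B) * (edgeSum y I J B + edgeSum y I J (S \ B)) := by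
    refine Finset.sum_congr rfl fun B _ => ?_
    exact Commute.eq (Commute.add_left
      ((hy.edgeSum_commute_rowTree hIJ B).mul_right
        (hy.edgeSum_commute_of_disjoint Finset.disjoint_sdiff))
      ((hy.edgeSum_commute_of_disjoint Finset.sdiff_disjoint).mul_right
        (hy.edgeSum_commute_rowTree hIJ _)))
  have := (eL.symm.trans comm).trans eR
  rw [comm', add_assoc, add_assoc, add_right_inj] at this
  rw [← sub_eq_zero]
  apply h2
  rw [← sub_eq_zero] at this
  rw [← neg_eq_zero, ← this]
  abel

variable {C : Subsemiring R}

/-- This sums `forest_col_dom` over `u` and lets the second tree have any column as root, instead of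
the end of the new edge. -/
theorem colTree_dom_mergeRight (hy : FKSystem y) (hIJ : ∀ i, i ∈ I ↔ i ∉ J)
    (hC : ∀ v ∈ I, ∀ u ∈ J, y v u ∈ C) (hS : 2 ≤ (S ∩ J).card) :
    Dom C (colTree y I J S) (mergeRight y I J (colTree y I J) (colTree y I J) S) := by
  refine (Dom.sum fun u hu => hy.forest_col_dom hIJ hC (Finset.mem_of_mem_inter_left hu)
    (Finset.mem_of_mem_inter_right hu) hS).trans ?_
  simp only [Finset.sum_filter]
  rw [Finset.sum_comm]
  refine Dom.sum fun B hB => ?_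
  have hBS := Finset.mem_powerset.1 hB
  have e1 : B ∩ J = (S ∩ J).filter (· ∈ B) := by
    ext i; simp only [Finset.mem_inter, Finset.mem_filter]; have := @hBS i; tauto
  rw [← Finset.sum_filter, ← e1, Finset.sum_comm]
  refine Dom.sum fun v hv => ?_
  rw [Finset.sum_comm]
  refine Dom.sum fun u hu => ?_
  have hvu := hC v (Finset.mem_of_mem_inter_right hv) u (Finset.mem_of_mem_inter_right hu)
  rw [← Finset.sum_mul, ← Finset.sum_mul]
  exact Dom.mul_right hvu (Dom.mul_left (colTree_mem hC B) (Dom.single_le_sum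
    (f := fun u => forest y I J {u} (S \ B)) hu fun _ _ => forest_mem_cone hC _ _))

/-- The column version in the opposite ring yields a joining edge at the beginning;
`mergeRight_rowTree` moves it to the end. -/
theorem rowTree_dom_mergeRight (hy : FKSystem y) (hIJ : ∀ i, i ∈ I ↔ i ∉ J)
    (h2 : ∀ r : R, r + r = 0 → r = 0) (hC : ∀ v ∈ I, ∀ u ∈ J, y v u ∈ C)
    (hS : 2 ≤ (S ∩ I).card) :
    Dom C (rowTree y I J S) (mergeRight y I J (rowTree y I J) (rowTree y I J) S) := by
  have hJI : ∀ i, i ∈ J ↔ i ∉ I := fun i => by rw [hIJ, not_not]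
  have := hy.op.colTree_dom_mergeRight (C := C.op) hJI
    (fun u hu v hv => Subsemiring.mem_op.2 (hC v hv u hu)) hS
  have e : ∀ S, colTree (fun i j => MulOpposite.op (y j i)) J I S =
      MulOpposite.op (rowTree y I J S) := fun S => by
    simp only [rowTree, colTree, hy.forest_op hIJ, Finset.op_sum]
  have e' : mergeRight (fun i j => MulOpposite.op (y j i)) J I
      (colTree (fun i j => MulOpposite.op (y j i)) J I)
      (colTree (fun i j => MulOpposite.op (y j i)) J I) S =
      MulOpposite.op (mergeLeft y I J (rowTree y I J) (rowTree y I J) S) := by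
    rw [mergeRight, mergeLeft, ← sum_powerset_sdiff, Finset.op_sum]
    refine Finset.sum_congr rfl fun B hB => ?_
    rw [Finset.sdiff_sdiff_eq_self (Finset.mem_powerset.1 hB), Finset.sum_comm, Finset.op_sum]
    refine Finset.sum_congr rfl fun v _ => ?_
    rw [Finset.op_sum]
    refine Finset.sum_congr rfl fun u _ => ?_
    rw [e, e, MulOpposite.op_mul, MulOpposite.op_mul]
  rw [e, e', Dom, ← MulOpposite.op_sub, Subsemiring.mem_op, MulOpposite.unop_op] at this
  rwa [hy.mergeRight_rowTree hIJ h2]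

end FKSystem
end Merge

/-! ### Set partitions -/

section SetPartitions
variable {ι : Type*} [DecidableEq ι]

open Classical in
/-- The set partitions of `S`, as sets of blocks. -/
def setPartitions (S : Finset ι) : Finset (Finset (Finset ι)) :=
  S.powerset.powerset.filter fun P =>
    (P : Set (Finset ι)).PairwiseDisjoint id ∧ ∅ ∉ P ∧ P.sup id = S

theorem mem_setPartitions {S : Finset ι} {P : Finset (Finset ι)} : P ∈ setPartitions S ↔
    (P : Set (Finset ι)).PairwiseDisjoint id ∧ ∅ ∉ P ∧ P.sup id = S := by
  simp only [setPartitions, Finset.mem_filter, Finset.mem_powerset, and_iff_right_iff_imp]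
  rintro ⟨-, -, rfl⟩ B hB
  exact Finset.mem_powerset.2 (Finset.le_sup (f := id) hB)

variable {S B B' : Finset ι} {P : Finset (Finset ι)}

theorem disjoint_of_mem_setPartitions (hP : P ∈ setPartitions S) (hB : B ∈ P) (hB' : B' ∈ P)
    (h : B ≠ B') : Disjoint B B' := (mem_setPartitions.1 hP).1 hB hB' h

theorem subset_of_mem_setPartitions (hP : P ∈ setPartitions S) (hB : B ∈ P) : B ⊆ S := by
  rw [← (mem_setPartitions.1 hP).2.2]; exact Finset.le_sup (f := id) hB

theorem nonempty_of_mem_setPartitions (hP : P ∈ setPartitions S) (hB : B ∈ P) : B.Nonempty := by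
  rw [Finset.nonempty_iff_ne_empty]
  rintro rfl
  exact (mem_setPartitions.1 hP).2.1 hB

theorem setPartitions_empty : setPartitions (∅ : Finset ι) = {∅} := by
  ext P
  rw [Finset.mem_singleton]
  constructor
  · intro hP
    rw [Finset.eq_empty_iff_forall_notMem]
    intro B hB
    obtain ⟨i, hi⟩ := nonempty_of_mem_setPartitions hP hB
    exact Finset.notMem_empty i (subset_of_mem_setPartitions hP hB hi)
  · rintro rfl
    simp [mem_setPartitions]

theorem notMem_of_mem_setPartitions_sdiff (hB : B.Nonempty) (hP : P ∈ setPartitions (S \ B)) :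
    B ∉ P := by
  obtain ⟨i, hi⟩ := hB
  exact fun h => (Finset.mem_sdiff.1 (subset_of_mem_setPartitions hP h hi)).2 hi

theorem insert_mem_setPartitions (hBS : B ⊆ S) (hB : B.Nonempty) (hP : P ∈ setPartitions (S \ B)) :
    insert B P ∈ setPartitions S := by
  have h := mem_setPartitions.1 hP
  refine mem_setPartitions.2 ⟨?_, ?_, ?_⟩
  · rw [Finset.coe_insert, Set.pairwiseDisjoint_insert]
    exact ⟨h.1, fun B' hB' _ =>
      Finset.disjoint_sdiff.mono_right (subset_of_mem_setPartitions hP hB')⟩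
  · rw [Finset.mem_insert, not_or]
    exact ⟨hB.ne_empty.symm, h.2.1⟩
  · rw [Finset.sup_insert, h.2.2, id, Finset.sup_eq_union, Finset.union_sdiff_of_subset hBS]

theorem erase_mem_setPartitions (hP : P ∈ setPartitions S) (hB : B ∈ P) :
    P.erase B ∈ setPartitions (S \ B) := by
  have h := mem_setPartitions.1 hP
  refine mem_setPartitions.2 ⟨h.1.subset (by simp), fun h' => h.2.1 (Finset.mem_of_mem_erase h'), ?_⟩
  have hd : Disjoint B ((P.erase B).sup id) := Finset.disjoint_sup_right.2 fun B' hB' =>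
    disjoint_of_mem_setPartitions hP hB (Finset.mem_of_mem_erase hB') (Finset.ne_of_mem_erase hB').symm
  rw [← h.2.2]
  nth_rewrite 2 [← Finset.insert_erase hB]
  rw [Finset.sup_insert, id, Finset.sup_eq_union, Finset.union_sdiff_cancel_left hd]

/-- The block containing `s` is split off; this is the recursion behind the inductions over set
partitions. -/
theorem sum_setPartitions_of_mem {M : Type*} [AddCommMonoid M] {s : ι} (hs : s ∈ S)
    (f : Finset (Finset ι) → M) : ∑ P ∈ setPartitions S, f P =
      ∑ B ∈ S.powerset with s ∈ B, ∑ P ∈ setPartitions (S \ B), f (insert B P) := by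
  rw [Finset.sum_sigma']
  symm
  refine Finset.sum_bij (fun a _ => insert a.1 a.2) ?_ ?_ ?_ ?_
  · rintro ⟨B, P⟩ h
    simp only [Finset.mem_sigma, Finset.mem_filter, Finset.mem_powerset] at h
    exact insert_mem_setPartitions h.1.1 ⟨s, h.1.2⟩ h.2
  · rintro ⟨B, P⟩ h ⟨B', P'⟩ h' e
    simp only [Finset.mem_sigma, Finset.mem_filter, Finset.mem_powerset] at h h' e
    have hP := insert_mem_setPartitions h.1.1 ⟨s, h.1.2⟩ h.2
    have hBB : B = B' := by
      by_contra hne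
      refine Finset.disjoint_left.1 (disjoint_of_mem_setPartitions hP (Finset.mem_insert_self B P)
        ?_ hne) h.1.2 h'.1.2
      rw [e]; exact Finset.mem_insert_self _ _
    subst hBB
    congr 1
    rw [← Finset.erase_insert (notMem_of_mem_setPartitions_sdiff ⟨s, h.1.2⟩ h.2), e,
      Finset.erase_insert (notMem_of_mem_setPartitions_sdiff ⟨s, h.1.2⟩ h'.2)]
  · intro P hP
    have hs' : s ∈ P.sup id := by rwa [(mem_setPartitions.1 hP).2.2]
    obtain ⟨B, hB, hsB⟩ := Finset.mem_sup.1 hs'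
    refine ⟨⟨B, P.erase B⟩, ?_, Finset.insert_erase hB⟩
    simp only [Finset.mem_sigma, Finset.mem_filter, Finset.mem_powerset]
    exact ⟨⟨subset_of_mem_setPartitions hP hB, hsB⟩, erase_mem_setPartitions hP hB⟩
  · intros; rfl

theorem sum_setPartitions_marked {M : Type*} [AddCommMonoid M]
    (f : Finset ι → Finset (Finset ι) → M) : ∑ P ∈ setPartitions S, ∑ B ∈ P, f B (P.erase B) =
      ∑ B ∈ S.powerset with B.Nonempty, ∑ P ∈ setPartitions (S \ B), f B P := by
  rw [Finset.sum_sigma', Finset.sum_sigma']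
  refine Finset.sum_bij' (fun a _ => ⟨a.2, a.1.erase a.2⟩) (fun a _ => ⟨insert a.1 a.2, a.1⟩)
    ?_ ?_ ?_ ?_ ?_
  · rintro ⟨P, B⟩ h
    simp only [Finset.mem_sigma, Finset.mem_filter, Finset.mem_powerset] at h ⊢
    exact ⟨⟨subset_of_mem_setPartitions h.1 h.2, nonempty_of_mem_setPartitions h.1 h.2⟩,
      erase_mem_setPartitions h.1 h.2⟩
  · rintro ⟨B, P⟩ h
    simp only [Finset.mem_sigma, Finset.mem_filter, Finset.mem_powerset] at h ⊢
    exact ⟨insert_mem_setPartitions h.1.1 h.1.2 h.2, Finset.mem_insert_self _ _⟩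
  · rintro ⟨P, B⟩ h
    simp only [Finset.mem_sigma] at h
    simp [Finset.insert_erase h.2]
  · rintro ⟨B, P⟩ h
    simp only [Finset.mem_sigma, Finset.mem_filter, Finset.mem_powerset] at h
    simp [Finset.erase_insert (notMem_of_mem_setPartitions_sdiff h.1.2 h.2)]
  · intros; rfl

theorem sum_card_inter (hP : P ∈ setPartitions S) (K : Finset ι) :
    ∑ B ∈ P, (B ∩ K).card = (S ∩ K).card := by
  rw [← Finset.card_biUnion]
  · congr 1
    ext i
    rw [← (mem_setPartitions.1 hP).2.2]
    simp only [Finset.mem_biUnion, Finset.mem_inter, Finset.mem_sup, id]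
    tauto
  · intro B hB B' hB' h
    exact (disjoint_of_mem_setPartitions hP hB hB' h).mono Finset.inter_subset_left
      Finset.inter_subset_left

/-- The product of `f B` over the blocks `B`, in an arbitrary order. -/
def blockProd {R : Type*} [Ring R] (f : Finset ι → R) (P : Finset (Finset ι)) : R :=
  (P.toList.map f).prod

section BlockProd
variable {R : Type*} [Ring R] {f g : Finset ι → R}

theorem blockProd_empty (f : Finset ι → R) : blockProd f ∅ = 1 := by simp [blockProd]

/-- The factors of disjoint blocks commute, so the arbitrary order of `toList` is irrelevant. -/
theorem blockProd_insert (hf : ∀ B B', Disjoint B B' → Commute (f B) (f B'))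
    (hBS : B ⊆ S) (hB : B.Nonempty) (hP : P ∈ setPartitions (S \ B)) :
    blockProd f (insert B P) = f B * blockProd f P := by
  have hBP := notMem_of_mem_setPartitions_sdiff hB hP
  have hi := insert_mem_setPartitions hBS hB hP
  rw [blockProd, blockProd, ← List.prod_cons, ← List.map_cons]
  refine List.Perm.prod_eq' ((Finset.toList_insert hBP).map f) ?_
  rw [List.pairwise_map]
  refine (Finset.nodup_toList _).imp_of_mem ?_
  intro B₁ B₂ h₁ h₂ hne
  exact hf _ _ (disjoint_of_mem_setPartitions hi (Finset.mem_toList.1 h₁)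
    (Finset.mem_toList.1 h₂) hne)

theorem blockProd_erase (hf : ∀ B B', Disjoint B B' → Commute (f B) (f B'))
    (hP : P ∈ setPartitions S) (hB : B ∈ P) :
    f B * blockProd f (P.erase B) = blockProd f P := by
  rw [← blockProd_insert hf (subset_of_mem_setPartitions hP hB)
    (nonempty_of_mem_setPartitions hP hB) (erase_mem_setPartitions hP hB), Finset.insert_erase hB]

theorem blockProd_mem (C : Subsemiring R) (h : ∀ B ∈ P, f B ∈ C) : blockProd f P ∈ C :=
  list_prod_mem fun r hr => by
    obtain ⟨B, hB, rfl⟩ := List.mem_map.1 hr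
    exact h B (Finset.mem_toList.1 hB)

theorem commute_blockProd {c : R} (h : ∀ B ∈ P, Commute c (f B)) : Commute c (blockProd f P) :=
  (Subsemiring.mem_centralizer_iff (s := {c})).1
    (blockProd_mem (Subsemiring.centralizer {c}) fun B hB =>
      Subsemiring.mem_centralizer_iff.2 fun g hg => by
        rw [Set.mem_singleton_iff.1 hg]; exact h B hB) c rfl

theorem blockProd_congr (h : ∀ B ∈ P, f B = g B) : blockProd f P = blockProd g P := by
  rw [blockProd, blockProd, List.map_congr_left fun B hB => h B (Finset.mem_toList.1 hB)]

end BlockProd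
end SetPartitions

/-! ### Forests as products of trees over set partitions -/

section ForestSum
variable {ι R : Type*} [Ring R] [DecidableEq ι] {y : ι → ι → R} {I J Q S S' : Finset ι}

/-- The trees with vertex set `B` whose root is the only element of `Q` in `B`. -/
def rootedTree (y : ι → ι → R) (I J Q B : Finset ι) : R :=
  if (B ∩ Q).card = 1 then forest y I J (B ∩ Q) B else 0

namespace FKSystem

theorem rootedTree_commute (hy : FKSystem y) (B B' : Finset ι) (h : Disjoint B B') :
    Commute (rootedTree y I J Q B) (rootedTree y I J Q B') := by
  rw [rootedTree, rootedTree]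
  split_ifs
  exacts [hy.commute_forest h _ _, Commute.zero_right _, Commute.zero_left _, Commute.zero_left _]

theorem sum_rootedTree_of_mem (hy : FKSystem y) {s : ι} (hs : s ∈ S) (Q : Finset ι) :
    ∑ P ∈ setPartitions S, blockProd (rootedTree y I J Q) P =
      ∑ B ∈ S.powerset with s ∈ B, rootedTree y I J Q B *
        ∑ P ∈ setPartitions (S \ B), blockProd (rootedTree y I J Q) P := by
  rw [sum_setPartitions_of_mem hs]
  refine Finset.sum_congr rfl fun B hB => ?_
  simp only [Finset.mem_filter, Finset.mem_powerset] at hB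
  rw [Finset.mul_sum]
  exact Finset.sum_congr rfl fun P hP => blockProd_insert hy.rootedTree_commute hB.1 ⟨s, hB.2⟩ hP

/-- A forest is a product of trees. -/
theorem forest_eq_sum (hy : FKSystem y) (hIJ : ∀ i, i ∈ I ↔ i ∉ J) (hQ : Q ⊆ S) :
    forest y I J Q S = ∑ P ∈ setPartitions S, blockProd (rootedTree y I J Q) P := by
  induction hm : Q.card generalizing Q S with
  | zero =>
    obtain rfl := Finset.card_eq_zero.1 hm
    rcases S.eq_empty_or_nonempty with rfl | ⟨s, hs⟩
    · rw [setPartitions_empty, Finset.sum_singleton, blockProd_empty, forest_empty]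
    · rw [hy.forest_no_root hIJ ⟨s, hs⟩, hy.sum_rootedTree_of_mem hs]
      refine (Finset.sum_eq_zero fun B _ => ?_).symm
      simp [rootedTree]
  | succ m ih =>
    obtain ⟨q, hq⟩ : Q.Nonempty := Finset.card_pos.1 (by omega)
    rw [hy.splitsAt hIJ hQ hq, hy.sum_rootedTree_of_mem (hQ hq), Finset.sum_filter]
    refine Finset.sum_congr rfl fun B hB => ?_
    have hBS := Finset.mem_powerset.1 hB
    by_cases hBQ : B ∩ Q = {q}
    · have hqB : q ∈ B := by
        have := Finset.mem_singleton_self q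
        rw [← hBQ] at this; exact Finset.mem_of_mem_inter_left this
      rw [if_pos hBQ, if_pos hqB, rootedTree, hBQ, Finset.card_singleton, if_pos rfl,
        ih (Q := Q.erase q) (S := S \ B) _ (by rw [Finset.card_erase_of_mem hq]; omega)]
      · congr 1
        refine Finset.sum_congr rfl fun P hP => blockProd_congr fun B' hB' => ?_
        have hsub := subset_of_mem_setPartitions hP hB'
        have hqB' : q ∉ B' := fun h => (Finset.mem_sdiff.1 (hsub h)).2 hqB
        have e : B' ∩ Q.erase q = B' ∩ Q := by
          ext i; simp only [Finset.mem_inter, Finset.mem_erase]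
          constructor
          · tauto
          · rintro ⟨h1, h2⟩; exact ⟨h1, fun h => hqB' (h ▸ h1), h2⟩
        rw [rootedTree, rootedTree, e]
      · intro i hi
        obtain ⟨h1, h2⟩ := Finset.mem_erase.1 hi
        refine Finset.mem_sdiff.2 ⟨hQ h2, fun h3 => h1 ?_⟩
        have := Finset.mem_inter.2 ⟨h3, h2⟩
        rwa [hBQ, Finset.mem_singleton] at this
    · rw [if_neg hBQ]
      by_cases hqB : q ∈ B
      · rw [if_pos hqB, rootedTree, if_neg, zero_mul]
        intro h
        obtain ⟨j, hj⟩ := Finset.card_eq_one.1 h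
        have : q ∈ B ∩ Q := Finset.mem_inter.2 ⟨hqB, hq⟩
        rw [hj, Finset.mem_singleton] at this
        exact hBQ (this ▸ hj)
      · rw [if_neg hqB]

/-- Unlike `splitsAt`, this splits off the tree of an arbitrary vertex `s`, so that root sets can be
summed without knowing one of their elements. -/
theorem forest_eq_sum_of_mem (hy : FKSystem y) (hIJ : ∀ i, i ∈ I ↔ i ∉ J) (hQ : Q ⊆ S) {s : ι}
    (hs : s ∈ S) : forest y I J Q S = ∑ B ∈ S.powerset with s ∈ B,
      rootedTree y I J (Q ∩ B) B * forest y I J (Q \ B) (S \ B) := by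
  rw [hy.forest_eq_sum hIJ hQ, hy.sum_rootedTree_of_mem hs]
  refine Finset.sum_congr rfl fun B _ => ?_
  have e : B ∩ (Q ∩ B) = B ∩ Q := by ext i; simp only [Finset.mem_inter]; tauto
  rw [rootedTree, rootedTree, e, hy.forest_eq_sum hIJ (Finset.sdiff_subset_sdiff hQ subset_rfl)]
  congr 1
  refine Finset.sum_congr rfl fun P hP => blockProd_congr fun B' hB' => ?_
  have hsub := subset_of_mem_setPartitions hP hB'
  have e : B' ∩ (Q \ B) = B' ∩ Q := by
    ext i
    simp only [Finset.mem_inter, Finset.mem_sdiff]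
    have := @hsub i
    simp only [Finset.mem_sdiff] at this
    tauto
  rw [rootedTree, rootedTree, e]

end FKSystem
end ForestSum

/-! ### The forest sums in terms of set partitions -/

theorem sum_powerset_split {ι M : Type*} [DecidableEq ι] [AddCommMonoid M] {S B : Finset ι}
    (hB : B ⊆ S) (h : Finset ι → Finset ι → M) :
    ∑ Q ∈ S.powerset, h (Q ∩ B) (Q \ B) =
      ∑ Q₁ ∈ B.powerset, ∑ Q₂ ∈ (S \ B).powerset, h Q₁ Q₂ := by
  rw [← Finset.sum_product']
  refine Finset.sum_bij' (fun Q _ => (Q ∩ B, Q \ B)) (fun q _ => q.1 ∪ q.2) ?_ ?_ ?_ ?_ ?_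
  · intro Q hQ
    simp only [Finset.mem_product, Finset.mem_powerset] at hQ ⊢
    exact ⟨Finset.inter_subset_right, Finset.sdiff_subset_sdiff hQ subset_rfl⟩
  · rintro ⟨Q₁, Q₂⟩ hq
    simp only [Finset.mem_product, Finset.mem_powerset] at hq ⊢
    exact Finset.union_subset (hq.1.trans hB) (hq.2.trans Finset.sdiff_subset)
  · intro Q _
    exact sup_inf_sdiff Q B
  · rintro ⟨Q₁, Q₂⟩ hq
    simp only [Finset.mem_product, Finset.mem_powerset] at hq
    have h2 : ∀ i ∈ Q₂, i ∉ B := fun i hi => (Finset.mem_sdiff.1 (hq.2 hi)).2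
    have h1 : ∀ i ∈ Q₁, i ∈ B := fun i hi => hq.1 hi
    refine Prod.ext ?_ ?_ <;> ext i <;>
      simp only [Finset.mem_inter, Finset.mem_union, Finset.mem_sdiff] <;>
      have := h1 i <;> have := h2 i <;> tauto
  · intros; rfl

/-- The binomial coefficient with an integer at the bottom. -/
def chooseInt (N : ℕ) (i : ℤ) : ℕ := if 0 ≤ i then N.choose i.toNat else 0

theorem chooseInt_zero (i : ℤ) : chooseInt 0 i = if i = 0 then 1 else 0 := by
  rw [chooseInt]
  rcases lt_trichotomy i 0 with h | rfl | h
  · rw [if_neg (by omega), if_neg h.ne]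
  · simp
  · rw [if_pos h.le, if_neg h.ne']
    obtain ⟨m, rfl⟩ := Int.eq_succ_of_zero_lt h
    simp

theorem chooseInt_of_neg (N : ℕ) {i : ℤ} (h : i < 0) : chooseInt N i = 0 :=
  if_neg (by omega)

theorem chooseInt_of_lt {N : ℕ} {i : ℤ} (h : N < i) : chooseInt N i = 0 := by
  rw [chooseInt, if_pos (by omega), Nat.choose_eq_zero_of_lt (by omega)]

theorem chooseInt_natCast (N i : ℕ) : chooseInt N i = N.choose i := by
  rw [chooseInt, if_pos (by omega), Int.toNat_natCast]

theorem chooseInt_self (N : ℕ) : chooseInt N N = 1 := by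
  rw [chooseInt_natCast, Nat.choose_self]

theorem chooseInt_zero_right (N : ℕ) : chooseInt N 0 = 1 := by
  simpa using chooseInt_natCast N 0

theorem chooseInt_succ (N : ℕ) (i : ℤ) :
    chooseInt (N + 1) i = chooseInt N (i - 1) + chooseInt N i := by
  rcases lt_trichotomy i 0 with h | rfl | h
  · simp [chooseInt_of_neg, h, show i - 1 < 0 by omega]
  · simp [chooseInt]
  · obtain ⟨m, rfl⟩ := Int.eq_succ_of_zero_lt h
    rw [add_sub_cancel_right]
    norm_cast


/-! ### Block statistics of set partitions -/

section Stat
variable {ι : Type*} [DecidableEq ι] {I : Finset ι}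

/-- The indicator function of blocks with at least two elements. -/
def bigIndicator (B : Finset ι) : ℕ := if B.card = 1 then 0 else 1

/-- The indicator function of blocks that consist of one element of `I`. -/
def singleIndicator (I B : Finset ι) : ℕ := if B.card = 1 ∧ (B ∩ I).Nonempty then 1 else 0

/-- The number of blocks with at least two elements. -/
def bigBlocks (P : Finset (Finset ι)) : ℕ := ∑ B ∈ P, bigIndicator B

/-- The number of blocks that consist of one element of `I`. -/
def singleBlocks (I : Finset ι) (P : Finset (Finset ι)) : ℕ := ∑ B ∈ P, singleIndicator I B

theorem bigBlocks_insert {B : Finset ι} {P : Finset (Finset ι)} (h : B ∉ P) :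
    bigBlocks (insert B P) = bigIndicator B + bigBlocks P := Finset.sum_insert h

theorem singleBlocks_insert {B : Finset ι} {P : Finset (Finset ι)} (h : B ∉ P) :
    singleBlocks I (insert B P) = singleIndicator I B + singleBlocks I P := Finset.sum_insert h

/-- The coefficient of a set partition with `c` blocks, `N` of them with at least two elements and
`s` of them consisting of one row, in `rootSum`. -/
def rootCoeff (α β : ℤ) (c N s : ℕ) : ℕ :=
  if (c : ℤ) = α + β then chooseInt N (α - s) else 0

end Stat

/-! ### Forests with prescribed numbers of row and column roots -/

section RootSum
variable {ι R : Type*} [Ring R] [DecidableEq ι] {y : ι → ι → R} {I J Q S S' : Finset ι}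

/-- The sum of all forests with `α` roots in `I` and `β` roots in `J`. -/
def rootSum (y : ι → ι → R) (I J : Finset ι) (α β : ℤ) (S : Finset ι) : R :=
  ∑ Q ∈ S.powerset, if ((Q ∩ I).card : ℤ) = α ∧ ((Q ∩ J).card : ℤ) = β then forest y I J Q S else 0

theorem sum_pieriTerm (f : Finset ι → R) (A : Finset ι) (p : ℕ) :
    ∑ X ∈ A.powersetCard p, f X =
      ∑ Q ∈ A.powerset, if (Q.card : ℤ) = A.card - p then f (A \ Q) else 0 := by
  rw [← sum_powerset_sdiff, Finset.powersetCard_eq_filter, Finset.sum_filter]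
  refine Finset.sum_congr rfl fun X hX => ?_
  have hX := Finset.mem_powerset.1 hX
  rw [Finset.sdiff_sdiff_eq_self hX]
  have h1 := Finset.card_sdiff_of_subset hX
  have h2 := Finset.card_le_card hX
  congr 1
  rw [h1, eq_iff_iff]
  omega

/-- The rows used in the first factor and the columns used in the second are the vertices with a
parent; the roots form the complement. Integer parameters allow `p` and `q` to exceed the numbers of
rows and columns. -/
theorem pieriSum_mul_pieriSum (hIJ : ∀ i, i ∈ I ↔ i ∉ J) (S : Finset ι) (p q : ℕ) :
    pieriSum y S (S ∩ I) p * pieriSum (fun i j => y j i) S (S ∩ J) q =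
      rootSum y I J ((S ∩ I).card - p) ((S ∩ J).card - q) S := by
  have hJI : ∀ i, i ∈ J ↔ i ∉ I := fun i => by rw [hIJ, not_not]
  rw [pieriSum, pieriSum, sdiff_inter_rows hIJ, sdiff_inter_rows hJI, sum_pieriTerm, sum_pieriTerm,
    Finset.sum_mul_sum, rootSum]
  have := sum_powerset_split (S := S) (B := S ∩ I) Finset.inter_subset_left
    (fun Q₁ Q₂ => if (Q₁.card : ℤ) = (S ∩ I).card - p ∧ (Q₂.card : ℤ) = (S ∩ J).card - q then
      starSum y ((S ∩ I) \ Q₁) (S ∩ J) * starSum (fun i j => y j i) ((S ∩ J) \ Q₂) (S ∩ I) else 0)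
  rw [sdiff_inter_rows hIJ] at this
  rw [Finset.sum_congr rfl fun Q₁ _ => Finset.sum_congr rfl fun Q₂ _ => ?_, ← this]
  · refine Finset.sum_congr rfl fun Q hQ => ?_
    have hQ := Finset.mem_powerset.1 hQ
    have e1 : Q ∩ (S ∩ I) = Q ∩ I := by
      ext i; have := @hQ i; simp only [Finset.mem_inter]; tauto
    have e2 : Q \ (S ∩ I) = Q ∩ J := by
      ext i; have := @hQ i; have := hIJ i; simp only [Finset.mem_inter, Finset.mem_sdiff]; tauto
    have e3 : (S ∩ I) \ (Q ∩ I) = (S ∩ I) \ Q := by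
      ext i; simp only [Finset.mem_inter, Finset.mem_sdiff]; tauto
    have e4 : (S ∩ J) \ (Q ∩ J) = (S ∩ J) \ Q := by
      ext i; simp only [Finset.mem_inter, Finset.mem_sdiff]; tauto
    rw [e1, e2, e3, e4, forest]
  · split_ifs <;> simp_all

theorem rowTree_singleton_of_mem {v : ι} (hv : v ∈ I) : rowTree y I J {v} = 1 := by
  rw [rowTree, Finset.singleton_inter_of_mem hv, Finset.sum_singleton, forest]
  simp [starSum_left_empty, Finset.sdiff_eq_empty_iff_subset.2 Finset.inter_subset_left]

theorem rowTree_singleton_of_notMem {v : ι} (hv : v ∉ I) : rowTree y I J {v} = 0 := by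
  rw [rowTree, Finset.singleton_inter_of_notMem hv, Finset.sum_empty]

theorem colTree_singleton_of_mem {v : ι} (hv : v ∈ J) : colTree y I J {v} = 1 := by
  rw [colTree, Finset.singleton_inter_of_mem hv, Finset.sum_singleton, forest]
  simp [starSum_left_empty, Finset.sdiff_eq_empty_iff_subset.2 Finset.inter_subset_left]

theorem colTree_singleton_of_notMem {v : ι} (hv : v ∉ J) : colTree y I J {v} = 0 := by
  rw [colTree, Finset.singleton_inter_of_notMem hv, Finset.sum_empty]

/-- A tree has a single root, a row or a column. The function `f` carries the numbers of roots
along, so that the lemma can be used inside the sum over the remaining roots. -/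
theorem sum_rootedTree {M : Type*} [AddCommMonoid M] (hIJ : ∀ i, i ∈ I ↔ i ∉ J) (B : Finset ι)
    (f : R → ℤ → ℤ → M) (hf : ∀ a b, f 0 a b = 0) :
    ∑ Q ∈ B.powerset, f (rootedTree y I J Q B) (Q ∩ I).card (Q ∩ J).card =
      ∑ v ∈ B ∩ I, f (forest y I J {v} B) 1 0 + ∑ v ∈ B ∩ J, f (forest y I J {v} B) 0 1 := by
  have h : ∑ Q ∈ B.powerset, f (rootedTree y I J Q B) (Q ∩ I).card (Q ∩ J).card =
      ∑ Q ∈ B.powersetCard 1, f (forest y I J Q B) (Q ∩ I).card (Q ∩ J).card := by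
    rw [Finset.powersetCard_eq_filter, Finset.sum_filter]
    refine Finset.sum_congr rfl fun Q hQ => ?_
    rw [rootedTree, Finset.inter_eq_right.2 (Finset.mem_powerset.1 hQ)]
    split_ifs
    · rfl
    · exact hf _ _
  have hB : B = (B ∩ I) ∪ (B ∩ J) := by
    ext i; have := hIJ i; simp only [Finset.mem_inter, Finset.mem_union]; tauto
  have hd : Disjoint (B ∩ I) (B ∩ J) := by
    rw [Finset.disjoint_left]
    intro i h1 h2
    exact (hIJ i).1 (Finset.mem_of_mem_inter_right h1) (Finset.mem_of_mem_inter_right h2)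
  rw [h, Finset.powersetCard_one, Finset.sum_map]
  trans ∑ v ∈ (B ∩ I) ∪ (B ∩ J), f (forest y I J {v} B) ({v} ∩ I : Finset ι).card
    ({v} ∩ J : Finset ι).card
  · rw [← hB]; rfl
  rw [Finset.sum_union hd]
  congr 1
  · refine Finset.sum_congr rfl fun v hv => ?_
    have h1 := Finset.mem_of_mem_inter_right hv
    simp [Finset.singleton_inter_of_mem h1, Finset.singleton_inter_of_notMem ((hIJ v).1 h1)]
  · refine Finset.sum_congr rfl fun v hv => ?_
    have h1 := Finset.mem_of_mem_inter_right hv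
    have h2 : v ∉ I := fun h => (hIJ v).1 h h1
    simp [Finset.singleton_inter_of_mem h1, Finset.singleton_inter_of_notMem h2]

namespace FKSystem

/-- The tree that contains `s` uses up either one of the `α` row roots or one of the `β` column
roots. -/
theorem rootSum_of_mem (hy : FKSystem y) (hIJ : ∀ i, i ∈ I ↔ i ∉ J) {s : ι} (hs : s ∈ S)
    (α β : ℤ) : rootSum y I J α β S = ∑ B ∈ S.powerset with s ∈ B,
      (rowTree y I J B * rootSum y I J (α - 1) β (S \ B) +
        colTree y I J B * rootSum y I J α (β - 1) (S \ B)) := by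
  have h1 : rootSum y I J α β S = ∑ Q ∈ S.powerset, ∑ B ∈ S.powerset with s ∈ B,
      if ((Q ∩ I).card : ℤ) = α ∧ ((Q ∩ J).card : ℤ) = β then
        rootedTree y I J (Q ∩ B) B * forest y I J (Q \ B) (S \ B) else 0 := by
    rw [rootSum]
    refine Finset.sum_congr rfl fun Q hQ => ?_
    split_ifs
    · exact hy.forest_eq_sum_of_mem hIJ (Finset.mem_powerset.1 hQ) hs
    · simp
  rw [h1, Finset.sum_comm]
  refine Finset.sum_congr rfl fun B hB => ?_
  simp only [Finset.mem_filter, Finset.mem_powerset] at hB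
  have hc : ∀ K Q : Finset ι, ((Q ∩ K).card : ℤ) = (Q ∩ B ∩ K).card + ((Q \ B) ∩ K).card := by
    intro K Q
    have e1 : Q ∩ B ∩ K = (Q ∩ K) ∩ B := by ext; simp only [Finset.mem_inter]; tauto
    have e2 : (Q \ B) ∩ K = (Q ∩ K) \ B := by
      ext; simp only [Finset.mem_inter, Finset.mem_sdiff]; tauto
    rw [e1, e2]
    exact_mod_cast (Finset.card_inter_add_card_sdiff (Q ∩ K) B).symm
  rw [Finset.sum_congr rfl fun Q _ => by rw [hc I Q, hc J Q],
    sum_powerset_split hB.1 fun Q₁ Q₂ =>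
      if ((Q₁ ∩ I).card : ℤ) + (Q₂ ∩ I).card = α ∧ ((Q₁ ∩ J).card : ℤ) + (Q₂ ∩ J).card = β then
        rootedTree y I J Q₁ B * forest y I J Q₂ (S \ B) else 0]
  rw [sum_rootedTree hIJ B fun r a b => ∑ Q ∈ (S \ B).powerset,
    if a + (Q ∩ I).card = α ∧ b + (Q ∩ J).card = β then r * forest y I J Q (S \ B) else 0]
  · rw [rowTree, colTree, Finset.sum_mul, Finset.sum_mul]
    congr 1
    · refine Finset.sum_congr rfl fun v _ => ?_
      rw [rootSum, Finset.mul_sum]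
      refine Finset.sum_congr rfl fun Q _ => ?_
      rw [mul_ite, mul_zero]
      congr 1
      rw [eq_iff_iff]; omega
    · refine Finset.sum_congr rfl fun v _ => ?_
      rw [rootSum, Finset.mul_sum]
      refine Finset.sum_congr rfl fun Q _ => ?_
      rw [mul_ite, mul_zero]
      congr 1
      rw [eq_iff_iff]; omega
  · simp

theorem tree_commute (hy : FKSystem y) (B B' : Finset ι) (h : Disjoint B B') :
    Commute (tree y I J B) (tree y I J B') := by
  rw [tree, tree]
  split_ifs
  · exact Commute.one_left _
  · exact Commute.one_left _
  · exact Commute.one_right _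
  · rw [rowTree, rowTree]
    exact Commute.sum_left _ _ _ fun v _ => Commute.sum_right _ _ _ fun u _ =>
      hy.commute_forest h _ _

/-- The forest sums are combinations of products of trees, with binomial coefficients. -/
theorem rootSum_eq (hy : FKSystem y) (hIJ : ∀ i, i ∈ I ↔ i ∉ J) (α β : ℤ) (S : Finset ι) :
    rootSum y I J α β S = ∑ P ∈ setPartitions S,
      rootCoeff α β P.card (bigBlocks P) (singleBlocks I P) • blockProd (tree y I J) P := by
  induction hm : S.card using Nat.strong_induction_on generalizing S α β with
  | _ m ih =>
  rcases S.eq_empty_or_nonempty with rfl | ⟨s, hs⟩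
  · rw [setPartitions_empty, Finset.sum_singleton, blockProd_empty, rootSum]
    simp only [Finset.powerset_empty, Finset.sum_singleton, Finset.empty_inter, Finset.card_empty,
      Nat.cast_zero, forest_empty, rootCoeff, bigBlocks, Finset.sum_empty, singleBlocks, sub_zero,
      chooseInt_zero]
    split_ifs <;> first | omega | simp
  · rw [hy.rootSum_of_mem hIJ hs, sum_setPartitions_of_mem hs]
    refine Finset.sum_congr rfl fun B hB => ?_
    simp only [Finset.mem_filter, Finset.mem_powerset] at hB
    have hlt : (S \ B).card < m := by
      rw [← hm]; exact Finset.card_lt_card (Finset.sdiff_ssubset hB.1 ⟨s, hB.2⟩)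
    rw [ih _ hlt _ _ _ rfl, ih _ hlt _ _ _ rfl, Finset.mul_sum, Finset.mul_sum,
      ← Finset.sum_add_distrib]
    refine Finset.sum_congr rfl fun P hP => ?_
    have hBP := notMem_of_mem_setPartitions_sdiff ⟨s, hB.2⟩ hP
    rw [blockProd_insert hy.tree_commute hB.1 ⟨s, hB.2⟩ hP, mul_smul_comm, mul_smul_comm,
      bigBlocks_insert hBP, singleBlocks_insert hBP, Finset.card_insert_of_notMem hBP]
    generalize bigBlocks P = N, singleBlocks I P = t, P.card = c
    -- A single vertex has no choice of root: a row uses up one of `α` and is counted by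
    -- `singleBlocks`, a column uses up one of `β`. For a big block both choices have the same value
    -- and the binomial coefficients add by Pascal's rule.
    by_cases hB1 : B.card = 1
    · obtain ⟨v, rfl⟩ := Finset.card_eq_one.1 hB1
      rw [tree, if_pos hB1, one_mul, bigIndicator, if_pos hB1, singleIndicator]
      by_cases hv : v ∈ I
      · rw [rowTree_singleton_of_mem hv, colTree_singleton_of_notMem ((hIJ v).1 hv),
          if_pos ⟨hB1, v, by simpa using hv⟩, one_mul, zero_mul, smul_zero, add_zero, zero_add]
        congr 1
        rw [rootCoeff, rootCoeff]
        congr 1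
        · rw [eq_iff_iff]; omega
        · congr 1; push_cast; ring
      · rw [rowTree_singleton_of_notMem hv, colTree_singleton_of_mem (by have := hIJ v; tauto),
          if_neg (by simp [Finset.singleton_inter_of_notMem hv]),
          one_mul, zero_mul, smul_zero, zero_add, zero_add, zero_add]
        congr 1
        rw [rootCoeff, rootCoeff]
        congr 1
        rw [eq_iff_iff]; omega
    · have h2 : 2 ≤ B.card := by
        have : 0 < B.card := Finset.card_pos.2 ⟨s, hB.2⟩
        omega
      rw [hy.colTree_eq_rowTree hIJ h2, tree, if_neg hB1, bigIndicator, if_neg hB1, singleIndicator,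
        if_neg (by tauto), ← add_smul, zero_add]
      congr 1
      rw [rootCoeff, rootCoeff, rootCoeff, add_comm 1 N, chooseInt_succ]
      by_cases h : ((c + 1 : ℕ) : ℤ) = α + β
      · rw [if_pos h, if_pos (by omega), if_pos (by omega)]
        congr 2; ring
      · rw [if_neg h, if_neg (by omega), if_neg (by omega)]

end FKSystem
end RootSum

/-! ### The sums for hooks and multiplication by the sum of all edges -/

section LinkedSum
variable {ι R : Type*} [Ring R] [DecidableEq ι] {y : ι → ι → R} {I J Q S B : Finset ι}
  {P : Finset (Finset ι)} {C : Subsemiring R}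

theorem rowTree_eq_zero (h : B ∩ I = ∅) : rowTree y I J B = 0 := by
  rw [rowTree, h, Finset.sum_empty]

theorem colTree_eq_zero (h : B ∩ J = ∅) : colTree y I J B = 0 := by
  rw [colTree, h, Finset.sum_empty]

theorem card_inter_add_card_inter (hIJ : ∀ i, i ∈ I ↔ i ∉ J) (B : Finset ι) :
    (B ∩ I).card + (B ∩ J).card = B.card := by
  rw [← sdiff_inter_rows hIJ]
  have : B \ (B ∩ I) = B \ I := by ext; simp
  rw [this, Finset.card_inter_add_card_sdiff]

theorem bigIndicator_eq_one (h : B.card ≠ 1) : bigIndicator B = 1 := if_neg h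

theorem singleIndicator_of_ne (I : Finset ι) (h : B.card ≠ 1) : singleIndicator I B = 0 :=
  if_neg fun h' => h h'.1

theorem indicators_row {v : ι} (hB : B.card = 1) (hv : v ∈ B ∩ I) :
    bigIndicator B = 0 ∧ singleIndicator I B = 1 := ⟨if_pos hB, if_pos ⟨hB, v, hv⟩⟩

theorem eq_singleton_of_card {v : ι} (hB : B.card = 1) (hv : v ∈ B) : B = {v} := by
  obtain ⟨w, rfl⟩ := Finset.card_eq_one.1 hB
  rw [Finset.mem_singleton.1 hv]

theorem indicators_col (hIJ : ∀ i, i ∈ I ↔ i ∉ J) {u : ι} (hB : B.card = 1) (hu : u ∈ B ∩ J) :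
    bigIndicator B = 0 ∧ singleIndicator I B = 0 := by
  obtain ⟨hu, huJ⟩ := Finset.mem_inter.1 hu
  obtain rfl := eq_singleton_of_card hB hu
  refine ⟨if_pos hB, if_neg ?_⟩
  rw [Finset.singleton_inter_of_notMem fun h => (hIJ u).1 h huJ]
  simp

theorem setPartitions_card_eq (hP : P ∈ setPartitions S) (h : bigBlocks P = 0) :
    P.card = S.card := by
  have h1 := sum_card_inter hP S
  rw [Finset.inter_self] at h1
  rw [← h1, Finset.card_eq_sum_ones]
  refine Finset.sum_congr rfl fun B hB => ?_
  rw [Finset.inter_eq_left.2 (subset_of_mem_setPartitions hP hB)]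
  by_contra hne
  have := Finset.single_le_sum (f := bigIndicator) (fun _ _ => Nat.zero_le _) hB
  rw [bigIndicator_eq_one (Ne.symm hne)] at this
  rw [bigBlocks] at h
  omega

/-- The coefficient of a set partition with `c` blocks, `N` of them with at least two elements and
`s` of them consisting of one row, in `linkedSum`. -/
def linkedCoeff (α β : ℤ) (c N s : ℕ) : ℕ :=
  if (c : ℤ) = α + β + 1 ∧ N ≠ 0 then chooseInt (N - 1) (α - s) else 0

/-- A combination of products of trees for the set partitions into `α + β + 1` blocks. -/
def linkedSum (y : ι → ι → R) (I J : Finset ι) (α β : ℤ) (S : Finset ι) : R :=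
  ∑ P ∈ setPartitions S,
    linkedCoeff α β P.card (bigBlocks P) (singleBlocks I P) • blockProd (tree y I J) P

namespace FKSystem

theorem tree_eq_zero (hy : FKSystem y) (hIJ : ∀ i, i ∈ I ↔ i ∉ J) (hB : 2 ≤ B.card)
    (h : B ∩ I = ∅ ∨ B ∩ J = ∅) : tree y I J B = 0 := by
  rw [tree, if_neg (by omega)]
  rcases h with h | h
  · exact rowTree_eq_zero h
  · rw [← hy.colTree_eq_rowTree hIJ hB, colTree_eq_zero h]

/-- Pascal's rule for `binom(N, α - s)`, the counterpart of `e_p h_q` being a sum of two hooks. The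
assumption excludes the partition into single vertices, hence `N ≠ 0`. -/
theorem rootSum_eq_linkedSum (hy : FKSystem y) (hIJ : ∀ i, i ∈ I ↔ i ∉ J) {α β : ℤ}
    (h : α + β < S.card) :
    rootSum y I J α β S = linkedSum y I J α (β - 1) S + linkedSum y I J (α - 1) β S := by
  rw [hy.rootSum_eq hIJ, linkedSum, linkedSum, ← Finset.sum_add_distrib]
  refine Finset.sum_congr rfl fun P hP => ?_
  rw [← add_smul]
  congr 1
  rw [rootCoeff, linkedCoeff, linkedCoeff]
  by_cases hc : (P.card : ℤ) = α + β
  · have hN : bigBlocks P ≠ 0 := fun h0 => by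
      have := setPartitions_card_eq hP h0
      omega
    rw [if_pos hc, if_pos ⟨by omega, hN⟩, if_pos ⟨by omega, hN⟩]
    obtain ⟨N, hN⟩ := Nat.exists_eq_succ_of_ne_zero hN
    rw [hN, Nat.succ_eq_add_one, chooseInt_succ, Nat.add_sub_cancel, add_comm]
    congr 2; ring
  · rw [if_neg hc, if_neg (by omega), if_neg (by omega)]

theorem blockProd_tree_eq_zero (hy : FKSystem y) (hIJ : ∀ i, i ∈ I ↔ i ∉ J)
    (hP : P ∈ setPartitions S) (hB : B ∈ P) (h2 : B.card ≠ 1) (h : B ∩ I = ∅ ∨ B ∩ J = ∅) :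
    blockProd (tree y I J) P = 0 := by
  have := Finset.card_pos.2 (nonempty_of_mem_setPartitions hP hB)
  rw [← blockProd_erase hy.tree_commute hP hB, hy.tree_eq_zero hIJ (by omega) h, zero_mul]

/-- If the product of trees is not zero, every block except the single rows contains a column. So
there are at most `|S ∩ J| + s` blocks, the number of blocks then forces `α < s`, and the binomial
coefficient is zero. -/
theorem linkedSum_card_right (hy : FKSystem y) (hIJ : ∀ i, i ∈ I ↔ i ∉ J) (α : ℤ) (S : Finset ι) :
    linkedSum y I J α (S ∩ J).card S = 0 := by
  refine Finset.sum_eq_zero fun P hP => ?_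
  by_cases h : ∃ B ∈ P, B.card ≠ 1 ∧ B ∩ J = ∅
  · obtain ⟨B, hB, h1, h2⟩ := h
    rw [hy.blockProd_tree_eq_zero hIJ hP hB h1 (Or.inr h2), smul_zero]
  · push Not at h
    have key : P.card ≤ (S ∩ J).card + singleBlocks I P := by
      rw [← sum_card_inter hP, singleBlocks, ← Finset.sum_add_distrib, Finset.card_eq_sum_ones]
      refine Finset.sum_le_sum fun B hB => ?_
      by_cases hB1 : B.card = 1
      · obtain ⟨v, rfl⟩ := Finset.card_eq_one.1 hB1
        by_cases hv : v ∈ J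
        · simp [hv]
        · have : v ∈ I := (hIJ v).2 hv
          simp [singleIndicator, this]
      · have := Finset.card_pos.2 (h B hB hB1)
        omega
    rw [linkedCoeff]
    split_ifs with hc
    · rw [chooseInt_of_neg _ (by omega), zero_smul]
    · rw [zero_smul]

/-- If the product of trees is not zero, every big block contains a row. So `N + s ≤ |S ∩ I| = α`,
and the binomial coefficient `binom(N - 1, α - s)` is zero. -/
theorem linkedSum_card_left (hy : FKSystem y) (hIJ : ∀ i, i ∈ I ↔ i ∉ J) (β : ℤ) (S : Finset ι) :
    linkedSum y I J (S ∩ I).card β S = 0 := by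
  refine Finset.sum_eq_zero fun P hP => ?_
  by_cases h : ∃ B ∈ P, B.card ≠ 1 ∧ B ∩ I = ∅
  · obtain ⟨B, hB, h1, h2⟩ := h
    rw [hy.blockProd_tree_eq_zero hIJ hP hB h1 (Or.inl h2), smul_zero]
  · push Not at h
    have key : bigBlocks P + singleBlocks I P ≤ (S ∩ I).card := by
      rw [← sum_card_inter hP, singleBlocks, bigBlocks, ← Finset.sum_add_distrib]
      refine Finset.sum_le_sum fun B hB => ?_
      by_cases hB1 : B.card = 1
      · obtain ⟨v, rfl⟩ := Finset.card_eq_one.1 hB1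
        by_cases hv : v ∈ I <;> simp [singleIndicator, bigIndicator, hv]
      · have := Finset.card_pos.2 (h B hB hB1)
        rw [bigIndicator_eq_one hB1, singleIndicator_of_ne I hB1]
        omega
    rw [linkedCoeff]
    split_ifs with hc
    · rw [chooseInt_of_lt (by omega), zero_smul]
    · rw [zero_smul]

end FKSystem

/-- The contribution of the ways to split the block `B` to the product of `linkedSum` and
`edgeSum`, if the other blocks have the given statistics. -/
def linkedMerge (y : ι → ι → R) (I J : Finset ι) (α β : ℤ) (c N s : ℕ) (B : Finset ι) : R :=
  ∑ D ∈ B.powerset, ∑ v ∈ D ∩ I, ∑ u ∈ (B \ D) ∩ J,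
    linkedCoeff α β (c + 2) (N + (bigIndicator D + bigIndicator (B \ D)))
      (s + (singleIndicator I D + singleIndicator I (B \ D))) •
        (tree y I J D * tree y I J (B \ D) * y v u)

theorem linkedMerge_mem (hC : ∀ v ∈ I, ∀ u ∈ J, y v u ∈ C) (α β : ℤ) (c N s : ℕ) (B : Finset ι) :
    linkedMerge y I J α β c N s B ∈ C :=
  C.sum_mem fun _ _ => C.sum_mem fun v hv => C.sum_mem fun u hu => nsmul_mem
    (C.mul_mem (C.mul_mem (tree_mem hC _) (tree_mem hC _))
      (hC v (Finset.mem_of_mem_inter_right hv) u (Finset.mem_of_mem_inter_right hu))) _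

/-- Only the edges between different blocks are kept; those inside a block are discarded, which is
where the product loses terms. -/
theorem edgeSum_dom_of_mem_setPartitions (hC : ∀ v ∈ I, ∀ u ∈ J, y v u ∈ C)
    (hP : P ∈ setPartitions S) :
    Dom C (∑ B ∈ P, ∑ D ∈ P.erase B, ∑ v ∈ B ∩ I, ∑ u ∈ D ∩ J, y v u) (edgeSum y I J S) := by
  have hd : ∀ K : Finset ι, (P : Set (Finset ι)).PairwiseDisjoint fun B => B ∩ K :=
    fun K B hB B' hB' h => (disjoint_of_mem_setPartitions hP hB hB' h).mono
      Finset.inter_subset_left Finset.inter_subset_left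
  have hK : ∀ K : Finset ι, S ∩ K = P.biUnion fun B => B ∩ K := by
    intro K
    ext i
    rw [← (mem_setPartitions.1 hP).2.2]
    simp only [Finset.mem_biUnion, Finset.mem_inter, Finset.mem_sup, id]
    tauto
  have e : edgeSum y I J S = ∑ B ∈ P, ∑ D ∈ P, ∑ v ∈ B ∩ I, ∑ u ∈ D ∩ J, y v u := by
    rw [edgeSum, hK I, Finset.sum_biUnion (hd I)]
    refine Finset.sum_congr rfl fun B _ => ?_
    rw [Finset.sum_comm (s := P)]
    refine Finset.sum_congr rfl fun v _ => ?_
    rw [hK J, Finset.sum_biUnion (hd J)]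
  rw [e]
  refine Dom.sum fun B _ => ?_
  refine Dom.sum_subset (f := fun D => ∑ v ∈ B ∩ I, ∑ u ∈ D ∩ J, y v u)
    (Finset.erase_subset _ _) fun D _ => ?_
  exact C.sum_mem fun v hv => C.sum_mem fun u hu => hC v (Finset.mem_of_mem_inter_right hv) u
      (Finset.mem_of_mem_inter_right hu)

namespace FKSystem

/-- A partition with two distinguished blocks is the same as a coarser partition with a
distinguished block that is cut in two. The coefficient still refers to the finer partition. -/
theorem sum_linkedMerge_eq (hy : FKSystem y) (α β : ℤ) (S : Finset ι) :
    ∑ P ∈ setPartitions S, (linkedCoeff α β P.card (bigBlocks P) (singleBlocks I P) •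
        blockProd (tree y I J) P) *
          ∑ B ∈ P, ∑ D ∈ P.erase B, ∑ v ∈ B ∩ I, ∑ u ∈ D ∩ J, y v u =
      ∑ P ∈ setPartitions S, ∑ B ∈ P, linkedMerge y I J α β (P.erase B).card
        (bigBlocks (P.erase B)) (singleBlocks I (P.erase B)) B *
          blockProd (tree y I J) (P.erase B) := by
  let f : Finset ι → Finset ι → Finset (Finset ι) → R := fun B D P =>
    ∑ v ∈ B ∩ I, ∑ u ∈ D ∩ J, linkedCoeff α β (P.card + 2)
      (bigBlocks P + (bigIndicator B + bigIndicator D))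
      (singleBlocks I P + (singleIndicator I B + singleIndicator I D)) •
        (tree y I J B * tree y I J D * y v u * blockProd (tree y I J) P)
  -- Empty blocks contribute zero, so sums over nonempty sets may be replaced by sums over all
  -- subsets.
  have hf : ∀ B, B = ∅ → ∀ D P, f B D P = 0 := by
    rintro _ rfl D P
    simp [f]
  have hf' : ∀ D, D = ∅ → ∀ B P, f B D P = 0 := by
    rintro _ rfl D P
    simp [f]
  have h1 : ∀ P ∈ setPartitions S, (linkedCoeff α β P.card (bigBlocks P) (singleBlocks I P) •
        blockProd (tree y I J) P) *
          ∑ B ∈ P, ∑ D ∈ P.erase B, ∑ v ∈ B ∩ I, ∑ u ∈ D ∩ J, y v u =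
      ∑ B ∈ P, ∑ D ∈ P.erase B, f B D ((P.erase B).erase D) := by
    intro P hP
    simp only [Finset.mul_sum]
    refine Finset.sum_congr rfl fun B hB => Finset.sum_congr rfl fun D hD =>
      Finset.sum_congr rfl fun v hv => Finset.sum_congr rfl fun u hu => ?_
    have hPB := erase_mem_setPartitions hP hB
    have hPD := erase_mem_setPartitions hPB hD
    -- The edge does not touch the other blocks, so it can be moved next to the two trees that it
    -- joins.
    have hc : ∀ K ∈ (P.erase B).erase D, Commute (y v u) (tree y I J K) := by
      intro K hK
      have hK1 := subset_of_mem_setPartitions hPD hK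
      have hv' : v ∉ K := fun h => by
        have := hK1 h
        simp only [Finset.mem_sdiff] at this
        exact this.1.2 (Finset.mem_of_mem_inter_left hv)
      have hu' : u ∉ K := fun h => by
        have := hK1 h
        simp only [Finset.mem_sdiff] at this
        exact this.2 (Finset.mem_of_mem_inter_left hu)
      rw [tree]
      split_ifs
      · exact Commute.one_right _
      · rw [rowTree]
        exact Commute.sum_right _ _ _ fun i _ => hy.letter_commute_forest hv' hu'
    have e1 : P = insert B (insert D ((P.erase B).erase D)) := by
      rw [Finset.insert_erase hD, Finset.insert_erase hB]
    have hB' : B ∉ insert D ((P.erase B).erase D) := by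
      rw [Finset.insert_erase hD]; exact Finset.notMem_erase B P
    have hD' : D ∉ (P.erase B).erase D := Finset.notMem_erase _ _
    rw [← blockProd_erase hy.tree_commute hP hB, ← blockProd_erase hy.tree_commute hPB hD,
      smul_mul_assoc, mul_assoc (tree y I J B * tree y I J D), (commute_blockProd hc).eq]
    nth_rewrite 1 [e1]
    nth_rewrite 2 [e1]
    nth_rewrite 3 [e1]
    rw [Finset.card_insert_of_notMem hB', Finset.card_insert_of_notMem hD',
      bigBlocks_insert hB', bigBlocks_insert hD', singleBlocks_insert hB', singleBlocks_insert hD']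
    simp only [mul_assoc]
    congr 2 <;> ring
  rw [Finset.sum_congr rfl h1,
    sum_setPartitions_marked fun B P => ∑ D ∈ P, f B D (P.erase D)]
  rw [sum_setPartitions_marked fun B P => linkedMerge y I J α β P.card
    (bigBlocks P) (singleBlocks I P) B * blockProd (tree y I J) P]
  have h2 : ∀ B, ∑ P ∈ setPartitions (S \ B), ∑ D ∈ P, f B D (P.erase D) =
      ∑ D ∈ (S \ B).powerset, ∑ P ∈ setPartitions ((S \ B) \ D), f B D P := by
    intro B
    rw [sum_setPartitions_marked, Finset.sum_filter]
    refine Finset.sum_congr rfl fun D _ => ?_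
    rw [ite_eq_left_iff]
    intro hD
    exact (Finset.sum_eq_zero fun P _ =>
      hf' D (Finset.not_nonempty_iff_eq_empty.1 hD) B P).symm
  rw [Finset.sum_filter, Finset.sum_filter]
  trans ∑ B ∈ S.powerset, ∑ D ∈ (S \ B).powerset, ∑ P ∈ setPartitions ((S \ B) \ D), f B D P
  · refine Finset.sum_congr rfl fun B _ => ?_
    rw [← h2, ite_eq_left_iff]
    intro hB
    exact (Finset.sum_eq_zero fun P _ => Finset.sum_eq_zero fun D _ =>
      hf B (Finset.not_nonempty_iff_eq_empty.1 hB) D _).symm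
  rw [← sum_powerset_powerset S fun B D => ∑ P ∈ setPartitions ((S \ B) \ D), f B D P]
  refine Finset.sum_congr rfl fun B _ => ?_
  split_ifs with hB
  · have : ∀ D ∈ B.powerset, (S \ D) \ (B \ D) = S \ B := by
      intro D hD
      ext i
      have hDB := Finset.mem_powerset.1 hD
      have := @hDB i
      simp only [Finset.mem_sdiff]; tauto
    rw [Finset.sum_congr rfl fun D hD => by rw [this D hD], Finset.sum_comm]
    refine Finset.sum_congr rfl fun P _ => ?_
    simp only [linkedMerge, Finset.sum_mul, f, smul_mul_assoc]
  · obtain rfl := Finset.not_nonempty_iff_eq_empty.1 hB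
    simp [f]

theorem sum_linkedMerge_dom (hy : FKSystem y) (hC : ∀ v ∈ I, ∀ u ∈ J, y v u ∈ C) (α β : ℤ)
    (S : Finset ι) :
    Dom C (∑ P ∈ setPartitions S, ∑ B ∈ P, linkedMerge y I J α β (P.erase B).card
        (bigBlocks (P.erase B)) (singleBlocks I (P.erase B)) B *
          blockProd (tree y I J) (P.erase B))
      (linkedSum y I J α β S * edgeSum y I J S) := by
  rw [← hy.sum_linkedMerge_eq, linkedSum, Finset.sum_mul]
  exact Dom.sum fun P hP => Dom.mul_left (nsmul_mem (blockProd_mem C fun B _ => tree_mem hC B) _)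
    (edgeSum_dom_of_mem_setPartitions hC hP)

end FKSystem
end LinkedSum

/-! ### Comparing one set partition with its refinements -/

section LinkedDom
variable {ι R : Type*} [Ring R] [DecidableEq ι] {y : ι → ι → R} {I J Q S B : Finset ι}
  {P : Finset (Finset ι)} {C : Subsemiring R}

/-- With `N = p + q + 2` and `i = p + 1`, the two sides differ by the factor `i (N - i) / (N - 1) ≥
1`. This and the next two lemmas compare `binom(N, i)` with `N` times the coefficient after cutting
one big block into parts of which one or two are single vertices. -/
theorem choose_le_mul_choose_sub_two (p q : ℕ) :
    (p + q + 2).choose (p + 1) ≤ (p + q + 2) * (p + q).choose p := by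
  have h1 := Nat.add_one_mul_choose_eq (p + q) p
  have h2 := Nat.choose_mul_succ_eq (p + q + 1) (p + 1)
  rw [show p + q + 1 + 1 - (p + 1) = q + 1 by omega] at h2
  have h3 : (p + q + 1) * ((p + q + 2) * (p + q).choose p) =
      (p + q + 2).choose (p + 1) * ((p + 1) * (q + 1)) := by
    calc _ = (p + q + 2) * ((p + q + 1) * (p + q).choose p) := by ring
      _ = (p + 1) * ((p + q + 1).choose (p + 1) * (p + q + 1 + 1)) := by rw [h1]; ring
      _ = _ := by rw [h2]; ring
  have h4 : p + q + 1 ≤ (p + 1) * (q + 1) := by nlinarith [Nat.zero_le (p * q)]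
  have h5 : (p + q + 1) * (p + q + 2).choose (p + 1) ≤
      (p + q + 1) * ((p + q + 2) * (p + q).choose p) := by
    rw [h3, mul_comm (Nat.choose _ _)]
    exact Nat.mul_le_mul_right _ h4
  exact Nat.le_of_mul_le_mul_left h5 (Nat.succ_pos _)

theorem choose_le_mul_choose_sub_one (p q : ℕ) :
    (p + q + 2).choose (p + 1) ≤ (p + q + 2) * (p + q + 1).choose p := by
  have h1 := Nat.add_one_mul_choose_eq (p + q + 1) p
  rw [show p + q + 2 = p + q + 1 + 1 by ring, h1]
  exact Nat.le_mul_of_pos_right _ (Nat.succ_pos p)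

theorem choose_le_mul_choose_sub_one' (p q : ℕ) :
    (p + q + 2).choose (p + 1) ≤ (p + q + 2) * (p + q + 1).choose (p + 1) := by
  have h2 := Nat.choose_mul_succ_eq (p + q + 1) (p + 1)
  rw [show p + q + 1 + 1 - (p + 1) = q + 1 by omega] at h2
  rw [show p + q + 2 = p + q + 1 + 1 by ring, mul_comm _ (Nat.choose _ _), h2]
  exact Nat.le_mul_of_pos_right _ (Nat.succ_pos q)

theorem nsmul_dom_nsmul {r : R} (hr : r ∈ C) {m n : ℕ} (h : m ≤ n) : Dom C (m • r) (n • r) := by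
  obtain ⟨d, rfl⟩ := Nat.exists_eq_add_of_le h
  rw [Dom, add_smul, add_sub_cancel_left]
  exact nsmul_mem hr d

theorem mergeRight_dom_linkedMerge {f : Finset ι → R} {α β : ℤ} {c N s m m' : ℕ}
    (hC : ∀ v ∈ I, ∀ u ∈ J, y v u ∈ C)
    (h : ∀ D D' : Finset ι, D ⊆ B → D' = B \ D → ∀ v ∈ D ∩ I, ∀ u ∈ D' ∩ J,
      Dom C (m • (f D * f D'))
        (m' • (linkedCoeff α β (c + 2) (N + (bigIndicator D + bigIndicator D'))
          (s + (singleIndicator I D + singleIndicator I D')) • (tree y I J D * tree y I J D')))) :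
    Dom C (m • mergeRight y I J f f B) (m' • linkedMerge y I J α β c N s B) := by
  simp only [mergeRight, linkedMerge, Finset.smul_sum]
  refine Dom.sum fun D hD => Dom.sum fun v hv => Dom.sum fun u hu => ?_
  have := Dom.mul_right (hC v (Finset.mem_of_mem_inter_right hv) u
    (Finset.mem_of_mem_inter_right hu)) (h D _ (Finset.mem_powerset.1 hD) rfl v hv u hu)
  simpa only [smul_mul_assoc] using this

theorem smul_dom_smul {a b : R} (m : ℕ) (h : Dom C a b) : Dom C (m • a) (m • b) := by
  rw [Dom, ← smul_sub]; exact nsmul_mem h m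

namespace FKSystem

/-- Here `N` counts the other big blocks, so the partition has `N + 1` of them, and `0 < p + 1 < N +
1`. The last edge of the tree is cut; the four cases are whether the part at `v` is a single row and
the part at `u` a single column. -/
theorem tree_dom_linkedMerge (hy : FKSystem y) (hIJ : ∀ i, i ∈ I ↔ i ∉ J)
    (hC : ∀ v ∈ I, ∀ u ∈ J, y v u ∈ C) {α β : ℤ} {c N s : ℕ} (hB : 2 ≤ B.card)
    (hc : (c : ℤ) + 1 = α + β) (p q : ℕ) (hp : α - s = p + 1) (hN : N + 1 = p + q + 2) :
    Dom C ((N + 1).choose (p + 1) • tree y I J B)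
      ((N + 1) • linkedMerge y I J α β c N s B) := by
  obtain rfl : N = p + q + 1 := by omega
  refine (smul_dom_smul _ (hy.tree_dom_mergeRight hIJ hC hB)).trans
    (mergeRight_dom_linkedMerge hC ?_)
  intro D D' _ _ v hv u hu
  rw [← mul_smul]
  refine nsmul_dom_nsmul (C.mul_mem (tree_mem hC _) (tree_mem hC _)) ?_
  rw [linkedCoeff]
  have hc' : ((c + 2 : ℕ) : ℤ) = α + β + 1 := by push_cast; omega
  by_cases hD : D.card = 1 <;> by_cases hD' : D'.card = 1
  · rw [(indicators_row hD hv).1, (indicators_row hD hv).2, (indicators_col hIJ hD' hu).1,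
      (indicators_col hIJ hD' hu).2, if_pos ⟨hc', by omega⟩,
      show α - ((s + (1 + 0) : ℕ) : ℤ) = (p : ℕ) by push_cast; omega, chooseInt_natCast]
    exact choose_le_mul_choose_sub_two p q
  · rw [(indicators_row hD hv).1, (indicators_row hD hv).2, bigIndicator_eq_one hD',
      singleIndicator_of_ne I hD', if_pos ⟨hc', by omega⟩,
      show α - ((s + (1 + 0) : ℕ) : ℤ) = (p : ℕ) by push_cast; omega, chooseInt_natCast]
    exact choose_le_mul_choose_sub_one p q
  · rw [bigIndicator_eq_one hD, singleIndicator_of_ne I hD, (indicators_col hIJ hD' hu).1,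
      (indicators_col hIJ hD' hu).2, if_pos ⟨hc', by omega⟩,
      show α - ((s + (0 + 0) : ℕ) : ℤ) = (p + 1 : ℕ) by push_cast; omega, chooseInt_natCast]
    exact choose_le_mul_choose_sub_one' p q
  · rw [bigIndicator_eq_one hD, singleIndicator_of_ne I hD, bigIndicator_eq_one hD',
      singleIndicator_of_ne I hD', if_pos ⟨hc', by omega⟩,
      show α - ((s + (0 + 0) : ℕ) : ℤ) = (p + 1 : ℕ) by push_cast; omega, chooseInt_natCast]
    exact Nat.le_mul_of_pos_left _ (Nat.succ_pos _)

/-- For `α = s` a part that is a single row gets coefficient zero and all other cuts get coefficient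
one. Such parts do not occur in the merge of column-rooted trees, as a single row has no column
root. -/
theorem tree_dom_linkedMerge_of_col (hy : FKSystem y) (hIJ : ∀ i, i ∈ I ↔ i ∉ J)
    (hC : ∀ v ∈ I, ∀ u ∈ J, y v u ∈ C) {α β : ℤ} {c N s : ℕ} (hB : 2 ≤ (B ∩ J).card)
    (hc : (c : ℤ) + 1 = α + β) (hs : α - s = 0) :
    Dom C (tree y I J B) (linkedMerge y I J α β c N s B) := by
  have hB2 : 2 ≤ B.card := hB.trans (Finset.card_le_card Finset.inter_subset_left)
  rw [tree, if_neg (by omega), ← hy.colTree_eq_rowTree hIJ hB2, ← one_smul ℕ (linkedMerge ..)]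
  refine (hy.colTree_dom_mergeRight hIJ hC hB).trans ?_
  rw [← one_smul ℕ (mergeRight ..)]
  refine mergeRight_dom_linkedMerge hC ?_
  intro D D' _ _ v hv u hu
  rw [one_smul, one_smul]
  have hc' : ((c + 2 : ℕ) : ℤ) = α + β + 1 := by push_cast; omega
  by_cases hD : D.card = 1
  · have hD2 := eq_singleton_of_card hD (Finset.mem_of_mem_inter_left hv)
    rw [hD2, colTree_singleton_of_notMem ((hIJ v).1 (Finset.mem_of_mem_inter_right hv)), zero_mul]
    exact Dom.of_mem (nsmul_mem (C.mul_mem (tree_mem hC _) (tree_mem hC _)) _)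
  · have h1 := Finset.card_pos.2 ⟨v, Finset.mem_of_mem_inter_left hv⟩
    have hcoeff : linkedCoeff α β (c + 2) (N + (bigIndicator D + bigIndicator D'))
        (s + (singleIndicator I D + singleIndicator I D')) = 1 := by
      have : singleIndicator I D' = 0 := by
        by_cases hD' : D'.card = 1
        · exact (indicators_col hIJ hD' hu).2
        · exact singleIndicator_of_ne I hD'
      rw [linkedCoeff, bigIndicator_eq_one hD, singleIndicator_of_ne I hD, this,
        if_pos ⟨hc', by omega⟩, show α - ((s + (0 + 0) : ℕ) : ℤ) = 0 by push_cast; omega,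
        chooseInt_zero_right]
    have hD' : colTree y I J D' = tree y I J D' := by
      rw [tree]
      split_ifs with h
      · rw [eq_singleton_of_card h (Finset.mem_of_mem_inter_left hu),
          colTree_singleton_of_mem (Finset.mem_of_mem_inter_right hu)]
      · have := Finset.card_pos.2 ⟨u, Finset.mem_of_mem_inter_left hu⟩
        exact hy.colTree_eq_rowTree hIJ (by omega)
    rw [hcoeff, one_smul, hD', hy.colTree_eq_rowTree hIJ (by omega),
      show tree y I J D = rowTree y I J D from if_neg hD]
    exact Dom.refl C _

/-- At the upper end of the binomial coefficients it is the cuts with a single column that get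
coefficient zero; row-rooted trees avoid these. -/
theorem tree_dom_linkedMerge_of_row (hy : FKSystem y) (hIJ : ∀ i, i ∈ I ↔ i ∉ J)
    (h2 : ∀ r : R, r + r = 0 → r = 0) (hC : ∀ v ∈ I, ∀ u ∈ J, y v u ∈ C) {α β : ℤ} {c N s : ℕ}
    (hB : 2 ≤ (B ∩ I).card) (hc : (c : ℤ) + 1 = α + β) (hs : α - s = N + 1) :
    Dom C (tree y I J B) (linkedMerge y I J α β c N s B) := by
  have hB2 : 2 ≤ B.card := hB.trans (Finset.card_le_card Finset.inter_subset_left)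
  rw [tree, if_neg (by omega), ← one_smul ℕ (linkedMerge ..)]
  refine (hy.rowTree_dom_mergeRight hIJ h2 hC hB).trans ?_
  rw [← one_smul ℕ (mergeRight ..)]
  refine mergeRight_dom_linkedMerge hC ?_
  intro D D' _ _ v hv u hu
  rw [one_smul, one_smul]
  have hc' : ((c + 2 : ℕ) : ℤ) = α + β + 1 := by push_cast; omega
  by_cases hD' : D'.card = 1
  · have hD2 := eq_singleton_of_card hD' (Finset.mem_of_mem_inter_left hu)
    have huI : u ∉ I := fun h => (hIJ u).1 h (Finset.mem_of_mem_inter_right hu)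
    rw [hD2, rowTree_singleton_of_notMem huI, mul_zero]
    exact Dom.of_mem (nsmul_mem (C.mul_mem (tree_mem hC _) (tree_mem hC _)) _)
  · have hcoeff : linkedCoeff α β (c + 2) (N + (bigIndicator D + bigIndicator D'))
        (s + (singleIndicator I D + singleIndicator I D')) = 1 := by
      have h1 : (bigIndicator D = 0 ∧ singleIndicator I D = 1) ∨
          (bigIndicator D = 1 ∧ singleIndicator I D = 0) := by
        by_cases hD : D.card = 1
        · exact Or.inl (indicators_row hD hv)
        · exact Or.inr ⟨bigIndicator_eq_one hD, singleIndicator_of_ne I hD⟩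
      rw [linkedCoeff, bigIndicator_eq_one hD', singleIndicator_of_ne I hD',
        if_pos ⟨hc', by omega⟩,
        show α - ((s + (singleIndicator I D + 0) : ℕ) : ℤ) =
          (N + (bigIndicator D + 1) - 1 : ℕ) by push_cast; omega, chooseInt_self]
    have hD : rowTree y I J D = tree y I J D := by
      rw [tree]
      split_ifs with h
      · rw [eq_singleton_of_card h (Finset.mem_of_mem_inter_left hv),
          rowTree_singleton_of_mem (Finset.mem_of_mem_inter_right hv)]
      · rfl
    rw [hcoeff, one_smul, hD, show tree y I J D' = rowTree y I J D' from if_neg hD']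
    exact Dom.refl C _

/-- One set partition in the comparison of `rootSum` with `linkedSum * edgeSum`. -/
theorem blockProd_dom_sum_linkedMerge (hy : FKSystem y) (hIJ : ∀ i, i ∈ I ↔ i ∉ J)
    (h2 : ∀ r : R, r + r = 0 → r = 0) (hC : ∀ v ∈ I, ∀ u ∈ J, y v u ∈ C)
    (hdiv : ∀ (m : ℕ) (r : R), m ≠ 0 → m • r ∈ C → r ∈ C) {α β : ℤ}
    (hα : α < (S ∩ I).card) (hβ : β < (S ∩ J).card) (hP : P ∈ setPartitions S) :
    Dom C (rootCoeff α β P.card (bigBlocks P) (singleBlocks I P) • blockProd (tree y I J) P)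
      (∑ B ∈ P, linkedMerge y I J α β (P.erase B).card (bigBlocks (P.erase B))
        (singleBlocks I (P.erase B)) B * blockProd (tree y I J) (P.erase B)) := by
  have hprod : ∀ P' : Finset (Finset ι), blockProd (tree y I J) P' ∈ C := fun P' =>
    blockProd_mem C fun B _ => tree_mem hC B
  have hmem : ∀ B ∈ P, linkedMerge y I J α β (P.erase B).card (bigBlocks (P.erase B))
      (singleBlocks I (P.erase B)) B * blockProd (tree y I J) (P.erase B) ∈ C := fun B _ =>
    C.mul_mem (linkedMerge_mem hC _ _ _ _ _ B) (hprod _)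
  have herase : ∀ B ∈ P, (P.erase B).card + 1 = P.card ∧
      bigBlocks P = bigIndicator B + bigBlocks (P.erase B) ∧
      singleBlocks I P = singleIndicator I B + singleBlocks I (P.erase B) := by
    intro B hB
    refine ⟨Finset.card_erase_add_one hB, ?_, ?_⟩
    · rw [← bigBlocks_insert (Finset.notMem_erase B P), Finset.insert_erase hB]
    · rw [← singleBlocks_insert (Finset.notMem_erase B P), Finset.insert_erase hB]
  rw [rootCoeff]
  by_cases hc : (P.card : ℤ) = α + β
  swap
  · rw [if_neg hc, zero_smul]
    exact Dom.of_mem (C.sum_mem hmem)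
  rw [if_pos hc]
  rcases lt_trichotomy (α - singleBlocks I P) 0 with hi | hi | hi
  · rw [chooseInt_of_neg _ hi, zero_smul]
    exact Dom.of_mem (C.sum_mem hmem)
  -- If every block had at most one column, then `|S ∩ J| + s` would be at most the number `α + β`
  -- of blocks; with `α = s` this contradicts `hβ`.
  · obtain ⟨B, hB, hB2⟩ : ∃ B ∈ P, 2 ≤ (B ∩ J).card := by
      by_contra! hcon
      have key : (S ∩ J).card + singleBlocks I P ≤ P.card := by
        rw [← sum_card_inter hP, singleBlocks, ← Finset.sum_add_distrib, Finset.card_eq_sum_ones]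
        refine Finset.sum_le_sum fun B hB => ?_
        have h1 := hcon B hB
        by_cases hB1 : B.card = 1
        · obtain ⟨v, rfl⟩ := Finset.card_eq_one.1 hB1
          by_cases hv : v ∈ I
          · have := (hIJ v).1 hv
            simp [singleIndicator, hv, this]
          · simp only [singleIndicator, Finset.singleton_inter_of_notMem hv]
            simp
            omega
        · rw [singleIndicator_of_ne I hB1]
          omega
      omega
    have hB1 : 2 ≤ B.card := hB2.trans (Finset.card_le_card Finset.inter_subset_left)
    obtain ⟨e1, e2, e3⟩ := herase B hB
    rw [singleIndicator_of_ne I (by omega)] at e3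
    rw [hi, chooseInt_zero_right, one_smul, ← blockProd_erase hy.tree_commute hP hB]
    exact (Dom.mul_right (hprod _) (hy.tree_dom_linkedMerge_of_col hIJ hC hB2 (by omega)
      (by omega))).trans (Dom.single_le_sum (f := fun B => linkedMerge y I J α β (P.erase B).card
        (bigBlocks (P.erase B)) (singleBlocks I (P.erase B)) B *
          blockProd (tree y I J) (P.erase B)) hB hmem)
  · rcases lt_trichotomy (α - singleBlocks I P) (bigBlocks P) with hN | hN | hN
    · obtain ⟨p, hp⟩ := Int.eq_succ_of_zero_lt hi
      obtain ⟨q, hq⟩ : ∃ q, bigBlocks P = p + q + 2 :=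
        ⟨bigBlocks P - (p + 2), by omega⟩
      rw [hp, show (p : ℤ) + 1 = (p + 1 : ℕ) by push_cast; rfl, chooseInt_natCast, hq]
      -- Averaging: the product of trees is counted once for each of its `p + q + 2` big blocks, and
      -- the common factor is divided out by `hdiv`.
      have key : Dom C ((p + q + 2) • ((p + q + 2).choose (p + 1) • blockProd (tree y I J) P))
          ((p + q + 2) • ∑ B ∈ P, linkedMerge y I J α β (P.erase B).card
            (bigBlocks (P.erase B)) (singleBlocks I (P.erase B)) B *
              blockProd (tree y I J) (P.erase B)) := by
        nth_rewrite 1 [← hq]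
        rw [bigBlocks, Finset.sum_smul, Finset.smul_sum]
        refine Dom.sum fun B hB => ?_
        by_cases hB1 : B.card = 1
        · rw [bigIndicator, if_pos hB1, zero_smul]
          exact Dom.of_mem (nsmul_mem (hmem B hB) _)
        · have hpos := Finset.card_pos.2 (nonempty_of_mem_setPartitions hP hB)
          obtain ⟨e1, e2, e3⟩ := herase B hB
          rw [singleIndicator_of_ne I hB1] at e3
          rw [bigIndicator_eq_one hB1] at e2
          have := hy.tree_dom_linkedMerge hIJ hC (B := B) (α := α) (β := β)
            (c := (P.erase B).card) (N := bigBlocks (P.erase B))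
            (s := singleBlocks I (P.erase B)) (by omega) (by omega) p q
            (by omega) (by omega)
          rw [bigIndicator_eq_one hB1, one_smul, ← blockProd_erase hy.tree_commute hP hB,
            ← smul_mul_assoc, ← smul_mul_assoc]
          rw [show bigBlocks (P.erase B) + 1 = p + q + 2 by omega] at this
          exact Dom.mul_right (hprod _) this
      rw [Dom, ← smul_sub] at key
      exact hdiv _ _ (by omega) key
    -- If every block had at most one row, then `|S ∩ I|` would be at most `N + s = α`, against
    -- `hα`.
    · obtain ⟨B, hB, hB2⟩ : ∃ B ∈ P, 2 ≤ (B ∩ I).card := by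
        by_contra! hcon
        have key : (S ∩ I).card ≤ bigBlocks P + singleBlocks I P := by
          rw [← sum_card_inter hP, singleBlocks, bigBlocks, ← Finset.sum_add_distrib]
          refine Finset.sum_le_sum fun B hB => ?_
          have h1 := hcon B hB
          by_cases hB1 : B.card = 1
          · obtain ⟨v, rfl⟩ := Finset.card_eq_one.1 hB1
            by_cases hv : v ∈ I <;> simp [singleIndicator, bigIndicator, hv]
          · rw [bigIndicator_eq_one hB1, singleIndicator_of_ne I hB1]
            omega
        omega
      have hB1 : 2 ≤ B.card := hB2.trans (Finset.card_le_card Finset.inter_subset_left)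
      obtain ⟨e1, e2, e3⟩ := herase B hB
      rw [singleIndicator_of_ne I (by omega)] at e3
      rw [bigIndicator_eq_one (by omega)] at e2
      rw [hN, chooseInt_self, one_smul, ← blockProd_erase hy.tree_commute hP hB]
      exact (Dom.mul_right (hprod _) (hy.tree_dom_linkedMerge_of_row hIJ h2 hC hB2 (by omega)
        (by omega))).trans (Dom.single_le_sum (f := fun B => linkedMerge y I J α β
          (P.erase B).card (bigBlocks (P.erase B)) (singleBlocks I (P.erase B)) B *
            blockProd (tree y I J) (P.erase B)) hB hmem)
    · rw [chooseInt_of_lt hN, zero_smul]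
      exact Dom.of_mem (C.sum_mem hmem)

theorem rootSum_dom_linkedSum_mul_edgeSum (hy : FKSystem y) (hIJ : ∀ i, i ∈ I ↔ i ∉ J)
    (h2 : ∀ r : R, r + r = 0 → r = 0) (hC : ∀ v ∈ I, ∀ u ∈ J, y v u ∈ C)
    (hdiv : ∀ (m : ℕ) (r : R), m ≠ 0 → m • r ∈ C → r ∈ C) {α β : ℤ}
    (hα : α < (S ∩ I).card) (hβ : β < (S ∩ J).card) :
    Dom C (rootSum y I J α β S) (linkedSum y I J α β S * edgeSum y I J S) := by
  rw [hy.rootSum_eq hIJ]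
  exact (Dom.sum fun P hP => hy.blockProd_dom_sum_linkedMerge hIJ h2 hC hdiv hα hβ hP).trans
    (hy.sum_linkedMerge_dom hC α β S)

end FKSystem
end LinkedDom

/-! ### Hooks plus a box in the Fomin-Kirillov algebra -/

section HookPoly
variable {σ : Type*} [Fintype σ]

open MvPolynomial

/-- The Schur polynomial of the hook `(b + 1, 1^a)`. -/
def hookPoly (σ : Type*) [Fintype σ] : ℕ → ℕ → MvPolynomial σ ℂ
  | 0, a => esymm σ ℂ (a + 1)
  | b + 1, a => esymm σ ℂ (a + 1) * hookPoly σ b 0 - hookPoly σ b (a + 1)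

end HookPoly

/-! ### Hook Schur polynomials at Dunkl elements -/

namespace FKSystem
variable {ι R : Type*} [Ring R] [DecidableEq ι] {y : ι → ι → R} {I J S : Finset ι}

theorem pieriSum_mul_pieriSum_eq (hy : FKSystem y) (hIJ : ∀ i, i ∈ I ↔ i ∉ J) (S : Finset ι)
    {p q : ℕ} (h : p + q ≠ 0) :
    pieriSum y S (S ∩ I) p * pieriSum (fun i j => y j i) S (S ∩ J) q =
      linkedSum y I J ((S ∩ I).card - p) ((S ∩ J).card - q - 1) S +
        linkedSum y I J ((S ∩ I).card - p - 1) ((S ∩ J).card - q) S := by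
  have := card_inter_add_card_inter hIJ S
  rw [pieriSum_mul_pieriSum hIJ, hy.rootSum_eq_linkedSum hIJ (by omega)]

theorem linkedSum_one (hy : FKSystem y) (hIJ : ∀ i, i ∈ I ↔ i ∉ J) (S : Finset ι) (a : ℕ) :
    linkedSum y I J ((S ∩ I).card - a - 1) ((S ∩ J).card - 1) S =
      pieriSum y S (S ∩ I) (a + 1) := by
  have := hy.pieriSum_mul_pieriSum_eq hIJ S (p := a + 1) (q := 0) (by omega)
  rw [pieriSum_zero, mul_one, Nat.cast_zero, sub_zero, hy.linkedSum_card_right hIJ, add_zero] at this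
  rw [this]
  congr 1; push_cast; ring

theorem pieriSum_flip_eq_linkedSum (hy : FKSystem y) (hIJ : ∀ i, i ∈ I ↔ i ∉ J) (S : Finset ι)
    (b : ℕ) : pieriSum (fun i j => y j i) S (S ∩ J) (b + 1) =
      linkedSum y I J ((S ∩ I).card - 1) ((S ∩ J).card - b - 1) S := by
  have := hy.pieriSum_mul_pieriSum_eq hIJ S (p := 0) (q := b + 1) (by omega)
  rw [pieriSum_zero, one_mul, Nat.cast_zero, sub_zero, hy.linkedSum_card_left hIJ, zero_add] at this
  rw [this]
  congr 1; push_cast; ring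

/-- This is the recursion that defines `hookPoly`; `linkedSum` at `α = |S ∩ I| - 1` plays the role
of the complete symmetric polynomial. -/
theorem linkedSum_succ (hy : FKSystem y) (hIJ : ∀ i, i ∈ I ↔ i ∉ J) (S : Finset ι) (a b : ℕ) :
    linkedSum y I J ((S ∩ I).card - a - 1) ((S ∩ J).card - (b + 1 : ℕ) - 1) S =
      pieriSum y S (S ∩ I) (a + 1) *
          linkedSum y I J ((S ∩ I).card - 1) ((S ∩ J).card - b - 1) S -
        linkedSum y I J ((S ∩ I).card - (a + 1 : ℕ) - 1) ((S ∩ J).card - b - 1) S := by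
  rw [← hy.pieriSum_flip_eq_linkedSum hIJ, hy.pieriSum_mul_pieriSum_eq hIJ S (by omega),
    eq_sub_iff_add_eq]
  congr 2 <;> push_cast <;> ring

/-- A ring homomorphism that sends elementary symmetric polynomials to `pieriSum` sends hook Schur
polynomials to `linkedSum`. -/
theorem map_hookPoly {σ F : Type*} [Fintype σ] [FunLike F (MvPolynomial σ ℂ) R]
    [RingHomClass F (MvPolynomial σ ℂ) R] (hy : FKSystem y) (hIJ : ∀ i, i ∈ I ↔ i ∉ J)
    (S : Finset ι) (ψ : F)
    (hψ : ∀ p, ψ (MvPolynomial.esymm σ ℂ p) = pieriSum y S (S ∩ I) p) (b a : ℕ) :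
    ψ (hookPoly σ b a) = linkedSum y I J ((S ∩ I).card - a - 1) ((S ∩ J).card - b - 1) S := by
  induction b generalizing a with
  | zero => rw [hookPoly, hψ, Nat.cast_zero, sub_zero, hy.linkedSum_one hIJ]
  | succ b ih =>
    rw [hookPoly, map_sub, map_mul, hψ, ih, ih, Nat.cast_zero, sub_zero, hy.linkedSum_succ hIJ]

/-- The Schur polynomial of a hook plus a box is sent to the cone. -/
theorem map_hookPlusBox_mem {σ F : Type*} [Fintype σ] [FunLike F (MvPolynomial σ ℂ) R]
    [RingHomClass F (MvPolynomial σ ℂ) R] (hy : FKSystem y) (hIJ : ∀ i, i ∈ I ↔ i ∉ J)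
    (S : Finset ι) (ψ : F)
    (hψ : ∀ p, ψ (MvPolynomial.esymm σ ℂ p) = pieriSum y S (S ∩ I) p) {C : Subsemiring R}
    (h2 : ∀ r : R, r + r = 0 → r = 0) (hC : ∀ v ∈ I, ∀ u ∈ J, y v u ∈ C)
    (hdiv : ∀ (m : ℕ) (r : R), m ≠ 0 → m • r ∈ C → r ∈ C) (b a : ℕ) :
    ψ (hookPoly σ b a * MvPolynomial.esymm σ ℂ 1 -
      MvPolynomial.esymm σ ℂ (a + 1) * hookPoly σ b 0) ∈ C := by
  rw [map_sub, map_mul, map_mul, hψ, hψ, hy.map_hookPoly hIJ S ψ hψ, hy.map_hookPoly hIJ S ψ hψ,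
    Nat.cast_zero, sub_zero, ← hy.pieriSum_flip_eq_linkedSum hIJ, pieriSum_mul_pieriSum hIJ,
    ← hy.edgeSum_eq hIJ]
  -- The product of `e_(a+1)` and `h_(b+1)` is the `rootSum`, the hook `(b + 1, 1^a)` is the
  -- `linkedSum` with the same parameters, and `e_1` is the `edgeSum`.
  have := hy.rootSum_dom_linkedSum_mul_edgeSum hIJ (S := S) h2 hC hdiv
    (α := (S ∩ I).card - a - 1) (β := (S ∩ J).card - b - 1) (by omega) (by omega)
  rw [Dom] at this
  convert this using 3 <;> push_cast <;> ring

end FKSystem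

/-! ### Specialization to the Fomin-Kirillov algebra and its cone -/

section Concrete
variable {n : ℕ}

theorem x_mul_self (i j : Fin n) : x i j * x i j = 0 := by
  by_cases h : i < j
  · rw [x_of_lt h, ← map_mul, mk_rel (FKRel.sq i j h), map_zero]
  · rw [x_of_not_lt h, zero_mul]

theorem y_mul_self (i j : Fin n) : y i j * y i j = 0 := by
  rcases lt_trichotomy i j with h | rfl | h
  · rw [y_of_lt h, x_mul_self]
  · rw [y_self, zero_mul]
  · rw [y_swap j i, neg_mul_neg, y_of_lt h, x_mul_self]

theorem fkSystem_y (n : ℕ) : FKSystem (y : Fin n → Fin n → FKAlgebra n) where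
  self := y_self
  swap := y_swap
  sq := y_mul_self
  comm _ _ _ _ h1 h2 h3 h4 := y_comm h1 h2 h3 h4
  tri _ _ _ h1 h2 h3 := y_tri h1 h2 h3

theorem smul_prod_mem_cone {c : ℝ} (hc : 0 ≤ c) (m : List (Gen n)) :
    (c : ℂ) • (m.map gen).prod ∈ cone n := AddSubmonoid.subset_closure ⟨c, m, hc, rfl⟩

/-- The cone is closed under multiplication. -/
def coneSemiring (n : ℕ) : Subsemiring (FKAlgebra n) where
  __ := cone n
  one_mem' := by
    have := smul_prod_mem_cone (n := n) zero_le_one []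
    simpa using this
  mul_mem' := by
    intro a b ha hb
    refine AddSubmonoid.closure_induction (motive := fun a _ => a * b ∈ cone n) ?_ ?_ ?_ ha
    · rintro _ ⟨c, m, hc, rfl⟩
      refine AddSubmonoid.closure_induction
        (motive := fun b _ => (c : ℂ) • (m.map gen).prod * b ∈ cone n) ?_ ?_ ?_ hb
      · rintro _ ⟨d, l, hd, rfl⟩
        have := smul_prod_mem_cone (mul_nonneg hc hd) (m ++ l)
        rwa [List.map_append, List.prod_append, Complex.ofReal_mul, ← smul_mul_smul_comm] at this
      · rw [mul_zero]; exact zero_mem _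
      · intro b b' _ _ h h'
        rw [mul_add]; exact add_mem h h'
    · rw [zero_mul]; exact zero_mem _
    · intro b b' _ _ h h'
      rw [add_mul]; exact add_mem h h'

theorem smul_mem_cone {c : ℝ} (hc : 0 ≤ c) {r : FKAlgebra n} (hr : r ∈ cone n) :
    (c : ℂ) • r ∈ cone n := by
  refine AddSubmonoid.closure_induction (motive := fun r _ => (c : ℂ) • r ∈ cone n) ?_ ?_ ?_ hr
  · rintro _ ⟨d, m, hd, rfl⟩
    rw [smul_smul, ← Complex.ofReal_mul]
    exact smul_prod_mem_cone (mul_nonneg hc hd) m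
  · rw [smul_zero]; exact zero_mem _
  · intro b b' _ _ h h'
    rw [smul_add]; exact add_mem h h'

theorem mem_cone_of_nsmul_mem {m : ℕ} {r : FKAlgebra n} (hm : m ≠ 0) (h : m • r ∈ cone n) :
    r ∈ cone n := by
  have := smul_mem_cone (c := (m : ℝ)⁻¹) (by positivity) h
  rwa [← Nat.cast_smul_eq_nsmul ℂ, smul_smul, Complex.ofReal_inv, Complex.ofReal_natCast,
    inv_mul_cancel₀ (by exact_mod_cast hm), one_smul] at this

theorem eq_zero_of_add_self {r : FKAlgebra n} (h : r + r = 0) : r = 0 := by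
  rw [← two_smul ℂ] at h
  have := congrArg (fun r => (2 : ℂ)⁻¹ • r) h
  simpa [smul_smul] using this

theorem y_mem_cone {i j : Fin n} (h : i < j) : y i j ∈ cone n := by
  rw [y_of_lt h, x, dif_pos h]
  have := smul_prod_mem_cone (n := n) zero_le_one [⟨(i, j), h⟩]
  simpa using this

open MvPolynomial

/-- Elementary symmetric polynomials satisfy the commutative version of the recursion in the Pieri
formula. -/
theorem evalDunkl_sum_prod (G : Finset (Fin n)) (p : ℕ) :
    evalDunkl n (∑ X ∈ G.powersetCard p, ∏ i ∈ X, MvPolynomial.X i) =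
      pieriSum y Finset.univ G p := by
  induction G using Finset.induction_on generalizing p with
  | empty =>
    cases p with
    | zero => simp [pieriSum_zero]
    | succ p =>
      rw [Finset.powersetCard_eq_empty.2 (by simp), Finset.sum_empty, map_zero, pieriSum_empty]
  | insert i G hi ih =>
    cases p with
    | zero => simp [pieriSum_zero]
    | succ p =>
      have hins : ∀ X ∈ G.powersetCard p, i ∉ X := fun X hX h =>
        hi ((Finset.mem_powersetCard.1 hX).1 h)
      rw [(fkSystem_y n).pieriSum_insert (Finset.subset_univ G) (Finset.mem_univ i) hi, ← ih, ← ih,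
        dunklSum, ← dunkl_eq_sum, ← evalDunkl_X, ← map_mul, ← map_add,
        Finset.powersetCard_succ_insert hi, Finset.sum_union]
      · congr 2
        rw [Finset.sum_image, Finset.sum_mul]
        · refine Finset.sum_congr rfl fun X hX => ?_
          rw [Finset.prod_insert (hins X hX), mul_comm]
        · intro X hX X' hX' h
          have h := congrArg (fun A => Finset.erase A i) h
          simpa [Finset.erase_insert (hins X hX), Finset.erase_insert (hins X' hX')] using h
      · rw [Finset.disjoint_left]
        intro X hX hX'
        obtain ⟨X', _, rfl⟩ := Finset.mem_image.1 hX'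
        exact hi ((Finset.mem_powersetCard.1 hX).1 (Finset.mem_insert_self i X'))

theorem rename_castLE_esymm {k : ℕ} (hk : k ≤ n) (p : ℕ) :
    rename (Fin.castLE hk) (esymm (Fin k) ℂ p) =
      ∑ X ∈ (Finset.univ.filter fun i : Fin n => (i : ℕ) < k).powersetCard p,
        ∏ i ∈ X, MvPolynomial.X i := by
  have e : (Finset.univ.filter fun i : Fin n => (i : ℕ) < k) =
      Finset.univ.map (Fin.castLEEmb hk) := by
    ext i
    simp only [Finset.mem_filter, Finset.mem_univ, true_and, Finset.mem_map, Fin.coe_castLEEmb]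
    exact ⟨fun h => ⟨⟨i, h⟩, rfl⟩, fun ⟨j, hj⟩ => hj ▸ j.2⟩
  rw [esymm, map_sum, e, Finset.powersetCard_map, Finset.sum_map]
  refine Finset.sum_congr rfl fun X _ => ?_
  simp [map_prod, Finset.mapEmbedding_apply]

theorem evalDunkl_hookPlusBox_mem {k : ℕ} (hk : k ≤ n) (b a : ℕ) :
    evalDunkl n (rename (Fin.castLE hk) (hookPoly (Fin k) b a * esymm (Fin k) ℂ 1 -
      esymm (Fin k) ℂ (a + 1) * hookPoly (Fin k) b 0)) ∈ cone n := by
  have := (fkSystem_y n).map_hookPlusBox_mem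
    (I := Finset.univ.filter fun i : Fin n => (i : ℕ) < k)
    (J := Finset.univ.filter fun i : Fin n => ¬ (i : ℕ) < k) (by simp) Finset.univ
    ((evalDunkl n).comp (rename (Fin.castLE hk)))
    (fun p => by
      rw [AlgHom.comp_apply, rename_castLE_esymm, evalDunkl_sum_prod, Finset.univ_inter])
    (C := coneSemiring n) (fun r => eq_zero_of_add_self)
    -- Rows precede columns, so `y v u` is the generator `x v u` itself, without a sign.
    (fun v hv u hu => y_mem_cone (by
      simp only [Finset.mem_filter, Finset.mem_univ, true_and] at hv hu
      exact Fin.lt_def.2 (lt_of_lt_of_le hv (not_lt.1 hu))))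
    (fun m r hm h => mem_cone_of_nsmul_mem hm h) b a
  exact this

end Concrete

/-! ### The Schur polynomial of a hook plus a box -/

section SchurHook
open MvPolynomial

variable {k : ℕ}

theorem esymm_eq_zero_of_lt {p : ℕ} (h : k < p) : esymm (Fin k) ℂ p = 0 := by
  rw [esymm, Finset.powersetCard_eq_empty.2 (by simpa using h), Finset.sum_empty]

theorem hookPoly_eq_zero {a : ℕ} (h : k ≤ a) (b : ℕ) : hookPoly (Fin k) b a = 0 := by
  induction b generalizing a with
  | zero => exact esymm_eq_zero_of_lt (by omega)
  | succ b ih => rw [hookPoly, esymm_eq_zero_of_lt (by omega), ih (by omega : k ≤ a + 1), zero_mul, sub_zero]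

/-- Each variable is a root of the monic polynomial whose coefficients are the signed elementary
symmetric polynomials. -/
theorem X_pow_card (i : Fin k) : (X i : MvPolynomial (Fin k) ℂ) ^ k =
    ∑ c ∈ Finset.range k, (-1) ^ c * esymm (Fin k) ℂ (c + 1) * X i ^ (k - 1 - c) := by
  have h := congrArg (Polynomial.eval (X i : MvPolynomial (Fin k) ℂ))
    (Multiset.prod_X_sub_X_eq_sum_esymm
      ((Finset.univ : Finset (Fin k)).val.map (X : Fin k → MvPolynomial (Fin k) ℂ)))
  rw [Polynomial.eval_multiset_prod, Multiset.prod_eq_zero, Polynomial.eval_finsetSum,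
    Multiset.card_map, Finset.card_val, Finset.card_univ, Fintype.card_fin,
    Finset.sum_range_succ', ← esymm_eq_multiset_esymm] at h
  · simp only [Polynomial.eval_mul, Polynomial.eval_pow, Polynomial.eval_neg, Polynomial.eval_one,
      Polynomial.eval_C, Polynomial.eval_X, pow_zero, one_mul, esymm_zero, Nat.sub_zero] at h
    rw [eq_comm, add_comm, add_eq_zero_iff_eq_neg, ← Finset.sum_neg_distrib] at h
    rw [h]
    refine Finset.sum_congr rfl fun c _ => ?_
    rw [Nat.sub_sub, Nat.add_comm 1 c, pow_succ]
    ring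
  · rw [Multiset.mem_map]
    refine ⟨Polynomial.X - Polynomial.C (X i), ?_, by simp⟩
    simp

/-- Hook Schur polynomials are the coefficients of `T ^ (k + b)` reduced modulo the polynomial with
roots `x_1, …, x_k`; multiplying by `T` and reducing once more is the recursion of `hookPoly`. -/
theorem X_pow_card_add (b : ℕ) (i : Fin k) : (X i : MvPolynomial (Fin k) ℂ) ^ (k + b) =
    ∑ c ∈ Finset.range k, (-1) ^ c * hookPoly (Fin k) b c * X i ^ (k - 1 - c) := by
  induction b with
  | zero => exact X_pow_card i
  | succ b ih =>
    obtain ⟨m, rfl⟩ : ∃ m, k = m + 1 := ⟨k - 1, by have := i.2; omega⟩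
    have h1 : (X i : MvPolynomial (Fin (m + 1)) ℂ) ^ (m + 1 + (b + 1)) =
        hookPoly (Fin (m + 1)) b 0 * X i ^ (m + 1) +
          ∑ c ∈ Finset.range (m + 1), (-1) ^ (c + 1) * hookPoly (Fin (m + 1)) b (c + 1) *
            X i ^ (m + 1 - 1 - c) := by
      rw [← add_assoc, pow_succ, ih, Finset.sum_range_succ', Finset.sum_range_succ _ m,
        hookPoly_eq_zero le_rfl, add_mul, Finset.sum_mul, mul_zero, zero_mul, add_zero]
      rw [add_comm (Finset.sum _ _)]
      refine congrArg₂ (· + ·) ?_ ?_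
      · rw [pow_zero, one_mul, mul_assoc, ← pow_succ, Nat.sub_zero, Nat.add_sub_cancel]
      · refine Finset.sum_congr rfl fun c hc => ?_
        rw [mul_assoc _ (X i ^ _), ← pow_succ]
        congr 2
        have := Finset.mem_range.1 hc
        omega
    rw [h1, X_pow_card, Finset.mul_sum, ← Finset.sum_add_distrib]
    refine Finset.sum_congr rfl fun c _ => ?_
    rw [hookPoly, pow_succ]
    ring

/-- The matrix is the identity plus a matrix of rank at most two, so the determinant reduces to a
two by two one. -/
theorem det_two_columns {A ι : Type*} [CommRing A] [Fintype ι] [DecidableEq ι] {p q : ι}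
    (hpq : p ≠ q) (u v : ι → A) :
    (Matrix.of fun c j : ι => if j = p then u c else if j = q then v c else
      if c = j then 1 else 0).det = u p * v q - v p * u q := by
  let U : Matrix ι (Fin 2) A := Matrix.of fun c l =>
    ![u c - if c = p then 1 else 0, v c - if c = q then 1 else 0] l
  let W : Matrix (Fin 2) ι A := Matrix.of fun l j =>
    ![if j = p then 1 else 0, if j = q then 1 else 0] l
  have h : (Matrix.of fun c j : ι => if j = p then u c else if j = q then v c else
      if c = j then 1 else 0) = 1 + U * W := by
    ext c j
    simp only [Matrix.of_apply, Matrix.add_apply, Matrix.mul_apply, Fin.sum_univ_two, U, W,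
      Matrix.one_apply, Matrix.cons_val_zero, Matrix.cons_val_one]
    by_cases h1 : j = p
    · subst h1; simp [hpq]
    · by_cases h2 : j = q
      · subst h2; simp [h1]
      · simp [h1, h2]
  rw [h, Matrix.det_one_add_mul_comm, Matrix.det_fin_two]
  simp [Matrix.mul_apply, U, W, hpq, hpq.symm]

/-- At the distinct points `0, …, k - 1` the value is a nonzero Vandermonde determinant up to sign.
-/
theorem alternant_nil_ne_zero (k : ℕ) : alternant k [] ≠ 0 := by
  intro h
  have h2 := congrArg (eval fun i : Fin k => ((i : ℕ) : ℂ)) h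
  rw [alternant, map_zero, RingHom.map_det] at h2
  have h3 : (Matrix.of fun i j : Fin k => (X i : MvPolynomial (Fin k) ℂ) ^
      (([] : List ℕ).getD (j : ℕ) 0 + (k - 1 - (j : ℕ)))).map
        (eval fun i : Fin k => ((i : ℕ) : ℂ)) =
      (Matrix.vandermonde fun i : Fin k => ((i : ℕ) : ℂ)).submatrix id Fin.revPerm := by
    ext i j
    simp only [Matrix.map_apply, Matrix.of_apply, Matrix.submatrix_apply,
      Matrix.vandermonde_apply, id, Fin.revPerm_apply, Fin.val_rev, List.getD_nil, zero_add,
      map_pow, eval_X]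
    congr 1
    omega
  rw [RingHom.mapMatrix_apply, h3, Matrix.det_permute', mul_eq_zero] at h2
  rcases h2 with h2 | h2
  · rcases Int.units_eq_one_or (Equiv.Perm.sign (Fin.revPerm (n := k))) with h | h <;>
      rw [h] at h2 <;> simp at h2
  · refine Matrix.det_vandermonde_ne_zero_iff.2 ?_ h2
    intro i j hij
    exact Fin.ext (by simpa using hij)

theorem getD_hookPlusBox {a : ℕ} (ha : 1 ≤ a) (b j : ℕ) : (hookPlusBox a b).getD j 0 =
    if j = 0 then b else if j = 1 then 2 else if j ≤ a then 1 else 0 := by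
  rcases j with _ | _ | j
  · rfl
  · rfl
  · rw [hookPlusBox, List.getD_cons_succ, List.getD_cons_succ, if_neg (by omega), if_neg (by omega)]
    split_ifs with h
    · rw [List.getD_eq_getElem _ _ (by simp; omega), List.getElem_replicate]
    · rw [List.getD_eq_default _ _ (by simp; omega)]

/-- The exponents of `λ + δ` are those of `δ` with `k - 1` and `k - 1 - a` replaced by `k + b` and
`k`, up to a cycle of the columns `1, …, a`. Reducing these two powers writes the matrix as the
Vandermonde matrix times an identity matrix with two replaced columns. -/
theorem alternant_hookPlusBox {a b : ℕ} (ha : 1 ≤ a) (hk : a + 1 ≤ k) :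
    alternant k (hookPlusBox a (b + 1)) = alternant k [] *
      (hookPoly (Fin k) b a * esymm (Fin k) ℂ 1 -
        esymm (Fin k) ℂ (a + 1) * hookPoly (Fin k) b 0) := by
  have : NeZero k := ⟨by omega⟩
  let o : Fin k := ⟨1, by omega⟩
  let l : Fin k := ⟨a, by omega⟩
  have hol : o ≤ l := Fin.mk_le_mk.2 ha
  have h0l : (0 : Fin k) ≠ l := fun h => by
    have := congrArg Fin.val h
    simp [l] at this
    omega
  let A := Matrix.of fun i j : Fin k => (X i : MvPolynomial (Fin k) ℂ) ^
    ((hookPlusBox a (b + 1)).getD (j : ℕ) 0 + (k - 1 - (j : ℕ)))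
  let V := Matrix.of fun i j : Fin k => (X i : MvPolynomial (Fin k) ℂ) ^
    (([] : List ℕ).getD (j : ℕ) 0 + (k - 1 - (j : ℕ)))
  -- The cycle puts column `1`, with exponent `k`, at position `a` and shifts columns `2, …, a` to
  -- the left; its sign `(-1) ^ (a - 1)` combines with the `(-1) ^ a` from the two-column
  -- determinant.
  have key : A.submatrix id (Fin.cycleIcc o l) = V * Matrix.of fun c j : Fin k =>
      if j = 0 then (-1) ^ (c : ℕ) * hookPoly (Fin k) b c else
        if j = l then (-1) ^ (c : ℕ) * esymm (Fin k) ℂ (c + 1) else if c = j then 1 else 0 := by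
    ext1 i j
    rw [Matrix.submatrix_apply, Matrix.mul_apply]
    simp only [A, V, Matrix.of_apply, id, List.getD_nil, zero_add, getD_hookPlusBox ha]
    by_cases hj : j = 0
    · subst hj
      have h1 : Fin.cycleIcc o l 0 = 0 := Fin.cycleIcc_of_lt (Fin.lt_def.2 (by simp [o]))
      simp only [h1, Fin.val_zero, if_true]
      rw [show b + 1 + (k - 1 - 0) = k + b by omega, X_pow_card_add, Finset.sum_range]
      exact Finset.sum_congr rfl fun c _ => mul_comm _ _
    · have hj0 : (j : ℕ) ≠ 0 := fun h => hj (Fin.ext (by simpa using h))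
      by_cases hjl : j = l
      · subst hjl
        rw [Fin.cycleIcc_of_last hol]
        simp only [hj, if_true, if_false, o]
        rw [if_neg one_ne_zero, show 2 + (k - 1 - 1) = k by omega, X_pow_card, Finset.sum_range]
        exact Finset.sum_congr rfl fun c _ => mul_comm _ _
      · have hjl' : (j : ℕ) ≠ a := fun h => hjl (Fin.ext h)
        simp only [hj, hjl, if_false, mul_ite, mul_one, mul_zero, Finset.sum_ite_eq',
          Finset.mem_univ, if_true]
        rcases lt_or_gt_of_ne hjl' with h | h
        · have h1 : Fin.cycleIcc o l j = j + 1 :=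
            Fin.cycleIcc_of_ge_of_lt (Fin.le_def.2 (by simp only [o]; omega)) (Fin.lt_def.2 h)
          have h2 : ((j + 1 : Fin k) : ℕ) = j + 1 := by
            rw [Fin.val_add_one_of_lt' (by omega)]
          rw [h1, h2, if_neg (by omega), if_neg (by omega), if_pos (by omega)]
          congr 1
          omega
        · have h1 : Fin.cycleIcc o l j = j := Fin.cycleIcc_of_gt (Fin.lt_def.2 h)
          rw [h1, if_neg (by omega), if_neg (by omega), if_neg (by omega), zero_add]
  have hdet := congrArg Matrix.det key
  rw [Matrix.det_permute', Matrix.det_mul, det_two_columns h0l, Fin.sign_cycleIcc_of_le hol] at hdet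
  obtain ⟨m, rfl⟩ : ∃ m, a = m + 1 := ⟨a - 1, by omega⟩
  have hs : ((((-1 : ℤˣ) ^ ((l : ℕ) - (o : ℕ)) : ℤˣ) : ℤ) : MvPolynomial (Fin k) ℂ) =
      (-1) ^ m := by simp [l, o]
  rw [hs] at hdet
  have hm : ((-1 : MvPolynomial (Fin k) ℂ) ^ m) * (-1) ^ m = 1 := by
    rw [← mul_pow]; simp
  calc A.det = (-1) ^ m * ((-1) ^ m * A.det) := by rw [← mul_assoc, hm, one_mul]
    _ = V.det * ((-1) ^ m * (-1) ^ m * (hookPoly (Fin k) b (m + 1) * esymm (Fin k) ℂ 1 -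
        esymm (Fin k) ℂ (m + 1 + 1) * hookPoly (Fin k) b 0)) := by
      rw [hdet]
      simp only [l, Fin.val_zero, pow_zero, one_mul, zero_add, pow_succ]
      ring
    _ = _ := by rw [hm, one_mul]; rfl

theorem schur_hookPlusBox {a b : ℕ} (ha : 1 ≤ a) (hk : a + 1 ≤ k) :
    schur k (hookPlusBox a (b + 1)) = hookPoly (Fin k) b a * esymm (Fin k) ℂ 1 -
      esymm (Fin k) ℂ (a + 1) * hookPoly (Fin k) b 0 :=
  mul_left_cancel₀ (alternant_nil_ne_zero k)
    ((schur_spec k _).symm.trans (alternant_hookPlusBox ha hk))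

end SchurHook

/-! ### Divided differences -/

section DividedDiff
open MvPolynomial

variable {n : ℕ} {i j l : Fin n} {f g : MvPolynomial (Fin n) ℂ}

theorem X_sub_X_ne_zero (h : i ≠ j) : (X i - X j : MvPolynomial (Fin n) ℂ) ≠ 0 :=
  sub_ne_zero.2 fun e => h (X_injective e)

theorem dividedDiff_eq (h : i ≠ j) (hg : f - rename (Equiv.swap i j) f = (X i - X j) * g) :
    dividedDiff i j f = g :=
  mul_left_cancel₀ (X_sub_X_ne_zero h) ((dividedDiff_spec i j f).symm.trans hg)

theorem dividedDiff_add (h : i ≠ j) (f g : MvPolynomial (Fin n) ℂ) :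
    dividedDiff i j (f + g) = dividedDiff i j f + dividedDiff i j g :=
  dividedDiff_eq h (by
    rw [map_add, mul_add, ← dividedDiff_spec, ← dividedDiff_spec]; ring)

theorem dividedDiff_mul_left (h : i ≠ j) (hg : rename (Equiv.swap i j) g = g)
    (f : MvPolynomial (Fin n) ℂ) : dividedDiff i j (g * f) = g * dividedDiff i j f :=
  dividedDiff_eq h (by rw [map_mul, hg, mul_left_comm, ← dividedDiff_spec]; ring)

theorem dividedDiff_of_symm (h : i ≠ j) (hf : rename (Equiv.swap i j) f = f) :
    dividedDiff i j f = 0 := dividedDiff_eq h (by rw [hf, sub_self, mul_zero])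

theorem dividedDiff_X_mul_of_symm (h : i ≠ j) (hf : rename (Equiv.swap i j) f = f) :
    dividedDiff i j (X i * f) = f :=
  dividedDiff_eq h (by rw [map_mul, hf, rename_X, Equiv.swap_apply_left]; ring)

theorem rename_swap_swap (i j : Fin n) (f : MvPolynomial (Fin n) ℂ) :
    rename (Equiv.swap i j) (rename (Equiv.swap i j) f) = f := by
  rw [rename_rename, ← Equiv.coe_trans, Equiv.swap_swap, Equiv.coe_refl, rename_id_apply]

theorem rename_swap_dividedDiff (h : i ≠ j) (f : MvPolynomial (Fin n) ℂ) :
    rename (Equiv.swap i j) (dividedDiff i j f) = dividedDiff i j f := by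
  refine (dividedDiff_eq h ?_).symm
  have := congrArg (rename (Equiv.swap i j)) (dividedDiff_spec i j f)
  rw [map_sub, map_mul, map_sub, rename_swap_swap, rename_X, rename_X, Equiv.swap_apply_left,
    Equiv.swap_apply_right] at this
  linear_combination -this

theorem dividedDiff_dividedDiff (h : i ≠ j) (f : MvPolynomial (Fin n) ℂ) :
    dividedDiff i j (dividedDiff i j f) = 0 :=
  dividedDiff_of_symm h (rename_swap_dividedDiff h f)

theorem dividedDiff_swap (h : i ≠ j) (f : MvPolynomial (Fin n) ℂ) :
    dividedDiff j i f = -dividedDiff i j f :=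
  dividedDiff_eq h.symm (by rw [Equiv.swap_comm, dividedDiff_spec]; ring)

theorem dividedDiff_neg (h : i ≠ j) (f : MvPolynomial (Fin n) ℂ) :
    dividedDiff i j (-f) = -dividedDiff i j f :=
  dividedDiff_eq h (by rw [map_neg, mul_neg, ← dividedDiff_spec]; ring)

theorem rename_swap_X_of_ne {m : Fin n} (hi : m ≠ i) (hj : m ≠ j) :
    rename (Equiv.swap i j) (X m : MvPolynomial (Fin n) ℂ) = X m := by
  rw [rename_X, Equiv.swap_apply_of_ne_of_ne hi hj]

theorem dividedDiff_comm {m : Fin n} (hij : i ≠ j) (hlm : l ≠ m) (hil : i ≠ l) (him : i ≠ m)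
    (hjl : j ≠ l) (hjm : j ≠ m) (f : MvPolynomial (Fin n) ℂ) :
    dividedDiff i j (dividedDiff l m f) = dividedDiff l m (dividedDiff i j f) := by
  have hcomm : ∀ f : MvPolynomial (Fin n) ℂ, rename (Equiv.swap i j) (rename (Equiv.swap l m) f) =
      rename (Equiv.swap l m) (rename (Equiv.swap i j) f) := by
    intro f
    rw [rename_rename, rename_rename]
    congr 2
    ext a
    simp only [Function.comp_apply, Equiv.swap_apply_def]
    split_ifs <;> simp_all
  refine dividedDiff_eq hij ?_
  refine mul_left_cancel₀ (X_sub_X_ne_zero hlm) ?_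
  have h1 := dividedDiff_spec l m f
  have h2 := congrArg (rename (Equiv.swap i j)) h1
  have h3 := dividedDiff_spec l m (dividedDiff i j f)
  have h4 := dividedDiff_spec i j f
  have h5 := congrArg (rename (Equiv.swap l m)) h4
  rw [map_sub, map_mul, map_sub, rename_swap_X_of_ne hil.symm hjl.symm,
    rename_swap_X_of_ne him.symm hjm.symm, hcomm] at h2
  rw [map_sub, map_mul, map_sub, rename_swap_X_of_ne hil him, rename_swap_X_of_ne hjl hjm] at h5
  linear_combination -h1 + h2 + (X i - X j) * h3 + h4 - h5

/-- With denominators cleared, the triple divided difference is the antisymmetrization over the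
permutations of three variables. -/
theorem dividedDiff_braid_mul (hij : i ≠ j) (hjl : j ≠ l) (hil : i ≠ l)
    (f : MvPolynomial (Fin n) ℂ) :
    (X i - X j) * (X i - X l) * (X j - X l) *
        dividedDiff i j (dividedDiff j l (dividedDiff i j f)) =
      f - rename (Equiv.swap i j) f - rename (Equiv.swap j l) f +
        rename (Equiv.swap j l) (rename (Equiv.swap i j) f) +
        rename (Equiv.swap i j) (rename (Equiv.swap j l) f) -
        rename (Equiv.swap i j) (rename (Equiv.swap j l) (rename (Equiv.swap i j) f)) := by
  refine mul_left_cancel₀ (X_sub_X_ne_zero hij) ?_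
  have h1 := dividedDiff_spec i j f
  have h2 := congrArg (rename (Equiv.swap j l)) h1
  have h3 := dividedDiff_spec j l (dividedDiff i j f)
  have h4 := congrArg (rename (Equiv.swap i j)) h2
  have h5 := congrArg (rename (Equiv.swap i j)) h3
  have h6 := dividedDiff_spec i j (dividedDiff j l (dividedDiff i j f))
  have hs := rename_swap_dividedDiff hij f
  simp only [map_sub, map_mul, rename_X, Equiv.swap_apply_left, Equiv.swap_apply_right,
    Equiv.swap_apply_of_ne_of_ne hij hil, Equiv.swap_apply_of_ne_of_ne hil.symm hjl.symm,
    hs] at h2 h4 h5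
  linear_combination (-(X i - X j) * (X i - X l) * (X j - X l)) * h6 +
    (-(X i - X j) * (X i - X l)) * h3 + (-(X i - X l)) * h1 + (X i - X j) * h2 +
    ((X i - X j) * (X j - X l)) * h5 - (X i - X j) * h4 + (X j - X l) * h1

/-- The antisymmetrization does not single out an end of `i, j, l`: the formula for `l, j, i` is
compared after correcting signs, since both triple products of swaps exchange `i` and `l`. -/
theorem dividedDiff_braid (hij : i ≠ j) (hjl : j ≠ l) (hil : i ≠ l)
    (f : MvPolynomial (Fin n) ℂ) :
    dividedDiff i j (dividedDiff j l (dividedDiff i j f)) =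
      dividedDiff j l (dividedDiff i j (dividedDiff j l f)) := by
  have h1 := dividedDiff_braid_mul hij hjl hil f
  have h2 := dividedDiff_braid_mul hjl.symm hij.symm hil.symm f
  rw [dividedDiff_swap hjl, dividedDiff_swap hjl, dividedDiff_swap hij, dividedDiff_neg hij,
    dividedDiff_neg hjl, dividedDiff_neg hjl, Equiv.swap_comm l j, Equiv.swap_comm j i] at h2
  have h3 : rename (Equiv.swap i j) (rename (Equiv.swap j l) (rename (Equiv.swap i j) f)) =
      rename (Equiv.swap j l) (rename (Equiv.swap i j) (rename (Equiv.swap j l) f)) := by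
    simp only [rename_rename]
    congr 2
    ext a
    simp only [Function.comp_apply, Equiv.swap_apply_def]
    split_ifs <;> simp_all
  refine mul_left_cancel₀ (mul_ne_zero (mul_ne_zero (X_sub_X_ne_zero hij) (X_sub_X_ne_zero hil))
    (X_sub_X_ne_zero hjl)) ?_
  linear_combination h1 - h2 - h3

/-- The divided difference at the positions `r` and `r + 1`, as an additive endomorphism. -/
def diffOp (n r : ℕ) : AddMonoid.End (MvPolynomial (Fin n) ℂ) :=
  AddMonoidHom.mk' (fun f => if h : r + 1 < n then
    dividedDiff ⟨r, Nat.lt_of_succ_lt h⟩ ⟨r + 1, h⟩ f else 0) fun f g => by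
      split_ifs
      · exact dividedDiff_add (by simp) f g
      · rw [add_zero]

theorem diffOp_apply {r : ℕ} (h : r + 1 < n) (f : MvPolynomial (Fin n) ℂ) :
    diffOp n r f = dividedDiff ⟨r, Nat.lt_of_succ_lt h⟩ ⟨r + 1, h⟩ f := dif_pos h

theorem diffOp_eq_zero {r : ℕ} (h : ¬ r + 1 < n) : diffOp n r = 0 :=
  AddMonoidHom.ext fun _ => dif_neg h

theorem diffOp_mul_self (n r : ℕ) : diffOp n r * diffOp n r = 0 := by
  by_cases h : r + 1 < n
  · refine AddMonoidHom.ext fun f => ?_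
    change diffOp n r (diffOp n r f) = 0
    rw [diffOp_apply h, diffOp_apply h, dividedDiff_dividedDiff (by simp)]
  · rw [diffOp_eq_zero h, mul_zero]

theorem diffOp_comm {r s : ℕ} (hrs : r + 2 ≤ s) : diffOp n r * diffOp n s = diffOp n s * diffOp n r := by
  by_cases h : s + 1 < n
  · refine AddMonoidHom.ext fun f => ?_
    change diffOp n r (diffOp n s f) = diffOp n s (diffOp n r f)
    have hr : r + 1 < n := by omega
    rw [diffOp_apply h, diffOp_apply hr, diffOp_apply h, diffOp_apply hr]
    apply dividedDiff_comm <;> rw [Ne, Fin.mk.injEq] <;> omega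
  · rw [diffOp_eq_zero h, mul_zero, zero_mul]

theorem diffOp_braid {r : ℕ} (h : r + 2 < n) : diffOp n r * diffOp n (r + 1) * diffOp n r =
    diffOp n (r + 1) * diffOp n r * diffOp n (r + 1) := by
  refine AddMonoidHom.ext fun f => ?_
  change diffOp n r (diffOp n (r + 1) (diffOp n r f)) =
    diffOp n (r + 1) (diffOp n r (diffOp n (r + 1) f))
  have hr : r + 1 < n := by omega
  simp only [diffOp_apply h, diffOp_apply hr]
  apply dividedDiff_braid <;> rw [Ne, Fin.mk.injEq] <;> omega

/-- The product `∂_{m-1} ⋯ ∂_1 ∂_0` of divided differences. -/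
def insertOp (n : ℕ) : ℕ → AddMonoid.End (MvPolynomial (Fin n) ℂ)
  | 0 => 1
  | m + 1 => diffOp n m * insertOp n m

/-- The product of divided differences that belongs to the reversal of the first `m` positions. -/
def reverseOp (n : ℕ) : ℕ → AddMonoid.End (MvPolynomial (Fin n) ℂ)
  | 0 => 1
  | m + 1 => reverseOp n m * insertOp n m

theorem diffOp_comm_insertOp {r m : ℕ} (h : m + 1 ≤ r) :
    diffOp n r * insertOp n m = insertOp n m * diffOp n r := by
  induction m with
  | zero => rw [insertOp, mul_one, one_mul]
  | succ m ih =>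
    rw [insertOp, ← mul_assoc, ← diffOp_comm (by omega), mul_assoc, ih (by omega), mul_assoc]

theorem insertOp_mul_diffOp_zero {m : ℕ} (h : 1 ≤ m) : insertOp n m * diffOp n 0 = 0 := by
  induction m, h using Nat.le_induction with
  | base => rw [insertOp, insertOp, mul_one, diffOp_mul_self]
  | succ m _ ih => rw [insertOp, mul_assoc, ih, mul_zero]

/-- Passing through the cycle lowers the index of a divided difference by one; this is one braid
relation surrounded by commutations. -/
theorem insertOp_mul_diffOp_succ {r m : ℕ} (h : r + 2 ≤ m) (hm : m < n) :
    insertOp n m * diffOp n (r + 1) = diffOp n r * insertOp n m := by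
  induction m, h using Nat.le_induction with
  | base =>
    rw [insertOp, insertOp, mul_assoc, mul_assoc, ← diffOp_comm_insertOp (by omega), ← mul_assoc,
      ← mul_assoc, ← diffOp_braid (by omega), mul_assoc, mul_assoc]
  | succ m h ih =>
    rw [insertOp, mul_assoc, ih (by omega), ← mul_assoc, ← diffOp_comm (by omega), mul_assoc]

/-- The operator of the longest permutation kills divided differences on its right: passing through
the cycles lowers the index to `0`, where a square appears. -/
theorem reverseOp_mul_diffOp {r m : ℕ} (h : r + 2 ≤ m) (hm : m ≤ n) :
    reverseOp n m * diffOp n r = 0 := by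
  induction m generalizing r with
  | zero => omega
  | succ m ih =>
    rw [reverseOp, mul_assoc]
    cases r with
    | zero => rw [insertOp_mul_diffOp_zero (by omega), mul_zero]
    | succ r =>
      rw [insertOp_mul_diffOp_succ (by omega) (by omega), ← mul_assoc, ih (by omega) (by omega),
        zero_mul]

/-- The sum of `f` and its swapped version is symmetric in the two variables, hence a divided
difference, namely that of the sum times the first variable; so it is killed. -/
theorem reverseOp_swap {k r : ℕ} (hr : r + 1 < k) (hk : k ≤ n) (f : MvPolynomial (Fin n) ℂ) :
    reverseOp n k (rename (Equiv.swap ⟨r, by omega⟩ ⟨r + 1, by omega⟩) f) = -reverseOp n k f := by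
  have hrn : r + 1 < n := by omega
  have h : ∀ g, reverseOp n k (diffOp n r g) = 0 := fun g => by
    change (reverseOp n k * diffOp n r) g = 0
    rw [reverseOp_mul_diffOp (by omega) hk]; rfl
  rw [eq_neg_iff_add_eq_zero, ← map_add]
  have hne : (⟨r, Nat.lt_of_succ_lt hrn⟩ : Fin n) ≠ ⟨r + 1, hrn⟩ := by simp
  have hs : rename (Equiv.swap (⟨r, Nat.lt_of_succ_lt hrn⟩ : Fin n) ⟨r + 1, hrn⟩)
      (rename (Equiv.swap (⟨r, Nat.lt_of_succ_lt hrn⟩ : Fin n) ⟨r + 1, hrn⟩) f + f) =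
      rename (Equiv.swap (⟨r, Nat.lt_of_succ_lt hrn⟩ : Fin n) ⟨r + 1, hrn⟩) f + f := by
    rw [map_add, rename_swap_swap, add_comm]
  rw [← dividedDiff_X_mul_of_symm hne hs, ← diffOp_apply hrn]
  exact h _

theorem insertOp_mul_left {m : ℕ} (hm : m < n)
    (hg : ∀ (r : ℕ) (hr : r + 1 < n), r < m →
      rename (Equiv.swap ⟨r, Nat.lt_of_succ_lt hr⟩ ⟨r + 1, hr⟩) g = g)
    (f : MvPolynomial (Fin n) ℂ) : insertOp n m (g * f) = g * insertOp n m f := by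
  induction m with
  | zero => rfl
  | succ m ih =>
    change diffOp n m (insertOp n m (g * f)) = g * diffOp n m (insertOp n m f)
    rw [ih (by omega) fun r hr h => hg r hr (by omega), diffOp_apply hm, diffOp_apply hm,
      dividedDiff_mul_left (by simp) (hg m hm (by omega))]

theorem reverseOp_mul_left {m : ℕ} (hm : m ≤ n)
    (hg : ∀ (r : ℕ) (hr : r + 1 < n), r + 1 < m →
      rename (Equiv.swap ⟨r, Nat.lt_of_succ_lt hr⟩ ⟨r + 1, hr⟩) g = g)
    (f : MvPolynomial (Fin n) ℂ) : reverseOp n m (g * f) = g * reverseOp n m f := by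
  induction m generalizing f with
  | zero => rfl
  | succ m ih =>
    change reverseOp n m (insertOp n m (g * f)) = g * reverseOp n m (insertOp n m f)
    rw [insertOp_mul_left (by omega) fun r hr h => hg r hr (by omega),
      ih (by omega) fun r hr h => hg r hr (by omega)]

end DividedDiff

/-! ### Schubert polynomials of Grassmannian permutations -/

section Dominant
open MvPolynomial

variable {n : ℕ} {w : Equiv.Perm (Fin n)}

open Classical in
theorem schubert_of_first_ascent {r : ℕ} (hr : r + 1 < n)
    (hasc : w ⟨r, Nat.lt_of_succ_lt hr⟩ < w ⟨r + 1, hr⟩) (hmin : ∀ j < r, ¬ IsAscent w j) :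
    schubert w =
      diffOp n r (schubert (w * Equiv.swap ⟨r, Nat.lt_of_succ_lt hr⟩ ⟨r + 1, hr⟩)) := by
  have h : ∃ i, IsAscent w i := ⟨r, hr, hasc⟩
  obtain rfl : r = Nat.find h := ((Nat.find_eq_iff h).2 ⟨⟨hr, hasc⟩, hmin⟩).symm
  rw [schubert, dif_pos h, diffOp_apply hr]

theorem schubert_of_not_ascent (h : ¬ ∃ i, IsAscent w i) :
    schubert w = ∏ i : Fin n, X i ^ (n - 1 - (i : ℕ)) := by
  rw [schubert, dif_neg h]

/-- The Lehmer code of a permutation. -/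
def lehmer (w : Equiv.Perm (Fin n)) (i : Fin n) : ℕ :=
  (Finset.univ.filter fun j => i < j ∧ w j < w i).card

/-- Permutations without the pattern `132`. -/
def Dominant (w : Equiv.Perm (Fin n)) : Prop :=
  ∀ ⦃i j l : Fin n⦄, i < j → j < l → w i < w l → ¬ w l < w j

theorem lehmer_of_not_ascent (h : ¬ ∃ i, IsAscent w i) (i : Fin n) : lehmer w i = n - 1 - i := by
  have key : ∀ (d : ℕ) (i : Fin n) (hd : i + d + 1 < n), w ⟨i + d + 1, hd⟩ < w i := by
    intro d
    induction d with
    | zero =>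
      intro i hd
      refine lt_of_le_of_ne (not_lt.1 fun hlt => h ⟨i, hd, hlt⟩) fun e => ?_
      have := congrArg Fin.val (w.injective e)
      simp at this
    | succ d ih =>
      intro i hd
      refine lt_of_le_of_lt (not_lt.1 fun hlt => h ⟨i + d + 1, hd, hlt⟩) (ih i (by omega))
  have e : (Finset.univ.filter fun j => i < j ∧ w j < w i) = Finset.Ioi i := by
    ext j
    simp only [Finset.mem_filter, Finset.mem_univ, true_and, Finset.mem_Ioi, and_iff_left_iff_imp]
    intro hij
    have hij' : (i : ℕ) < j := hij
    have h1 : (i : ℕ) + (j - i - 1) + 1 = j := by omega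
    have := key (j - i - 1) i (by omega)
    simpa only [h1] using this
  rw [lehmer, e, Fin.card_Ioi]

theorem lt_swap_iff {a b i j : Fin n} (hab : (b : ℕ) = a + 1) (ha : i ≠ a) (hb : i ≠ b) :
    i < Equiv.swap a b j ↔ i < j := by
  have ha' : (i : ℕ) ≠ a := fun h => ha (Fin.ext h)
  have hb' : (i : ℕ) ≠ b := fun h => hb (Fin.ext h)
  rw [Equiv.swap_apply_def]
  split_ifs with h1 h2
  · subst h1; simp only [Fin.lt_def]; omega
  · subst h2; simp only [Fin.lt_def]; omega
  · rfl

theorem swap_lt_iff {a b i j : Fin n} (hab : (b : ℕ) = a + 1) (ha : j ≠ a) (hb : j ≠ b) :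
    Equiv.swap a b i < j ↔ i < j := by
  have ha' : (j : ℕ) ≠ a := fun h => ha (Fin.ext h)
  have hb' : (j : ℕ) ≠ b := fun h => hb (Fin.ext h)
  rw [Equiv.swap_apply_def]
  split_ifs with h1 h2
  · subst h1; simp only [Fin.lt_def]; omega
  · subst h2; simp only [Fin.lt_def]; omega
  · rfl

/-- An entry to the right of `b` with value between `w a` and `w b` would complete a pattern `132`.
-/
theorem Dominant.lehmer_eq (hw : Dominant w) {a b : Fin n} (hab : (b : ℕ) = a + 1)
    (hasc : w a < w b) : lehmer w a = lehmer w b := by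
  have hab' : a < b := Fin.lt_def.2 (by omega)
  rw [lehmer, lehmer]
  congr 1
  ext j
  simp only [Finset.mem_filter, Finset.mem_univ, true_and]
  constructor
  · rintro ⟨h1, h2⟩
    have hjb : j ≠ b := fun h => lt_asymm h2 (h ▸ hasc)
    have hjb' : (j : ℕ) ≠ b := fun h => hjb (Fin.ext h)
    exact ⟨Fin.lt_def.2 (by have := Fin.lt_def.1 h1; omega), h2.trans hasc⟩
  · rintro ⟨h1, h2⟩
    refine ⟨hab'.trans h1, lt_of_le_of_ne (not_lt.1 fun h => hw hab' h1 h h2) fun e => ?_⟩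
    exact (hab'.trans h1).ne' (w.injective e)

theorem lehmer_mul_swap_of_ne {a b i : Fin n} (hab : (b : ℕ) = a + 1) (ha : i ≠ a) (hb : i ≠ b) :
    lehmer (w * Equiv.swap a b) i = lehmer w i := by
  refine Finset.card_equiv (Equiv.swap a b) fun j => ?_
  simp only [Finset.mem_filter, Finset.mem_univ, true_and, Equiv.Perm.coe_mul,
    Function.comp_apply, Equiv.swap_apply_of_ne_of_ne ha hb, lt_swap_iff hab ha hb]

theorem lehmer_mul_swap_left {a b : Fin n} (hab : (b : ℕ) = a + 1) (hasc : w a < w b) :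
    lehmer (w * Equiv.swap a b) a = lehmer w b + 1 := by
  have hb : b ∉ Finset.univ.filter fun j => b < j ∧ w j < w b := by simp
  rw [lehmer, lehmer, ← Finset.card_insert_of_notMem hb]
  congr 1
  ext j
  simp only [Finset.mem_filter, Finset.mem_univ, true_and, Finset.mem_insert, Equiv.Perm.coe_mul,
    Function.comp_apply, Equiv.swap_apply_left]
  by_cases hj : j = b
  · subst hj
    simp only [Equiv.swap_apply_right, true_or, iff_true]
    exact ⟨Fin.lt_def.2 (by omega), hasc⟩
  · have hj' : (j : ℕ) ≠ b := fun h => hj (Fin.ext h)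
    simp only [hj, false_or]
    by_cases hja : j = a
    · subst hja
      simp only [lt_self_iff_false, false_and, false_iff, not_and]
      intro h; have := Fin.lt_def.1 h; omega
    · rw [Equiv.swap_apply_of_ne_of_ne hja hj]
      have : a < j ↔ b < j := by
        simp only [Fin.lt_def]; omega
      rw [this]

theorem lehmer_mul_swap_right {a b : Fin n} (hab : (b : ℕ) = a + 1) (hasc : w a < w b) :
    lehmer (w * Equiv.swap a b) b = lehmer w a := by
  rw [lehmer, lehmer]
  congr 1
  ext j
  simp only [Finset.mem_filter, Finset.mem_univ, true_and, Equiv.Perm.coe_mul,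
    Function.comp_apply, Equiv.swap_apply_right]
  constructor
  · rintro ⟨h1, h2⟩
    have h1' := Fin.lt_def.1 h1
    have hja : j ≠ a := fun h => by subst h; omega
    rw [Equiv.swap_apply_of_ne_of_ne hja h1.ne'] at h2
    exact ⟨Fin.lt_def.2 (by omega), h2⟩
  · rintro ⟨h1, h2⟩
    have h1' := Fin.lt_def.1 h1
    have hjb : j ≠ b := fun h => lt_asymm h2 (h ▸ hasc)
    have hjb' : (j : ℕ) ≠ b := fun h => hjb (Fin.ext h)
    rw [Equiv.swap_apply_of_ne_of_ne h1.ne' hjb]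
    exact ⟨Fin.lt_def.2 (by omega), h2⟩

/-- The swap reverses the order of the positions `a`, `b` only, so a new pattern `132` would have to
use both as neighbours. As its last two, it contradicts that the entries decrease up to the first
ascent; as its first two, it contradicts the descent created by the swap. -/
theorem Dominant.mul_swap (hw : Dominant w) {r : ℕ} (hr : r + 1 < n)
    (hasc : w ⟨r, Nat.lt_of_succ_lt hr⟩ < w ⟨r + 1, hr⟩) (hmin : ∀ j < r, ¬ IsAscent w j) :
    Dominant (w * Equiv.swap ⟨r, Nat.lt_of_succ_lt hr⟩ ⟨r + 1, hr⟩) := by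
  obtain ⟨a, ha⟩ : ∃ a : Fin n, a = ⟨r, Nat.lt_of_succ_lt hr⟩ := ⟨_, rfl⟩
  obtain ⟨b, hb⟩ : ∃ b : Fin n, b = ⟨r + 1, hr⟩ := ⟨_, rfl⟩
  rw [← ha, ← hb] at hasc ⊢
  have hab : (b : ℕ) = a + 1 := by rw [ha, hb]
  have hdec : ∀ i : Fin n, i < a → w a < w i := by
    have key : ∀ (d : ℕ) (i : Fin n) (hd : i + d + 1 ≤ r), w ⟨i + d + 1, by omega⟩ < w i := by
      intro d
      induction d with
      | zero =>
        intro i hd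
        refine lt_of_le_of_ne (not_lt.1 fun hlt => hmin i (by omega) ⟨by omega, hlt⟩) fun e => ?_
        have := congrArg Fin.val (w.injective e)
        simp at this
      | succ d ih =>
        intro i hd
        exact lt_of_le_of_lt (not_lt.1 fun hlt => hmin (i + d + 1) (by omega) ⟨by omega, hlt⟩)
          (ih i (by omega))
    intro i hi
    have hi' : (i : ℕ) < r := by rw [ha] at hi; exact hi
    have h1 : (i : ℕ) + (r - i - 1) + 1 = r := by omega
    have := key (r - i - 1) i (by omega)
    simpa only [h1, ← ha] using this
  intro i j l hij hjl h1 h2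
  simp only [Equiv.Perm.coe_mul, Function.comp_apply] at h1 h2
  by_cases h : j = a ∧ l = b
  · obtain ⟨rfl, rfl⟩ := h
    have hil : i ≠ l := (hij.trans hjl).ne
    rw [Equiv.swap_apply_of_ne_of_ne hij.ne hil, Equiv.swap_apply_right] at h1
    exact lt_asymm h1 (hdec i hij)
  · have hlt : ∀ {p q : Fin n}, p < q → ¬ (p = a ∧ q = b) →
        Equiv.swap a b p < Equiv.swap a b q := by
      intro p q hpq hn
      have hpq' := Fin.lt_def.1 hpq
      by_cases hpa : p = a
      · have hqb : q ≠ b := fun h => hn ⟨hpa, h⟩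
        have hqa : q ≠ a := fun h => hpq.ne (hpa.trans h.symm)
        rw [Equiv.swap_apply_of_ne_of_ne hqa hqb]
        exact (swap_lt_iff hab hqa hqb).2 hpq
      · by_cases hpb : p = b
        · have hqb : q ≠ b := fun h => hpq.ne (hpb.trans h.symm)
          have hqa : q ≠ a := fun h => by subst h hpb; omega
          rw [Equiv.swap_apply_of_ne_of_ne hqa hqb]
          exact (swap_lt_iff hab hqa hqb).2 hpq
        · rw [Equiv.swap_apply_of_ne_of_ne hpa hpb]
          exact (lt_swap_iff hab hpa hpb).2 hpq
    by_cases h' : i = a ∧ j = b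
    · obtain ⟨rfl, rfl⟩ := h'
      have hla : l ≠ i := (hij.trans hjl).ne'
      rw [Equiv.swap_apply_left, Equiv.swap_apply_of_ne_of_ne hla hjl.ne'] at h1
      rw [Equiv.swap_apply_right, Equiv.swap_apply_of_ne_of_ne hla hjl.ne'] at h2
      exact lt_asymm hasc (h1.trans h2)
    · exact hw (hlt hij h') (hlt hjl h) h1 h2

/-- For a dominant permutation the code takes equal values at both positions of an ascent, and the
swap at the first ascent raises the code by one at the left position. So the divided difference is
applied to `x_a` times a monomial that is symmetric in the two variables. -/
theorem Dominant.schubert_eq (hw : Dominant w) :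
    schubert w = ∏ i : Fin n, X i ^ lehmer w i := by
  induction hm : ∑ i : Fin n, (i : ℕ) * (w i : ℕ) using Nat.strong_induction_on generalizing w with
  | _ m ih =>
  by_cases h : ∃ i, IsAscent w i
  · classical
    obtain ⟨hr, hasc⟩ := Nat.find_spec h
    have hmin : ∀ j < Nat.find h, ¬ IsAscent w j := fun j hj => Nat.find_min h hj
    revert hr hasc hmin
    generalize Nat.find h = r
    intro hr hasc hmin
    rw [schubert_of_first_ascent hr hasc hmin, diffOp_apply hr,
      ih _ (hm ▸ sum_mul_swap_lt w _ _ (Fin.mk_lt_mk.2 (Nat.lt_succ_self _)) hasc)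
        (hw.mul_swap hr hasc hmin) rfl]
    have hw1 := hw.lehmer_eq (a := ⟨r, Nat.lt_of_succ_lt hr⟩) (b := ⟨r + 1, hr⟩) rfl hasc
    have hl := lehmer_mul_swap_left (w := w) (a := ⟨r, Nat.lt_of_succ_lt hr⟩)
      (b := ⟨r + 1, hr⟩) rfl hasc
    have hr' := lehmer_mul_swap_right (w := w) (a := ⟨r, Nat.lt_of_succ_lt hr⟩)
      (b := ⟨r + 1, hr⟩) rfl hasc
    have hne := fun i => lehmer_mul_swap_of_ne (w := w) (a := ⟨r, Nat.lt_of_succ_lt hr⟩)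
      (b := ⟨r + 1, hr⟩) (i := i) rfl
    have hab : (⟨r, Nat.lt_of_succ_lt hr⟩ : Fin n) ≠ ⟨r + 1, hr⟩ := by simp
    revert hw1 hl hr' hne hab
    generalize (⟨r, Nat.lt_of_succ_lt hr⟩ : Fin n) = a, (⟨r + 1, hr⟩ : Fin n) = b
    intro hw1 hl hr' hne hab
    have hcode : ∀ i, lehmer (w * Equiv.swap a b) i = (if i = a then 1 else 0) + lehmer w i := by
      intro i
      by_cases hia : i = a
      · subst hia
        rw [hl, if_pos rfl, hw1, add_comm]
      · rw [if_neg hia, zero_add]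
        by_cases hib : i = b
        · subst hib
          rw [hr', hw1]
        · exact hne i hia hib
    have hsymm : rename (Equiv.swap a b) (∏ i : Fin n, (X i : MvPolynomial (Fin n) ℂ) ^ lehmer w i) =
        ∏ i : Fin n, X i ^ lehmer w i := by
      rw [map_prod, ← Equiv.prod_comp (Equiv.swap a b)]
      refine Finset.prod_congr rfl fun i _ => ?_
      rw [map_pow, rename_X, Equiv.swap_apply_self]
      congr 1
      rw [Equiv.swap_apply_def]
      split_ifs with h1 h2
      · rw [h1, hw1]
      · rw [h2, hw1]
      · rfl
    have hprod : ∏ i : Fin n, (X i : MvPolynomial (Fin n) ℂ) ^ lehmer (w * Equiv.swap a b) i =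
        X a * ∏ i : Fin n, X i ^ lehmer w i := by
      simp only [hcode, pow_add, Finset.prod_mul_distrib]
      congr 1
      simp [Finset.prod_ite_eq']
    rw [hprod, dividedDiff_X_mul_of_symm hab hsymm]
  · rw [schubert_of_not_ascent h]
    exact Finset.prod_congr rfl fun i _ => by rw [lehmer_of_not_ascent h]

/-- Position `p` holds the entry `m` and the other positions up to `m` hold the smaller entries in
decreasing order. -/
def insertPos (m p i : ℕ) : ℕ :=
  if i < p then m - 1 - i else if i = p then m else if i ≤ m then m - i else i

/-- The recursion for `schubert` takes the first ascent, so this follows that particular chain: the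
largest of the first entries wanders to the left, one position at a time, through a decreasing
sequence. -/
theorem exists_schubert_insert {V : ℕ → ℕ} {m p : ℕ} (hm : m < n) (hp : p ≤ m)
    (hV : ∀ i j, i < j → j ≤ m → V i < V j) (hw : ∀ i, (w i : ℕ) = V (insertPos m p i)) :
    ∃ w' : Equiv.Perm (Fin n), (∀ i, (w' i : ℕ) = V (insertPos m 0 i)) ∧
      schubert w = insertOp n p (schubert w') := by
  induction p generalizing w with
  | zero => exact ⟨w, hw, rfl⟩
  | succ p ih =>
    have hr : p + 1 < n := by omega
    have h1 : insertPos m (p + 1) (p + 1) = m := by simp [insertPos]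
    have hlt : ∀ i, i < p + 1 → insertPos m (p + 1) i = m - 1 - i := fun i hi => if_pos hi
    have hasc : w ⟨p, Nat.lt_of_succ_lt hr⟩ < w ⟨p + 1, hr⟩ := by
      rw [Fin.lt_def, hw, hw, h1, hlt p (by omega)]
      exact hV _ _ (by omega) le_rfl
    have hmin : ∀ j < p, ¬ IsAscent w j := by
      rintro j hj ⟨h, h'⟩
      rw [Fin.lt_def, hw, hw, hlt j (by omega), hlt (j + 1) (by omega)] at h'
      exact lt_asymm h' (hV _ _ (by omega) (by omega))
    obtain ⟨w', hw', e⟩ := ih (w := w * Equiv.swap ⟨p, Nat.lt_of_succ_lt hr⟩ ⟨p + 1, hr⟩)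
      (by omega) (by
        intro i
        rw [Equiv.Perm.coe_mul, Function.comp_apply, hw, Equiv.swap_apply_def]
        congr 1
        split_ifs with h2 h3
        · subst h2
          simp [insertPos]
        · subst h3
          simp only [insertPos]
          split_ifs <;> omega
        · have h2' : (i : ℕ) ≠ p := fun h => h2 (Fin.ext h)
          have h3' : (i : ℕ) ≠ p + 1 := fun h => h3 (Fin.ext h)
          simp only [insertPos]
          split_ifs <;> omega)
    refine ⟨w', hw', ?_⟩
    rw [schubert_of_first_ascent hr hasc hmin, e]
    rfl

theorem exists_schubert_reverse {V : ℕ → ℕ} {k m : ℕ} (hk : k ≤ n) (hm : m ≤ k)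
    (hV : ∀ i j, i < j → j < k → V i < V j) (hw : ∀ i, (w i : ℕ) = V i) :
    ∃ w' : Equiv.Perm (Fin n), (∀ i : Fin n, (w' i : ℕ) = V (if (i : ℕ) < m then m - 1 - i else i)) ∧
      schubert w = reverseOp n m (schubert w') := by
  induction m with
  | zero => exact ⟨w, by simpa using hw, rfl⟩
  | succ m ih =>
    obtain ⟨w₁, h1, e1⟩ := ih (by omega)
    obtain ⟨w', h2, e2⟩ := exists_schubert_insert (w := w₁) (V := V) (m := m) (p := m) (by omega)
      le_rfl (fun i j h h' => hV i j h (by omega)) (fun i => by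
        rw [h1]; congr 1; simp only [insertPos]; split_ifs <;> omega)
    refine ⟨w', fun i => ?_, ?_⟩
    · rw [h2]; congr 1; simp only [insertPos]; split_ifs <;> omega
    · rw [e1, e2]; rfl

/-- Reversing the increasing entries at the first `k` positions gives a permutation that decreases
there and increases afterwards. It avoids `132`, so its Schubert polynomial is a monomial. -/
theorem schubert_eq_reverseOp {k : ℕ} (hk : k ≤ n) (V : ℕ → ℕ)
    (hV : ∀ i j, i < j → j < k → V i < V j) (hw : ∀ i, (w i : ℕ) = V i)
    (htail : ∀ i j : Fin n, k ≤ (i : ℕ) → i < j → w i < w j) :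
    schubert w = reverseOp n k (∏ i : Fin n, X i ^ if (i : ℕ) < k then V (k - 1 - i) else 0) := by
  obtain ⟨w', h1, e⟩ := exists_schubert_reverse hk le_rfl hV hw
  have htail' : ∀ i j : Fin n, k ≤ (i : ℕ) → i < j → w' i < w' j := by
    intro i j hi hij
    have hj := Fin.lt_def.1 hij
    rw [Fin.lt_def, h1, h1, if_neg (by omega), if_neg (by omega), ← hw, ← hw]
    exact htail i j hi hij
  have hhead : ∀ i j : Fin n, i < j → (j : ℕ) < k → w' j < w' i := by
    intro i j hij hj
    have hij' := Fin.lt_def.1 hij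
    rw [Fin.lt_def, h1, h1, if_pos (by omega), if_pos (by omega)]
    exact hV _ _ (by omega) (by omega)
  have hd : Dominant w' := by
    intro i j l hij hjl h2 h3
    by_cases hj : (j : ℕ) < k
    · exact lt_asymm (h2.trans h3) (hhead i j hij hj)
    · exact lt_asymm h3 (htail' j l (by omega) hjl)
  rw [e, hd.schubert_eq]
  congr 1
  refine Finset.prod_congr rfl fun i _ => ?_
  congr 1
  split_ifs with hi
  · have := h1 i
    rw [if_pos hi] at this
    -- Earlier entries are larger, so all values below `w' i` stand to the right of `i` and the code
    -- at `i` is `w' i`.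
    rw [← this, ← Fin.card_Iio (w' i), lehmer]
    refine Finset.card_equiv w' fun j => ?_
    simp only [Finset.mem_filter, Finset.mem_univ, true_and, Finset.mem_Iio, and_iff_right_iff_imp]
    intro hj
    by_contra hij
    rcases lt_or_eq_of_le (not_lt.1 hij) with h | h
    · exact lt_asymm hj (hhead j i h hi)
    · exact hj.ne (congrArg w' h)
  · rw [lehmer, Finset.card_eq_zero, Finset.filter_eq_empty_iff]
    rintro j - ⟨h2, h3⟩
    exact lt_asymm h3 (htail' i j (by omega) h2)

end Dominant

/-! ### Schubert polynomials of Grassmannian permutations are Schur polynomials -/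

section Grassmannian
open MvPolynomial

variable {n k : ℕ} {w : Equiv.Perm (Fin n)}

/-- The monomial `x^{λ+δ}` in `k` variables. -/
def alternantMonomial (k : ℕ) (lam : List ℕ) : MvPolynomial (Fin k) ℂ :=
  ∏ i : Fin k, X i ^ (lam.getD (i : ℕ) 0 + (k - 1 - (i : ℕ)))

theorem alternant_eq_sum (k : ℕ) (lam : List ℕ) : alternant k lam =
    ∑ σ : Equiv.Perm (Fin k), Equiv.Perm.sign σ • rename σ (alternantMonomial k lam) := by
  rw [alternant, Matrix.det_apply]
  refine Finset.sum_congr rfl fun σ _ => ?_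
  simp only [alternantMonomial, map_prod, map_pow, rename_X, Matrix.of_apply]

theorem rename_alternant (σ : Equiv.Perm (Fin k)) (lam : List ℕ) :
    rename σ (alternant k lam) = Equiv.Perm.sign σ • alternant k lam := by
  have : rename σ (alternant k lam) = ((Matrix.of fun i j : Fin k =>
      (X i : MvPolynomial (Fin k) ℂ) ^ (lam.getD (j : ℕ) 0 + (k - 1 - (j : ℕ)))).submatrix σ
        id).det := by
    rw [alternant, AlgHom.map_det]
    congr 1
    ext1 i j
    simp
  rw [this, Matrix.det_permute, Units.smul_def, zsmul_eq_mul, alternant]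

theorem rename_schur (σ : Equiv.Perm (Fin k)) (lam : List ℕ) :
    rename σ (schur k lam) = schur k lam := by
  have h := congrArg (rename σ) (schur_spec k lam)
  rw [map_mul, rename_alternant, rename_alternant, schur_spec k lam, smul_mul_assoc] at h
  exact (mul_left_cancel₀ (alternant_nil_ne_zero k) (smul_left_cancel _ h)).symm

theorem rename_swap_castLE (hk : k ≤ n) {r : ℕ} (hr : r + 1 < k) (f : MvPolynomial (Fin k) ℂ) :
    rename (Equiv.swap (⟨r, by omega⟩ : Fin n) ⟨r + 1, by omega⟩) (rename (Fin.castLE hk) f) =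
      rename (Fin.castLE hk) (rename (Equiv.swap (⟨r, by omega⟩ : Fin k) ⟨r + 1, hr⟩) f) := by
  rw [rename_rename, rename_rename]
  congr 2
  ext i
  simp only [Function.comp_apply, Equiv.swap_apply_def, Fin.ext_iff, Fin.val_castLE]
  split_ifs <;> simp_all

/-- Adjacent transpositions generate the symmetric group, and `reverseOp_swap` gives their sign. -/
theorem reverseOp_rename (hk : k ≤ n) (σ : Equiv.Perm (Fin k)) (f : MvPolynomial (Fin k) ℂ) :
    reverseOp n k (rename (Fin.castLE hk) (rename σ f)) =
      Equiv.Perm.sign σ • reverseOp n k (rename (Fin.castLE hk) f) := by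
  obtain _ | m := k
  · obtain rfl : σ = 1 := Subsingleton.elim _ _
    rw [Equiv.Perm.coe_one, rename_id_apply, Equiv.Perm.sign_one, one_smul]
  have hσ : σ ∈ Submonoid.closure
      (Set.range fun i : Fin m => Equiv.swap i.castSucc i.succ) := by
    rw [Equiv.Perm.mclosure_swap_castSucc_succ]; trivial
  induction hσ using Submonoid.closure_induction generalizing f with
  | mem σ h =>
    obtain ⟨i, rfl⟩ := h
    have hne : i.castSucc ≠ i.succ := by simp [Fin.ext_iff]
    have := rename_swap_castLE hk (r := i) (by omega) f
    change rename _ _ = rename (Fin.castLE hk) (rename (Equiv.swap i.castSucc i.succ) f) at this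
    rw [← this, reverseOp_swap (by omega) hk, Equiv.Perm.sign_swap hne, Units.neg_smul, one_smul]
  | one => rw [Equiv.Perm.coe_one, rename_id_apply, Equiv.Perm.sign_one, one_smul]
  | mul σ τ _ _ h1 h2 =>
    rw [Equiv.Perm.coe_mul, ← rename_rename, h1, h2, smul_smul, Equiv.Perm.sign_mul]

/-- The alternant is the signed sum over the images of the monomial, and each summand has the same
image under the antisymmetric operator. -/
theorem reverseOp_alternant (hk : k ≤ n) (lam : List ℕ) :
    reverseOp n k (rename (Fin.castLE hk) (alternant k lam)) =
      k.factorial • reverseOp n k (rename (Fin.castLE hk) (alternantMonomial k lam)) := by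
  rw [alternant_eq_sum, map_sum, map_sum]
  have : ∀ σ ∈ (Finset.univ : Finset (Equiv.Perm (Fin k))),
      reverseOp n k (rename (Fin.castLE hk)
        (Equiv.Perm.sign σ • rename σ (alternantMonomial k lam))) =
      reverseOp n k (rename (Fin.castLE hk) (alternantMonomial k lam)) := by
    intro σ _
    rw [Units.smul_def, map_zsmul, map_zsmul, reverseOp_rename, ← Units.smul_def, smul_smul,
      Int.units_mul_self, one_smul]
  rw [Finset.sum_congr rfl this, Finset.sum_const, Finset.card_univ, Fintype.card_perm,
    Fintype.card_fin]

theorem IsGrassmannianPerm.schubert_eq_reverseOp {lam : List ℕ}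
    (hw : IsGrassmannianPerm n k lam w) (hk : k ≤ n)
    (hlam : ∀ p q, p ≤ q → lam.getD q 0 ≤ lam.getD p 0) :
    schubert w = reverseOp n k (rename (Fin.castLE hk) (alternantMonomial k lam)) := by
  have hV : ∀ i (h : i < n), i < k → (w ⟨i, h⟩ : ℕ) = lam.getD (k - 1 - i) 0 + i :=
    fun i h hi => hw.head ⟨i, h⟩ hi
  rw [FominKirillov.schubert_eq_reverseOp hk (fun i => if h : i < n then (w ⟨i, h⟩ : ℕ) else 0)
    ?_ (fun i => by simp) hw.tail]
  · congr 1
    rw [alternantMonomial, map_prod]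
    trans ∏ i ∈ Finset.univ.map (Fin.castLEEmb hk), (X i : MvPolynomial (Fin n) ℂ) ^
      (lam.getD (i : ℕ) 0 + (k - 1 - (i : ℕ)))
    · symm
      refine Finset.prod_subset_one_on_sdiff (Finset.subset_univ _) ?_ ?_
      · intro i hi
        rw [if_neg, pow_zero]
        intro h
        refine (Finset.mem_sdiff.1 hi).2 (Finset.mem_map.2 ⟨⟨i, h⟩, Finset.mem_univ _, rfl⟩)
      · intro i hi
        obtain ⟨j, -, rfl⟩ := Finset.mem_map.1 hi
        have hj := j.2
        rw [Fin.coe_castLEEmb, Fin.val_castLE, if_pos hj, dif_pos (by omega),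
          hV _ _ (by omega), show k - 1 - (k - 1 - (j : ℕ)) = j by omega]
    · rw [Finset.prod_map]
      simp
  · intro i j hij hj
    rw [dif_pos (by omega), dif_pos (by omega), hV _ _ (by omega), hV _ _ hj]
    have := hlam (k - 1 - j) (k - 1 - i) (by omega)
    omega

theorem schubert_one : schubert (1 : Equiv.Perm (Fin n)) = 1 := by
  have hd : Dominant (1 : Equiv.Perm (Fin n)) := fun i j l _ hjl _ h => lt_asymm hjl h
  rw [hd.schubert_eq]
  refine Finset.prod_eq_one fun i _ => ?_
  rw [lehmer, Finset.filter_false_of_mem, Finset.card_empty, pow_zero]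
  rintro j - ⟨h1, h2⟩
  exact lt_asymm h1 h2

/-- The identity is the Grassmannian permutation of the empty partition, and its Schubert polynomial
is `1`; this replaces a direct computation of the operator on `x^δ`. -/
theorem reverseOp_alternantMonomial_nil (hk : k ≤ n) :
    reverseOp n k (rename (Fin.castLE hk) (alternantMonomial k [])) = 1 := by
  have h : IsGrassmannianPerm n k [] 1 := ⟨fun i _ => by simp, fun i j _ h => h⟩
  rw [← h.schubert_eq_reverseOp hk (by simp), schubert_one]

/-- The Schubert polynomial of a Grassmannian permutation is a Schur polynomial. -/
theorem IsGrassmannianPerm.schubert_eq_schur {lam : List ℕ} (hw : IsGrassmannianPerm n k lam w)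
    (hk : k ≤ n) (hlam : ∀ p q, p ≤ q → lam.getD q 0 ≤ lam.getD p 0) :
    schubert w = rename (Fin.castLE hk) (schur k lam) := by
  rw [hw.schubert_eq_reverseOp hk hlam]
  -- After multiplication by `k!` the monomial may be replaced by the alternant `a_δ s_λ`; the
  -- symmetric factor `s_λ` passes through the operator, and `a_δ` is sent to `k!`.
  refine smul_right_injective _ k.factorial_ne_zero ?_
  dsimp only
  rw [← reverseOp_alternant, schur_spec, mul_comm, map_mul, reverseOp_mul_left hk,
    reverseOp_alternant, reverseOp_alternantMonomial_nil, mul_smul_comm, mul_one]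
  intro r hr hrk
  rw [rename_swap_castLE hk hrk, rename_schur]

end Grassmannian

theorem getD_hookPlusBox_antitone {a b : ℕ} (ha : 1 ≤ a) (hb : 2 ≤ b) (p q : ℕ) (h : p ≤ q) :
    (hookPlusBox a b).getD q 0 ≤ (hookPlusBox a b).getD p 0 := by
  rw [getD_hookPlusBox ha, getD_hookPlusBox ha]
  split_ifs <;> omega

end FominKirillov
end

theorem theorem5p2 (n k a b : ℕ) (ha : 1 ≤ a) (hb : 2 ≤ b) (hk : a + 1 ≤ k) (hn : k + b ≤ n)
    (w : Equiv.Perm (Fin n))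
    (hw : FominKirillov.IsGrassmannianPerm n k (FominKirillov.hookPlusBox a b) w) :
    FominKirillov.evalDunkl n (FominKirillov.schubert w) =
        FominKirillov.evalDunkl n
          (MvPolynomial.rename (Fin.castLE (Nat.le_of_add_right_le hn))
            (FominKirillov.schur k (FominKirillov.hookPlusBox a b))) ∧
      FominKirillov.evalDunkl n (FominKirillov.schubert w) ∈ FominKirillov.cone n := by
  have h := hw.schubert_eq_schur (Nat.le_of_add_right_le hn)
    (FominKirillov.getD_hookPlusBox_antitone ha hb)
  refine ⟨by rw [h], ?_⟩
  -- In `hookPoly` the first row has one box more than the first argument, so the hook `(b, 1^a)`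
  -- has first argument `b - 1`.
  obtain ⟨c, rfl⟩ : ∃ c, b = c + 1 := ⟨b - 1, by omega⟩
  rw [h, FominKirillov.schur_hookPlusBox ha hk]
  exact FominKirillov.evalDunkl_hookPlusBox_mem _ c a
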